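/- Let $G$ be a finite simple connected graph. Let $EV(G)$ (the E-subgraph of $G$) denote the subgraph of $G$ induced by the vertices of even degree in $G$. A path decomposition of $G$ is a collection of pairwise edge-disjoint paths of $G$ that together cover all edges of $G$, and the path number $\mathrm{pn}(G)$ is the minimum cardinality of a path decomposition of $G$. If the maximum degree satisfies $\Delta(EV(G)) \le 3$, then $$\mathrm{pn}(G) \le \left\lceil \frac{|V(G)|}{2} \right\rceil .$$ -/

import Mathlib

namespace SimpleGraph

/-- A subgraph of `G` is a path if it consists of the vertices and edges of a walk of `G` with
pairwise distinct vertices. -/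
def Subgraph.IsPathSubgraph {V : Type*} {G : SimpleGraph V} (P : G.Subgraph) : Prop :=
  ∃ (u v : V) (p : G.Walk u v), p.IsPath ∧ p.toSubgraph = P

/-- A finite collection of pairwise edge-disjoint paths of `G` that covers the edges of `G`. -/
structure IsPathDecomposition {V : Type*} (G : SimpleGraph V) (D : Finset G.Subgraph) : Prop where
  isPath : ∀ P ∈ D, P.IsPathSubgraph
  edgeDisjoint : ∀ P ∈ D, ∀ Q ∈ D, P ≠ Q → Disjoint P.edgeSet Q.edgeSet
  covers : ∀ e ∈ G.edgeSet, ∃ P ∈ D, e ∈ P.edgeSet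

/-- The path number `pn(G)`: the least cardinality of a path decomposition of `G`. -/
noncomputable def pathNumber {V : Type*} (G : SimpleGraph V) : ℕ :=
  sInf {k : ℕ | ∃ D : Finset G.Subgraph, G.IsPathDecomposition D ∧ D.card = k}

/-- A finite graph has a path decomposition (its single edges), so the minimum defining
`pathNumber` is taken over a nonempty set. -/
theorem exists_isPathDecomposition {V : Type*} [Finite V] (G : SimpleGraph V) :
    ∃ D : Finset G.Subgraph, G.IsPathDecomposition D := by
  classical
  have hfin : {P : G.Subgraph | ∃ (u v : V) (h : G.Adj u v), G.subgraphOfAdj h = P}.Finite :=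
    Set.toFinite _
  refine ⟨hfin.toFinset, ?_, ?_, ?_⟩
  · intro P hP
    obtain ⟨u, v, h, rfl⟩ := by simpa using hP
    refine ⟨u, v, h.toWalk, ?_, ?_⟩
    · simp [h.ne]
    · simp [Adj.toWalk]
  · intro P hP Q hQ hne
    obtain ⟨u, v, h, rfl⟩ := by simpa using hP
    obtain ⟨x, y, h', rfl⟩ := by simpa using hQ
    rw [edgeSet_subgraphOfAdj, edgeSet_subgraphOfAdj, Set.disjoint_singleton]
    intro heq
    apply hne
    rcases Sym2.eq_iff.1 heq with ⟨rfl, rfl⟩ | ⟨rfl, rfl⟩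
    · rfl
    · exact (subgraphOfAdj_symm h').symm ▸ rfl
  · intro e he
    induction e with
    | _ u v =>
      have h : G.Adj u v := he
      refine ⟨G.subgraphOfAdj h, ?_, by simp [edgeSet_subgraphOfAdj]⟩
      simp only [Set.Finite.mem_toFinset, Set.mem_ofPred_eq]
      exact ⟨u, v, h, rfl⟩

/-- The path number is attained by a path decomposition. -/
theorem exists_isPathDecomposition_card_eq_pathNumber {V : Type*} [Finite V]
    (G : SimpleGraph V) :
    ∃ D : Finset G.Subgraph, G.IsPathDecomposition D ∧ D.card = G.pathNumber := by
  obtain ⟨D, hD⟩ := G.exists_isPathDecomposition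
  exact Nat.sInf_mem
    (s := {k : ℕ | ∃ D : Finset G.Subgraph, G.IsPathDecomposition D ∧ D.card = k})
    ⟨D.card, D, hD, rfl⟩

/-- The E-subgraph `EV(G)`: the subgraph of `G` induced by its vertices of even degree. -/
abbrev evenSubgraph {V : Type*} [Fintype V] (G : SimpleGraph V) [DecidableRel G.Adj] :
    SimpleGraph {v : V | Even (G.degree v)} :=
  G.induce {v : V | Even (G.degree v)}

end SimpleGraph

/-! Write E for the E-subgraph and n for the number of vertices. Induction on the number of edges
proves the sharper bound of at most n/2 paths for admissible graphs: E has maximum degree at most 3,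
and every component of E that is a triangle has a suitable odd vertex next to it (`IsGood`). Some
condition on triangles is needed, since the graph that is just a triangle has n = 3 and needs two
paths.

The engine is `IsPathFamily.exists_move`. Let an edge from a to some b in B be wanted. A path that
ends at b and avoids a is simply extended. If it passes through a, with c just before a, reversing
its initial segment trades the edge ac for ab and moves the end from b to c; now ac has to be put
back, and the argument repeats at c. Counting the edges at a shows that some such chain succeeds as
soon as the ends at B outnumber the neighbours of a without ends.

Degree plus number of path ends is even at each vertex, so every odd vertex carries an end. Each
reduction therefore deletes edges so that the relevant even vertices become odd, applies induction,
and puts the edges back, paying for each with an end. `Realizable` is the ledger of guaranteed ends,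
and `Realizable.star` restores a whole star: half of the edges bring ends to the centre, which then
pays for the other half.

Vertices of degree 3 or 1 in E, and paths on four vertices whose inner vertices have degree 2 in E,
are reducible, so E may be assumed to consist of isolated vertices and triangles. An odd vertex with
even neighbours is then reducible by a star (`realizable_of_not_isStuck`), unless it has at least
two of them and all lie in one triangle. In that stuck case, goodness supplies a further neighbour
through which the surplus end of the triangle can be passed on (`realizable_of_isStuck`). If all
even vertices are isolated in G, two edges at a vertex are replaced by one edge to an isolated
vertex, added if necessary (`realizable_of_isolated`).

Finally, in a connected graph a triangle that is not good dominates everything, so its vertices are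
the only even ones and n is odd. Deleting one of its edges leaves an admissible graph, and that edge
is one extra path: (n - 1)/2 + 1 paths in all. -/

/-! ### Consecutive elements of lists, which model the edges of paths. -/

section Consecutive

open Finset SimpleGraph

variable {V : Type*}

/-- The vertices `u` and `v` are consecutive in the list `l`, in one of the two orders. -/
def Consec (l : List V) (u v : V) : Prop := [u, v] <:+: l ∨ [v, u] <:+: l

theorem pair_infix_append {l₁ l₂ : List V} {u v : V} :
    [u, v] <:+: l₁ ++ l₂ ↔
      [u, v] <:+: l₁ ∨ [u, v] <:+: l₂ ∨ (l₁.getLast? = some u ∧ l₂.head? = some v) := by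
  induction l₁ with
  | nil => simp
  | cons a l₁ ih =>
    rw [List.cons_append, List.infix_cons_iff, List.infix_cons_iff, ih]
    cases l₁ with
    | nil =>
      cases l₂ with
      | nil => simp
      | cons b l₂ =>
        have h : ([a] : List V) ≠ [u, v] := by simp
        simp only [List.nil_append, List.cons_prefix_cons, List.nil_prefix, and_true,
          List.prefix_nil, List.infix_nil, List.getLast?_singleton, List.head?_cons,
          Option.some.injEq]
        simp only [reduceCtorEq, and_false, false_or, eq_comm (a := a), eq_comm (a := b)]
        tauto
    | cons b l₁ =>
      simp only [List.cons_append, List.cons_prefix_cons, List.nil_prefix, List.getLast?_cons_cons]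
      tauto

theorem consec_comm {l : List V} {u v : V} : Consec l u v ↔ Consec l v u := or_comm

theorem consec_reverse {l : List V} {u v : V} : Consec l.reverse u v ↔ Consec l u v := by
  have h : ∀ u v : V, [u, v] <:+: l.reverse ↔ [v, u] <:+: l := fun u v => by
    rw [← List.reverse_infix]; simp
  rw [Consec, Consec, h, h, or_comm]

theorem consec_append {l₁ l₂ : List V} {u v : V} :
    Consec (l₁ ++ l₂) u v ↔ Consec l₁ u v ∨ Consec l₂ u v ∨
      (l₁.getLast? = some u ∧ l₂.head? = some v) ∨
      (l₁.getLast? = some v ∧ l₂.head? = some u) := by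
  simp only [Consec, pair_infix_append]; tauto

theorem not_consec_nil {u v : V} : ¬ Consec [] u v := by simp [Consec]

theorem not_consec_singleton {a u v : V} : ¬ Consec [a] u v := by
  simp [Consec, List.infix_cons_iff, List.cons_prefix_cons]

theorem consec_cons {l : List V} {a u v : V} :
    Consec (a :: l) u v ↔
      Consec l u v ∨ (a = u ∧ l.head? = some v) ∨ (a = v ∧ l.head? = some u) := by
  rw [← List.singleton_append, consec_append]
  simp [not_consec_singleton]

theorem Consec.mem_left {l : List V} {u v : V} (h : Consec l u v) : u ∈ l := by
  rcases h with h | h <;> exact h.subset (by simp)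

theorem Consec.mem_right {l : List V} {u v : V} (h : Consec l u v) : v ∈ l :=
  (consec_comm.1 h).mem_left

end Consecutive

/-! ### Path decompositions as families of lists, and the count of path ends. -/

section Families

open Finset SimpleGraph

variable {V ι : Type*}

/-- A finite family of lists without repetitions whose pairs of consecutive elements are the edges
of `H`, each edge arising from exactly one list. -/
structure IsPathFamily (H : SimpleGraph V) (p : ι → List V) : Prop where
  nodup : ∀ i, (p i).Nodup
  adj_iff : ∀ u v, H.Adj u v ↔ ∃ i, Consec (p i) u v
  unique : ∀ i j u v, Consec (p i) u v → Consec (p j) u v → i = j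

/-- The `i`-th list, read from its head (`false`) or from its tail (`true`). -/
def oriented (p : ι → List V) (x : ι × Bool) : List V := if x.2 then (p x.1).reverse else p x.1

open scoped Classical in
/-- The number of path ends at `v`; a path with one vertex has two ends there. -/
noncomputable def ends [Fintype ι] (p : ι → List V) (v : V) : ℕ :=
  #{x : ι × Bool | (oriented p x).head? = some v}

open scoped Classical in
/-- Replace the list with index `x.1` by a list that reads `l` from the side `x.2`. -/
noncomputable def replaced (p : ι → List V) (x : ι × Bool) (l : List V) : ι → List V :=
  Function.update p x.1 (if x.2 then l.reverse else l)

theorem oriented_replaced_self (p : ι → List V) (x : ι × Bool) (l : List V) :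
    oriented (replaced p x l) x = l := by
  rcases x with ⟨i, _ | _⟩ <;> simp [oriented, replaced]

theorem oriented_replaced_not (p : ι → List V) (x : ι × Bool) (l : List V) :
    oriented (replaced p x l) (x.1, !x.2) = l.reverse := by
  rcases x with ⟨i, _ | _⟩ <;> simp [oriented, replaced]

theorem oriented_not (p : ι → List V) (x : ι × Bool) :
    oriented p (x.1, !x.2) = (oriented p x).reverse := by
  rcases x with ⟨i, _ | _⟩ <;> simp [oriented]

theorem oriented_replaced_of_ne (p : ι → List V) (x y : ι × Bool) (l : List V) (h : y.1 ≠ x.1) :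
    oriented (replaced p x l) y = oriented p y := by
  simp [oriented, replaced, h]

theorem eq_or_eq_not_of_fst_eq {x y : ι × Bool} (h : y.1 = x.1) : y = x ∨ y = (x.1, !x.2) := by
  rcases x with ⟨i, a⟩
  rcases y with ⟨j, b⟩
  obtain rfl : j = i := h
  cases a <;> cases b <;> simp

theorem mem_oriented {p : ι → List V} {x : ι × Bool} {a : V} : a ∈ oriented p x ↔ a ∈ p x.1 := by
  unfold oriented; split <;> simp

theorem consec_oriented {p : ι → List V} {x : ι × Bool} {u v : V} :
    Consec (oriented p x) u v ↔ Consec (p x.1) u v := by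
  unfold oriented; split
  · exact consec_reverse
  · rfl

theorem IsPathFamily.nodup_oriented {H : SimpleGraph V} {p : ι → List V} (h : IsPathFamily H p)
    (x : ι × Bool) : (oriented p x).Nodup := by
  unfold oriented; split
  · exact List.nodup_reverse.2 (h.nodup _)
  · exact h.nodup _

/-- Replacing one path of a family by a path whose edges are not on the other paths. -/
theorem IsPathFamily.replace_path {H H' : SimpleGraph V} {p : ι → List V} (h : IsPathFamily H p)
    (x : ι × Bool) {l : List V} (hl : l.Nodup)
    (hH' : ∀ u v, H'.Adj u v ↔ (H.Adj u v ∧ ¬ Consec (oriented p x) u v) ∨ Consec l u v)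
    (hdis : ∀ u v, Consec l u v → H.Adj u v → Consec (oriented p x) u v) :
    IsPathFamily H' (replaced p x l) := by
  have hx : ∀ u v, Consec (replaced p x l x.1) u v ↔ Consec l u v := fun u v => by
    rw [← consec_oriented (x := x), oriented_replaced_self]
  have hne : ∀ i, i ≠ x.1 → replaced p x l i = p i := fun i hi => by simp [replaced, hi]
  simp only [consec_oriented] at hH' hdis
  refine ⟨fun i => ?_, fun u v => ?_, fun i j u v hi hj => ?_⟩
  · by_cases hi : i = x.1
    · subst hi
      simp only [replaced, Function.update_self]
      split
      · exact List.nodup_reverse.2 hl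
      · exact hl
    · rw [hne i hi]; exact h.nodup i
  · rw [hH']
    constructor
    · rintro (⟨ha, hc⟩ | hc)
      · obtain ⟨i, hi⟩ := (h.adj_iff u v).1 ha
        refine ⟨i, ?_⟩
        rw [hne i]
        · exact hi
        · rintro rfl; exact hc hi
      · exact ⟨x.1, (hx u v).2 hc⟩
    · rintro ⟨i, hi⟩
      by_cases hix : i = x.1
      · subst hix; exact Or.inr ((hx u v).1 hi)
      · rw [hne i hix] at hi
        exact Or.inl ⟨(h.adj_iff u v).2 ⟨i, hi⟩, fun hc => hix (h.unique _ _ _ _ hi hc)⟩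
  -- An edge shared by the new list and an untouched path lies in `H`, so by `hdis` it was already
  -- on the replaced path, against uniqueness.
  · have key : ∀ i, i ≠ x.1 → Consec (replaced p x l i) u v →
        Consec (replaced p x l x.1) u v → False := fun i hix hi hc => by
      rw [hne i hix] at hi
      rw [hx] at hc
      exact hix (h.unique _ _ _ _ hi (hdis u v hc ((h.adj_iff u v).2 ⟨i, hi⟩)))
    by_cases hix : i = x.1 <;> by_cases hjx : j = x.1
    · rw [hix, hjx]
    · subst hix; exact (key j hjx hj hi).elim
    · subst hjx; exact (key i hix hi hj).elim
    · rw [hne i hix] at hi; rw [hne j hjx] at hj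
      exact h.unique _ _ _ _ hi hj

open scoped Classical in
/-- If a path that started at `b` is replaced by one that starts at `c` and has the same other end,
then one end moves from `b` to `c`. -/
theorem ends_replaced [Fintype ι] (p : ι → List V) (x : ι × Bool) (l : List V) {b c : V}
    (hb : (oriented p x).head? = some b) (hc : l.head? = some c)
    (hlast : l.getLast? = (oriented p x).getLast?) (v : V) :
    ends (replaced p x l) v + (if v = b then 1 else 0) = ends p v + (if v = c then 1 else 0) := by
  -- Among all sides only `x` can change its head: the opposite side starts at the common last
  -- vertex.
  have hy : ∀ y, y ≠ x → (oriented (replaced p x l) y).head? = (oriented p y).head? := by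
    intro y hy
    by_cases h1 : y.1 = x.1
    · obtain rfl := (eq_or_eq_not_of_fst_eq h1).resolve_left hy
      rw [oriented_replaced_not, oriented_not, List.head?_reverse, List.head?_reverse, hlast]
    · rw [oriented_replaced_of_ne _ _ _ _ h1]
  have e1 : ∀ q : ι → List V, ends q v =
      #{y ∈ univ.erase x | (oriented q y).head? = some v} +
        (if (oriented q x).head? = some v then 1 else 0) := by
    intro q
    rw [ends]
    conv_lhs => rw [← Finset.insert_erase (Finset.mem_univ x), Finset.filter_insert]
    split
    · rw [Finset.card_insert_of_notMem (by simp)]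
    · simp
  have e2 : #{y ∈ univ.erase x | (oriented (replaced p x l) y).head? = some v} =
      #{y ∈ univ.erase x | (oriented p y).head? = some v} := by
    congr 1
    apply Finset.filter_congr
    intro y hyx
    rw [hy y (Finset.ne_of_mem_erase hyx)]
  rw [e1 p, e1 (replaced p x l), e2, oriented_replaced_self, hb, hc]
  simp only [Option.some.injEq, eq_comm (b := v)]
  omega

end Families

/-! ### Trading edges at a vertex along alternating chains. -/

section Augmentation

open Finset SimpleGraph

variable {V ι : Type*}

open scoped Classical in
/-- The part of an oriented path before the vertex `a`. -/
noncomputable def before (p : ι → List V) (a : V) (x : ι × Bool) : List V :=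
  (oriented p x).takeWhile (fun v => decide (v ≠ a))

open scoped Classical in
theorem exists_eq_takeWhile_append {l : List V} {a : V} (h : a ∈ l) :
    ∃ r, l = l.takeWhile (fun v => decide (v ≠ a)) ++ a :: r := by
  induction l with
  | nil => simp at h
  | cons b l ih =>
    by_cases hb : b = a
    · subst hb; exact ⟨l, by simp⟩
    · obtain ⟨r, hr⟩ := ih (by simpa [Ne.symm hb] using h)
      refine ⟨r, ?_⟩
      rw [List.takeWhile_cons_of_pos (by simpa using hb), List.cons_append, ← hr]

open scoped Classical in
theorem takeWhile_append_self {l r : List V} {a : V} (h : a ∉ l) :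
    (l ++ a :: r).takeWhile (fun v => decide (v ≠ a)) = l := by
  induction l with
  | nil => simp
  | cons b l ih =>
    simp only [List.mem_cons, not_or] at h
    rw [List.cons_append, List.takeWhile_cons_of_pos (by simpa using Ne.symm h.1), ih h.2]

theorem exists_oriented_eq {p : ι → List V} {a : V} {x : ι × Bool} (h : a ∈ p x.1) :
    ∃ r, oriented p x = before p a x ++ a :: r :=
  exists_eq_takeWhile_append (mem_oriented.2 h)

theorem before_eq {p : ι → List V} {a : V} {x : ι × Bool} {l r : List V}
    (h : oriented p x = l ++ a :: r) (hl : a ∉ l) : before p a x = l := by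
  rw [before, h, takeWhile_append_self hl]

theorem edge_adj_iff {a b u v : V} (h : a ≠ b) :
    (edge a b).Adj u v ↔ (u = a ∧ v = b) ∨ (u = b ∧ v = a) := by
  rw [edge_adj]
  constructor
  · tauto
  · rintro (⟨rfl, rfl⟩ | ⟨rfl, rfl⟩)
    · exact ⟨Or.inl ⟨rfl, rfl⟩, h⟩
    · exact ⟨Or.inr ⟨rfl, rfl⟩, h.symm⟩

/-- The propositional content of a flip: `A` is adjacency, `S` and `R` are the two surviving pieces
of the path, `C₁`, `C₂` the two orientations of the deleted edge and `B₁`, `B₂` those of the new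
one. -/
theorem trade_iff {A S R C₁ C₂ B₁ B₂ : Prop} (h₁ : S → A) (h₂ : R → A) (h₃ : S → ¬ C₁ ∧ ¬ C₂)
    (h₄ : R → ¬ C₁ ∧ ¬ C₂) : (A ∧ ¬ (C₁ ∨ C₂)) ∨ (B₁ ∨ B₂) ↔
      (A ∧ ¬ (S ∨ R ∨ C₂ ∨ C₁)) ∨ (S ∨ R ∨ B₂ ∨ B₁) := by
  by_cases A <;> by_cases S <;> by_cases R <;> simp_all <;> tauto

open scoped Classical in
/-- Reversing the part of a path before `a` trades the edge from `a` to its predecessor `c` for an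
edge from `a` to the end `b` of the path. -/
theorem IsPathFamily.exists_flip [Fintype ι] {H : SimpleGraph V} {p : ι → List V}
    (h : IsPathFamily H p) {a b c : V} {x : ι × Bool} (ha : a ∈ p x.1)
    (hb : (before p a x).head? = some b) (hc : (before p a x).getLast? = some c)
    (hab : ¬ H.Adj a b) :
    H.Adj a c ∧ ∃ p' : ι → List V, IsPathFamily (H \ edge a c ⊔ edge a b) p' ∧
      (∀ v, ends p' v + (if v = b then 1 else 0) = ends p v + (if v = c then 1 else 0)) ∧
      (∀ i, a ∈ p' i ↔ a ∈ p i) ∧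
      (∀ y, y.1 ≠ x.1 → (oriented p' y).head? = (oriented p y).head?) ∧
      ∀ y, y ≠ x → before p' a y = before p a y := by
  obtain ⟨r, hr⟩ := exists_oriented_eq ha
  set s := before p a x with hs
  have hnd := h.nodup_oriented x
  rw [hr] at hnd
  have has : a ∉ s := by
    intro h1
    exact (List.nodup_append.1 hnd).2.2 a h1 a (by simp) rfl
  have har : a ∉ r := by
    have := (List.nodup_append.1 hnd).2.1
    simp at this
    exact this.1
  have hbs : b ∈ s := List.mem_of_mem_head? hb
  have hcs : c ∈ s := List.mem_of_getLast? hc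
  have hba : b ≠ a := fun h => has (h ▸ hbs)
  have hca : c ≠ a := fun h => has (h ▸ hcs)
  have hcons : ∀ u v, Consec (oriented p x) u v ↔ Consec s u v ∨ Consec (a :: r) u v ∨
      (u = c ∧ v = a) ∨ (u = a ∧ v = c) := by
    intro u v
    rw [hr, consec_append, hc]
    simp only [Option.some.injEq, List.head?_cons, eq_comm (a := c), eq_comm (a := a)]
    tauto
  have hadj : ∀ u v, Consec (oriented p x) u v → H.Adj u v := fun u v huv =>
    (h.adj_iff u v).2 ⟨x.1, consec_oriented.1 huv⟩
  have hac : H.Adj a c := hadj _ _ ((hcons a c).2 (by simp))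
  refine ⟨hac, replaced p x (s.reverse ++ a :: r), ?_, ?_, ?_, ?_, ?_⟩
  · have hl' : ∀ u v, Consec (s.reverse ++ a :: r) u v ↔ Consec s u v ∨ Consec (a :: r) u v ∨
        (u = b ∧ v = a) ∨ (u = a ∧ v = b) := by
      intro u v
      rw [consec_append, List.getLast?_reverse, hb, consec_reverse]
      simp only [Option.some.injEq, List.head?_cons, eq_comm (a := b), eq_comm (a := a)]
      tauto
    have hs1 : ∀ u v, Consec s u v → u ≠ a ∧ v ≠ a := fun u v huv =>
      ⟨fun e => has (e ▸ huv.mem_left), fun e => has (e ▸ huv.mem_right)⟩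
    have hr1 : ∀ u v, Consec (a :: r) u v → u ≠ c ∧ v ≠ c := by
      have hcr : c ∉ a :: r := fun hmem => (List.nodup_append.1 hnd).2.2 c hcs c hmem rfl
      exact fun u v huv => ⟨fun e => hcr (e ▸ huv.mem_left), fun e => hcr (e ▸ huv.mem_right)⟩
    have hba' : ¬ H.Adj b a := fun h => hab h.symm
    refine h.replace_path x ?_ ?_ ?_
    · rw [List.nodup_append] at hnd ⊢
      exact ⟨List.nodup_reverse.2 hnd.1, hnd.2.1, fun u hu => hnd.2.2 u (by simpa using hu)⟩
    · intro u v
      rw [sup_adj, sdiff_adj, edge_adj_iff hca.symm, edge_adj_iff hba.symm, hl', hcons]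
      have h1 := hadj u v
      rw [hcons] at h1
      have h2 : Consec s u v → ¬ (u = a ∧ v = c) ∧ ¬ (u = c ∧ v = a) := fun h =>
        ⟨fun e => (hs1 u v h).1 e.1, fun e => (hs1 u v h).2 e.2⟩
      have h3 : Consec (a :: r) u v → ¬ (u = a ∧ v = c) ∧ ¬ (u = c ∧ v = a) := fun h =>
        ⟨fun e => (hr1 u v h).2 e.2, fun e => (hr1 u v h).1 e.1⟩
      exact trade_iff (fun h => h1 (Or.inl h)) (fun h => h1 (Or.inr (Or.inl h))) h2 h3
    · intro u v
      rw [hl', hcons]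
      rintro (h1 | h1 | ⟨rfl, rfl⟩ | ⟨rfl, rfl⟩) h2
      · exact Or.inl h1
      · exact Or.inr (Or.inl h1)
      · exact (hba' h2).elim
      · exact (hab h2).elim
  · refine ends_replaced p x _ ?_ ?_ ?_
    · rw [hr, List.head?_append, hb]; rfl
    · rw [List.head?_append, List.head?_reverse, hc]; rfl
    · rw [hr, List.getLast?_append, List.getLast?_append, List.getLast?_cons]; rfl
  · intro i
    by_cases hi : i = x.1
    · subst hi
      rw [← mem_oriented (x := x), oriented_replaced_self]
      simp [ha]
    · simp [replaced, hi]
  · intro y hy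
    rw [oriented_replaced_of_ne _ _ _ _ hy]
  · intro y hy
    by_cases h1 : y.1 = x.1
    · obtain rfl := (eq_or_eq_not_of_fst_eq h1).resolve_left hy
      rw [before_eq (l := r.reverse) (r := s), before_eq (l := r.reverse) (r := s.reverse)]
      · rw [oriented_not, hr]; simp
      · simpa using har
      · rw [oriented_replaced_not]; simp
      · simpa using har
    · rw [before, before, oriented_replaced_of_ne _ _ _ _ h1]

/-- `IsAltChain p a f b l`: starting from the end `b`, each member of the list `l` is a path side
that starts where the predecessor of `a` on the previous one lies, and the last of these
predecessors is an end of the path of `f`, which avoids `a`. -/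
def IsAltChain (p : ι → List V) (a : V) (f : ι × Bool) : V → List (ι × Bool) → Prop
  | b, [] => a ∉ p f.1 ∧ (oriented p f).head? = some b
  | b, x :: l => a ∈ p x.1 ∧ (before p a x).head? = some b ∧
      ∃ c, (before p a x).getLast? = some c ∧ IsAltChain p a f c l

/-- Lets the tail of a chain survive a flip elsewhere. The guard in `h2` is harmless, since a
flipped path contains `a` and hence is not the path of `f`. -/
theorem IsAltChain.congr {p p' : ι → List V} {a : V} {f : ι × Bool}
    (h1 : ∀ i, a ∈ p' i ↔ a ∈ p i)
    (h2 : a ∉ p f.1 → (oriented p' f).head? = (oriented p f).head?) :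
    ∀ {l : List (ι × Bool)} {b : V}, (∀ y ∈ l, before p' a y = before p a y) →
      IsAltChain p a f b l → IsAltChain p' a f b l
  | [], _, _, ⟨h, h'⟩ => ⟨by rwa [h1], by rw [h2 h, h']⟩
  | x :: l, b, hl, ⟨ha, hb, c, hc, h⟩ => by
    have hx := hl x (by simp)
    exact ⟨by rwa [h1], by rwa [hx], c, by rwa [hx],
      h.congr h1 h2 fun y hy => hl y (by simp [hy])⟩

open scoped Classical in
-- A flip at the first side installs `ab` at the cost of `ac`, and leaves the same task for `c` and
-- the shorter chain; at the end of the chain, `a` is prepended to the path of `f`. The changes in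
-- the end counts telescope. Without repetitions, no flip disturbs a side that is still to be used.
theorem IsAltChain.exists_add [Fintype ι] {a : V} {f : ι × Bool} :
    ∀ (l : List (ι × Bool)) {H : SimpleGraph V} {p : ι → List V} {b : V},
      IsPathFamily H p → ¬ H.Adj a b → a ≠ b → l.Nodup → IsAltChain p a f b l →
      ∃ p' : ι → List V, IsPathFamily (H ⊔ edge a b) p' ∧
        ∀ v, ends p' v + (if v = b then 1 else 0) = ends p v + (if v = a then 1 else 0)
  | [], H, p, b, h, hab, hne, _, ⟨haf, hb⟩ => by
    refine ⟨replaced p f (a :: oriented p f), h.replace_path f ?_ ?_ ?_, ?_⟩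
    · simp [mem_oriented, haf, h.nodup_oriented f]
    · intro u v
      rw [sup_adj, edge_adj_iff hne, consec_cons, hb]
      have : Consec (oriented p f) u v → H.Adj u v := fun huv =>
        (h.adj_iff u v).2 ⟨f.1, consec_oriented.1 huv⟩
      simp only [Option.some.injEq, eq_comm (a := a), eq_comm (a := b)]
      tauto
    · intro u v
      rw [consec_cons, hb]
      rintro (h1 | ⟨rfl, h1⟩ | ⟨rfl, h1⟩) h2
      · exact h1
      · simp only [Option.some.injEq] at h1; subst h1; exact (hab h2).elim
      · simp only [Option.some.injEq] at h1; subst h1; exact (hab h2.symm).elim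
    · refine ends_replaced p f _ hb (by simp) ?_
      cases hl : oriented p f with
      | nil => simp [hl] at hb
      | cons y l => simp
  | x :: l, H, p, b, h, hab, hne, hl, ⟨ha, hb, c, hc, hal⟩ => by
    obtain ⟨hac, p₁, hp₁, hends, hmem, hhead, hbef⟩ := h.exists_flip ha hb hc hab
    have hcb : c ≠ b := fun e => hab (e ▸ hac)
    have hca : a ≠ c := hac.ne
    rw [List.nodup_cons] at hl
    have hal' : IsAltChain p₁ a f c l :=
      hal.congr hmem (fun haf => hhead f fun e => haf (e ▸ ha))
        (fun y hy => hbef y fun e => hl.1 (e ▸ hy))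
    obtain ⟨p', hp', hends'⟩ := IsAltChain.exists_add l (p := p₁) hp₁
      (by simp [edge_adj_iff hca, edge_adj_iff hne, hcb, hca.symm]) hca hl.2 hal'
    refine ⟨p', ?_, fun v => ?_⟩
    · have hle : edge a c ≤ H := by
        intro u v huv
        rcases (edge_adj_iff hca).1 huv with ⟨rfl, rfl⟩ | ⟨rfl, rfl⟩
        exacts [hac, hac.symm]
      rwa [sup_right_comm, sdiff_sup_cancel hle] at hp'
    · have := hends v; have := hends' v; omega

/-- Serves to cut out loops: on meeting a side again, one continues from its occurrence in the
chain. -/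
theorem IsAltChain.exists_suffix {p : ι → List V} {a : V} {f y : ι × Bool} :
    ∀ {l : List (ι × Bool)} {b : V}, IsAltChain p a f b l → y ∈ l →
      ∃ l' b', IsAltChain p a f b' (y :: l') ∧ (y :: l').Sublist l
  | x :: l, b, h, hy => by
    rcases List.mem_cons.1 hy with rfl | hy
    · exact ⟨l, b, h, List.Sublist.refl _⟩
    · obtain ⟨_, _, c, _, h'⟩ := h
      obtain ⟨l', b', h1, h2⟩ := h'.exists_suffix hy
      exact ⟨l', b', h1, h2.cons x⟩

end Augmentation

/-! ### The counting argument that yields a chain. -/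

section Move

open Finset SimpleGraph

variable {V ι : Type*}

/-- The side `y` starts where the predecessor of `a` on the side `x` lies. -/
def Follows (p : ι → List V) (a : V) (x y : ι × Bool) : Prop :=
  a ∈ p y.1 ∧ before p a y ≠ [] ∧ (before p a x).getLast? = (before p a y).head?

/-- The chain is built backwards from `x`; a side that is already in it is not added again, the
chain being shortened to begin there instead. -/
theorem exists_isAltChain_of_follows {p : ι → List V} {a c : V} {f x₀ x : ι × Bool}
    (h : Relation.ReflTransGen (Follows p a) x₀ x) (hx₀ : a ∈ p x₀.1) (hx₀' : before p a x₀ ≠ [])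
    (hc : (before p a x).getLast? = some c) (hf : a ∉ p f.1)
    (hf' : (oriented p f).head? = some c) :
    ∃ b l, (x₀ :: l).Nodup ∧ IsAltChain p a f b (x₀ :: l) := by
  induction h using Relation.ReflTransGen.head_induction_on with
  | refl =>
    exact ⟨_, [], by simp, hx₀, List.head?_eq_some_head hx₀', c, hc, hf, hf'⟩
  | @head x y hxy _ ih =>
    obtain ⟨hy, hy', he⟩ := hxy
    obtain ⟨b, l, hnd, hal⟩ := ih hy hy'
    by_cases hmem : x ∈ y :: l
    · obtain ⟨l', b', h1, h2⟩ := hal.exists_suffix hmem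
      exact ⟨b', l', h2.nodup hnd, h1⟩
    · refine ⟨_, y :: l, List.nodup_cons.2 ⟨hmem, hnd⟩, hx₀, List.head?_eq_some_head hx₀', b, ?_, hal⟩
      rw [he]; exact hal.2.1

open scoped Classical in
/-- If the vertices of `B` are not adjacent to `a` and carry together more path ends than there are
neighbours of `a` without path ends, then for some `b` in `B` the edge `ab` can be added to the
graph, where one path end moves from `b` to `a`. -/
theorem IsPathFamily.exists_move [Fintype V] [Fintype ι] {H : SimpleGraph V} {p : ι → List V}
    (h : IsPathFamily H p) (a : V) (B : Finset V) (hB : ∀ b ∈ B, a ≠ b ∧ ¬ H.Adj a b)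
    (hcard : #{v | H.Adj a v ∧ ends p v = 0} < ∑ b ∈ B, ends p b) :
    ∃ b ∈ B, ∃ p' : ι → List V, IsPathFamily (H ⊔ edge a b) p' ∧
      ∀ v, ends p' v + (if v = b then 1 else 0) = ends p v + (if v = a then 1 else 0) := by
  by_contra hcon
  have hno : ∀ b ∈ B, ∀ f l, l.Nodup → ¬ IsAltChain p a f b l := fun b hb f l hl hal => by
    obtain ⟨p', h1, h2⟩ := hal.exists_add l h (hB b hb).2 (hB b hb).1 hl
    exact hcon ⟨b, hb, p', h1, h2⟩
  -- `R` collects all sides reachable by flips from ends at `B`; `C` below collects the neighbours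
  -- of `a` that these flips would free.
  set R : Finset (ι × Bool) := {x | ∃ x₀, (a ∈ p x₀.1 ∧ ∃ b ∈ B, (before p a x₀).head? = some b) ∧
    Relation.ReflTransGen (Follows p a) x₀ x} with hR
  have hRX : ∀ x ∈ R, a ∈ p x.1 ∧ before p a x ≠ [] := by
    intro x hx
    obtain ⟨x₀, ⟨h1, b, _, h2⟩, h3⟩ := (Finset.mem_filter.1 hx).2
    rcases Relation.ReflTransGen.cases_tail h3 with rfl | ⟨y, _, hy⟩
    · exact ⟨h1, fun e => by simp [e] at h2⟩
    · exact ⟨hy.1, hy.2.1⟩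
  set C : Finset V := {v | ∃ x ∈ R, (before p a x).getLast? = some v} with hC
  have hconsec : ∀ x ∈ R, ∀ v, (before p a x).getLast? = some v → Consec (p x.1) a v := by
    intro x hx v hv
    obtain ⟨r, hr⟩ := exists_oriented_eq (hRX x hx).1
    rw [← consec_oriented, hr, consec_append, hv]
    simp
  have hCadj : ∀ v ∈ C, H.Adj a v := by
    intro v hv
    obtain ⟨x, hx, hxv⟩ := (Finset.mem_filter.1 hv).2
    exact (h.adj_iff a v).2 ⟨x.1, hconsec x hx v hxv⟩
  -- Different sides enter `a` through different edges: edges on different paths are distinct, and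
  -- on one path the two parts around `a` are disjoint.
  have hRC : #R ≤ #C := by
    refine Finset.card_le_card_of_injOn
      (fun x => if hx : before p a x ≠ [] then (before p a x).getLast hx else a) ?_ ?_
    · intro x hx
      have hx' := (hRX x hx).2
      simp only [hC, Finset.coe_filter, Finset.mem_univ, true_and, Set.mem_ofPred_eq]
      exact ⟨x, hx, by rw [dif_pos hx', List.getLast?_eq_getLast_of_ne_nil hx']⟩
    · intro x hx y hy hxy
      have hx' := hRX x hx
      have hy' := hRX y hy
      simp only [dif_pos hx'.2, dif_pos hy'.2] at hxy
      have h1 := hconsec x hx _ (List.getLast?_eq_getLast_of_ne_nil hx'.2)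
      have h2 := hconsec y hy _ (List.getLast?_eq_getLast_of_ne_nil hy'.2)
      rw [← hxy] at h2
      have h3 := h.unique _ _ _ _ h1 h2
      rcases eq_or_eq_not_of_fst_eq h3.symm with e | e
      · exact e.symm
      · exfalso
        obtain ⟨r, hr⟩ := exists_oriented_eq hx'.1
        have hnd := h.nodup_oriented x
        rw [hr] at hnd
        have hnd' := List.nodup_append.1 hnd
        have har : a ∉ r := by
          have := hnd'.2.1
          simp at this
          exact this.1
        have h4 : before p a y = r.reverse := by
          rw [e]
          refine before_eq (r := (before p a x).reverse) ?_ (by simpa using har)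
          rw [oriented_not, hr]; simp
        have h5 : (before p a y).getLast hy'.2 ∈ r := by
          have := List.getLast_mem hy'.2
          rw [← List.mem_reverse, ← h4]
          exact this
        rw [← hxy] at h5
        exact hnd'.2.2 _ (List.getLast_mem hx'.2) _ (List.mem_cons_of_mem a h5) rfl
  have hBC : Disjoint B C := by
    rw [Finset.disjoint_left]
    exact fun v hv hv' => (hB v hv).2 (hCadj v hv')
  -- A path that ends at `v` and avoids `a` would complete a chain, so it passes through `a` and its
  -- side is reachable.
  have hmemR : ∀ v ∈ B ∪ C, ∀ y, (oriented p y).head? = some v → y ∈ R := by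
    intro v hv y hy
    have hva : v ≠ a := by
      rcases Finset.mem_union.1 hv with hv | hv
      · exact (hB v hv).1.symm
      · exact (hCadj v hv).ne'
    by_cases hay : a ∈ p y.1
    · have hby : (before p a y).head? = some v := by
        obtain ⟨r, hr⟩ := exists_oriented_eq hay
        rw [hr, List.head?_append] at hy
        cases hb : before p a y with
        | nil => simp [hb] at hy; exact (hva hy.symm).elim
        | cons z l => simpa [hb] using hy
      have hbn : before p a y ≠ [] := fun e => by simp [e] at hby
      rcases Finset.mem_union.1 hv with hv | hv
      · exact Finset.mem_filter.2 ⟨Finset.mem_univ _, y, ⟨hay, v, hv, hby⟩, .refl⟩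
      · obtain ⟨x, hx, hxv⟩ := (Finset.mem_filter.1 hv).2
        obtain ⟨x₀, h1, h2⟩ := (Finset.mem_filter.1 hx).2
        exact Finset.mem_filter.2 ⟨Finset.mem_univ _, x₀, h1, h2.tail ⟨hay, hbn, by rw [hxv, hby]⟩⟩
    · exfalso
      rcases Finset.mem_union.1 hv with hv | hv
      · exact hno v hv y [] List.nodup_nil ⟨hay, hy⟩
      · obtain ⟨x, hx, hxv⟩ := (Finset.mem_filter.1 hv).2
        obtain ⟨x₀, ⟨h1, b, hb, hb'⟩, h2⟩ := (Finset.mem_filter.1 hx).2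
        obtain ⟨b', l, hl, hal⟩ := exists_isAltChain_of_follows h2 h1
          (fun e => by simp [e] at hb') hxv hay hy
        have := hal.2.1
        rw [hb', Option.some.injEq] at this
        exact hno b hb y _ hl (this ▸ hal)
  have hsum : ∑ v ∈ B ∪ C, ends p v ≤ #R := by
    simp only [ends]
    rw [← Finset.card_biUnion]
    · refine Finset.card_le_card fun y hy => ?_
      obtain ⟨v, hv, hy⟩ := Finset.mem_biUnion.1 hy
      exact hmemR v hv y (Finset.mem_filter.1 hy).2
    · intro v _ w _ hvw
      refine Finset.disjoint_left.2 fun y hy hy' => ?_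
      have h1 := (Finset.mem_filter.1 hy).2
      rw [(Finset.mem_filter.1 hy').2, Option.some.injEq] at h1
      exact hvw h1.symm
  rw [Finset.sum_union hBC] at hsum
  -- Altogether the ends at `B` and `C` number at most #R ≤ #C, which is at most the ends at `C`
  -- plus the endless neighbours of `a`; cancelling the ends at `C` contradicts `hcard`.
  have hCsum : #C ≤ ∑ v ∈ C, ends p v + #{v | H.Adj a v ∧ ends p v = 0} := by
    have h1 : #C ≤ ∑ v ∈ C, (ends p v + if ends p v = 0 then 1 else 0) := by
      rw [Finset.card_eq_sum_ones]
      exact Finset.sum_le_sum fun v _ => by split <;> omega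
    rw [Finset.sum_add_distrib, ← Finset.card_filter] at h1
    refine h1.trans (Nat.add_le_add_left (Finset.card_le_card fun v hv => ?_) _)
    rw [Finset.mem_filter] at hv ⊢
    exact ⟨Finset.mem_univ _, hCadj v hv.1, hv.2⟩
  omega

end Move

/-! ### Degrees and path ends have the same parity. -/

section Parity

open Finset SimpleGraph
open scoped Classical

variable {V ι : Type*}

/-- The neighbours of `v`. -/
noncomputable def nbrs [Fintype V] (G : SimpleGraph V) (v : V) : Finset V := {u | G.Adj v u}

@[simp] theorem mem_nbrs [Fintype V] {G : SimpleGraph V} {u v : V} : u ∈ nbrs G v ↔ G.Adj v u := by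
  simp [nbrs]

/-- The vertex `v` has even degree. -/
def IsEven [Fintype V] (G : SimpleGraph V) (v : V) : Prop := Even #(nbrs G v)

/-- A vertex on a path has two sides, and on each there is either a neighbour or an end of the path;
a one-vertex path has two ends. -/
theorem card_consec_add [Fintype V] {l : List V} (hl : l.Nodup) (v : V) :
    #{u | Consec l v u} + ((if l.head? = some v then 1 else 0) +
      (if l.getLast? = some v then 1 else 0)) = 2 * if v ∈ l then 1 else 0 := by
  by_cases hv : v ∈ l
  · obtain ⟨s, t, rfl⟩ := List.append_of_mem hv
    rw [List.nodup_append] at hl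
    obtain ⟨hs, ht, hst⟩ := hl
    rw [List.nodup_cons] at ht
    have hvs : v ∉ s := fun h => hst v h v (by simp) rfl
    have hcon : ∀ u, Consec (s ++ v :: t) v u ↔ s.getLast? = some u ∨ t.head? = some u := by
      intro u
      rw [consec_append, consec_cons]
      have h1 : ¬ Consec s v u := fun h => hvs h.mem_left
      have h2 : ¬ Consec t v u := fun h => ht.1 h.mem_left
      have h3 : s.getLast? ≠ some v := fun h => hvs (List.mem_of_getLast? h)
      have h4 : t.head? ≠ some v := fun h => ht.1 (List.mem_of_mem_head? h)
      simp [h1, h2, h3, h4]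
      tauto
    have hs' : ((s ++ v :: t).head? = some v) ↔ s = [] := by
      cases s with
      | nil => simp
      | cons a s => simp; rintro rfl; exact hvs (by simp)
    have ht' : ((s ++ v :: t).getLast? = some v) ↔ t = [] := by
      rcases List.eq_nil_or_concat' t with rfl | ⟨t, a, rfl⟩
      · simp
      · rw [← List.cons_append, ← List.append_assoc, List.getLast?_concat]
        simp; rintro rfl; exact ht.1 (by simp)
    simp only [hcon, hs', ht', if_pos hv]
    rw [Finset.filter_or, Finset.card_union_of_disjoint]
    · have h1 : #{u | s.getLast? = some u} + (if s = [] then 1 else 0) = 1 := by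
        rcases List.eq_nil_or_concat' s with rfl | ⟨s, a, rfl⟩
        · simp
        · simp [Finset.filter_eq]
      have h2 : #{u | t.head? = some u} + (if t = [] then 1 else 0) = 1 := by
        cases t with
        | nil => simp
        | cons a t => simp [Finset.filter_eq]
      omega
    · rw [Finset.disjoint_filter]
      intro u _ h1 h2
      exact hst u (List.mem_of_getLast? h1) u
        (List.mem_cons_of_mem _ (List.mem_of_mem_head? h2)) rfl
  · have h1 : l.head? ≠ some v := fun h => hv (List.mem_of_mem_head? h)
    have h2 : l.getLast? ≠ some v := fun h => hv (List.mem_of_getLast? h)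
    have h3 : ∀ u, ¬ Consec l v u := fun u h => hv h.mem_left
    simp [hv, h1, h2, h3]

theorem ends_eq_sum [Fintype ι] (p : ι → List V) (v : V) :
    ends p v = ∑ i, ((if (p i).head? = some v then 1 else 0) +
      (if (p i).getLast? = some v then 1 else 0)) := by
  rw [ends, Finset.card_filter, Fintype.sum_prod_type]
  refine Finset.sum_congr rfl fun i _ => ?_
  rw [Fintype.sum_bool, add_comm]
  simp [oriented]

theorem IsPathFamily.card_nbrs_add_ends [Fintype V] [Fintype ι] {H : SimpleGraph V} {p : ι → List V}
    (h : IsPathFamily H p) (v : V) :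
    #(nbrs H v) + ends p v = 2 * ∑ i, if v ∈ p i then 1 else 0 := by
  have h1 : nbrs H v = univ.biUnion fun i => ({u | Consec (p i) v u} : Finset V) := by
    ext u; simp [h.adj_iff]
  rw [h1, Finset.card_biUnion, ends_eq_sum, ← Finset.sum_add_distrib, Finset.mul_sum]
  · exact Finset.sum_congr rfl fun i _ => card_consec_add (h.nodup i) v
  · intro i _ j _ hij
    refine Finset.disjoint_left.2 fun u hu hu' => ?_
    exact hij (h.unique i j v u (Finset.mem_filter.1 hu).2 (Finset.mem_filter.1 hu').2)

theorem IsPathFamily.one_le_ends [Fintype V] [Fintype ι] {H : SimpleGraph V} {p : ι → List V}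
    (h : IsPathFamily H p) {v : V} (hv : ¬ IsEven H v) : 1 ≤ ends p v := by
  by_contra hcon
  have := h.card_nbrs_add_ends v
  exact hv ⟨∑ i, (if v ∈ p i then 1 else 0), by omega⟩

end Parity

/-! ### The ledger of guaranteed path ends. -/

section Realizable

open Finset SimpleGraph
open scoped Classical

variable {V : Type*}

/-- `H` decomposes into at most `N / 2` paths, at least `m v` of whose ends are at `v`. -/
def Realizable (N : ℕ) (H : SimpleGraph V) (m : V → ℕ) : Prop :=
  ∃ (k : ℕ) (p : Fin k → List V), IsPathFamily H p ∧ 2 * k ≤ N ∧ ∀ v, m v ≤ ends p v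

/-- The neighbours of `a` at which no path end is guaranteed. -/
noncomputable def zeroNbrs [Fintype V] (H : SimpleGraph V) (m : V → ℕ) (a : V) : Finset V :=
  {v | H.Adj a v ∧ m v = 0}

theorem mem_zeroNbrs [Fintype V] {H : SimpleGraph V} {m : V → ℕ} {a v : V} :
    v ∈ zeroNbrs H m a ↔ H.Adj a v ∧ m v = 0 := by simp [zeroNbrs]

/-- The least possible number of path ends at each vertex, given the parity of the degrees. -/
noncomputable def oddInd [Fintype V] (H : SimpleGraph V) (v : V) : ℕ := if IsEven H v then 0 else 1

theorem Realizable.mono {N : ℕ} {H : SimpleGraph V} {m m' : V → ℕ} (h : Realizable N H m)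
    (hm : ∀ v, m' v ≤ m v) : Realizable N H m' := by
  obtain ⟨k, p, h1, h2, h3⟩ := h
  exact ⟨k, p, h1, h2, fun v => (hm v).trans (h3 v)⟩

/-- The induction hypothesis says nothing about ends; parity supplies one at every odd vertex, the
initial capital of every reduction. -/
theorem Realizable.odd [Fintype V] {N : ℕ} {H : SimpleGraph V} {m : V → ℕ} (h : Realizable N H m) :
    Realizable N H (oddInd H) := by
  obtain ⟨k, p, h1, h2, _⟩ := h
  refine ⟨k, p, h1, h2, fun v => ?_⟩
  unfold oddInd
  split
  · exact Nat.zero_le _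
  · rename_i hv; exact h1.one_le_ends hv

/-- One path end moves from `b` to `a`. -/
noncomputable def shift (m : V → ℕ) (b a : V) (v : V) : ℕ :=
  if v = a then m v + 1 else if v = b then m v - 1 else m v

theorem Realizable.exists_move [Fintype V] {N : ℕ} {H : SimpleGraph V} {m : V → ℕ} (h : Realizable N H m)
    (a : V) (B : Finset V) (hB : ∀ b ∈ B, a ≠ b ∧ ¬ H.Adj a b)
    (hcard : #(zeroNbrs H m a) < ∑ b ∈ B, m b) :
    ∃ b ∈ B, Realizable N (H ⊔ edge a b) (shift m b a) := by
  obtain ⟨k, p, h1, h2, h3⟩ := h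
  have hcard' : #{v | H.Adj a v ∧ ends p v = 0} < ∑ b ∈ B, ends p b := by
    refine lt_of_le_of_lt (Finset.card_le_card fun v hv => ?_)
      (hcard.trans_le (Finset.sum_le_sum fun b _ => h3 b))
    obtain ⟨_, hv1, hv2⟩ := Finset.mem_filter.1 hv
    have := h3 v
    exact mem_zeroNbrs.2 ⟨hv1, by omega⟩
  obtain ⟨b, hb, p', hp', he⟩ := h1.exists_move a B hB hcard'
  refine ⟨b, hb, k, p', hp', h2, fun v => ?_⟩
  have h4 := he v
  have h5 := h3 v
  have hne := (hB b hb).1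
  unfold shift
  split_ifs at h4 ⊢ <;> first | omega | (subst_vars; exact absurd rfl hne)

/-- Adding one edge `ab` to the graph, at the vertex `a`. -/
theorem Realizable.move [Fintype V] {N : ℕ} {H H' : SimpleGraph V} {m : V → ℕ} (h : Realizable N H m)
    (a b : V) (hab : a ≠ b) (hnadj : ¬ H.Adj a b) (hcard : #(zeroNbrs H m a) < m b)
    (hH' : H' = H ⊔ edge a b) : Realizable N H' (shift m b a) := by
  obtain ⟨b', hb', h⟩ := h.exists_move a {b} (by simp [hab, hnadj]) (by simpa using hcard)
  rw [Finset.mem_singleton] at hb'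
  subst hb'; rwa [hH']

/-- Adding one edge `ab` to the graph as a new path. -/
theorem Realizable.new_path {N : ℕ} {H : SimpleGraph V} {m : V → ℕ} (h : Realizable N H m)
    (a b : V) (hab : a ≠ b) (hnadj : ¬ H.Adj a b) : Realizable (N + 2) (H ⊔ edge a b) 0 := by
  obtain ⟨k, p, h1, h2, _⟩ := h
  have hc : ∀ u v, Consec [a, b] u v ↔ (u = a ∧ v = b) ∨ (u = b ∧ v = a) := by
    intro u v
    rw [consec_cons]
    simp only [not_consec_singleton, List.head?_cons, Option.some.injEq, false_or,
      eq_comm (a := a), eq_comm (a := b)]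
    tauto
  have hno : ∀ i, ¬ Consec (p i) a b := fun i hi => hnadj ((h1.adj_iff a b).2 ⟨i, hi⟩)
  have hno' : ∀ i u v, Consec [a, b] u v → ¬ Consec (p i) u v := by
    intro i u v huv hi
    rcases (hc u v).1 huv with ⟨rfl, rfl⟩ | ⟨rfl, rfl⟩
    · exact hno i hi
    · exact hno i (consec_comm.1 hi)
  refine ⟨k + 1, Fin.cons [a, b] p, ⟨?_, ?_, ?_⟩, by omega, fun v => Nat.zero_le _⟩
  · intro i
    refine Fin.cases ?_ (fun i => ?_) i
    · simp [hab]
    · simpa using h1.nodup i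
  · intro u v
    rw [sup_adj, edge_adj_iff hab, h1.adj_iff, Fin.exists_fin_succ]
    simp only [Fin.cons_zero, Fin.cons_succ, hc]
    tauto
  · intro i j u v
    refine Fin.cases ?_ (fun i => ?_) i <;> refine Fin.cases ?_ (fun j => ?_) j <;>
      simp only [Fin.cons_zero, Fin.cons_succ]
    · simp
    · exact fun h h' => (hno' j u v h h').elim
    · exact fun h h' => (hno' i u v h' h).elim
    · exact fun h h' => congrArg Fin.succ (h1.unique i j u v h h')

/-- A vertex of degree one cannot be interior to a path, so the path that carries its edge starts
there and can be shortened. -/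
theorem IsPathFamily.exists_remove_leaf {ι : Type*} [Fintype ι] {H : SimpleGraph V}
    {p : ι → List V} (h : IsPathFamily H p) {q y : V} (hq : ∀ u, H.Adj q u ↔ u = y) :
    ∃ p' : ι → List V, IsPathFamily (H \ edge q y) p' ∧
      ∀ v, ends p' v + (if v = q then 1 else 0) = ends p v + (if v = y then 1 else 0) := by
  have hqy : H.Adj q y := (hq y).2 rfl
  have key : ∃ x r, oriented p x = q :: y :: r := by
    have aux : ∀ l : List V, l.Nodup → (∀ u, Consec l q u → u = y) → [q, y] <:+: l →
        ∃ r, l = q :: y :: r := by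
      rintro l hl hl' ⟨s, t, rfl⟩
      rcases List.eq_nil_or_concat' s with rfl | ⟨s, a, rfl⟩
      · exact ⟨t, by simp⟩
      · exfalso
        obtain rfl : a = y := by
          refine hl' a (consec_comm.1 (Or.inl ⟨s, y :: t, by simp⟩))
        simp [List.nodup_append] at hl
    obtain ⟨i, hi⟩ := (h.adj_iff q y).1 hqy
    have hu : ∀ x : ι × Bool, ∀ u, Consec (oriented p x) q u → u = y := fun x u hu =>
      (hq u).1 ((h.adj_iff q u).2 ⟨x.1, consec_oriented.1 hu⟩)
    rcases hi with hi | hi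
    · obtain ⟨r, hr⟩ := aux (oriented p (i, false)) (h.nodup_oriented _) (hu _) (by simpa [oriented])
      exact ⟨_, r, hr⟩
    · obtain ⟨r, hr⟩ := aux (oriented p (i, true)) (h.nodup_oriented _) (hu _) (by
        rw [← List.reverse_infix]; simpa [oriented])
      exact ⟨_, r, hr⟩
  obtain ⟨x, r, hr⟩ := key
  have hnd := h.nodup_oriented x
  rw [hr] at hnd
  have hqr : q ∉ y :: r := (List.nodup_cons.1 hnd).1
  refine ⟨replaced p x (y :: r), h.replace_path x hnd.of_cons ?_ ?_, ?_⟩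
  · intro u v
    rw [hr, sdiff_adj, edge_adj_iff hqy.ne, consec_cons]
    have h1 : Consec (y :: r) u v → H.Adj u v := fun hc => (h.adj_iff u v).2
      ⟨x.1, consec_oriented.1 (by rw [hr, consec_cons]; exact Or.inl hc)⟩
    have h2 : Consec (y :: r) u v → ¬ (u = q ∧ v = y) ∧ ¬ (u = y ∧ v = q) := fun hc =>
      ⟨fun e => hqr (e.1 ▸ hc.mem_left), fun e => hqr (e.2 ▸ hc.mem_right)⟩
    simp only [List.head?_cons, Option.some.injEq, eq_comm (a := q), eq_comm (a := y)]
    by_cases hc : Consec (y :: r) u v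
    · simp only [h1 hc, hc, h2 hc, true_or, not_true, and_false, or_true, iff_true, true_and]
      simp
    · simp only [hc, false_or, or_false, and_comm (a := v = q)]
  · intro u v hc _
    rw [hr, consec_cons]; exact Or.inl hc
  · refine ends_replaced p x _ (by rw [hr]; rfl) rfl ?_
    rw [hr, List.getLast?_cons_cons]

theorem Realizable.remove_leaf {N : ℕ} {H H' : SimpleGraph V} {m : V → ℕ} (h : Realizable N H m)
    {q y : V} (hq : ∀ u, H.Adj q u ↔ u = y) (hH' : H' = H \ edge q y) :
    Realizable N H' (shift m q y) := by
  obtain ⟨k, p, h1, h2, h3⟩ := h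
  obtain ⟨p', hp', he⟩ := h1.exists_remove_leaf hq
  refine ⟨k, p', hH' ▸ hp', h2, fun v => ?_⟩
  have hne : q ≠ y := ((hq y).2 rfl).ne
  have h4 := he v
  have h5 := h3 v
  unfold shift
  split_ifs at h4 ⊢ <;> first | omega | (subst_vars; exact absurd rfl hne)

theorem realizable_bot (N : ℕ) : Realizable N (⊥ : SimpleGraph V) 0 :=
  ⟨0, fun i => [], ⟨fun i => i.elim0, fun u v => by simp, fun i => i.elim0⟩, by simp,
    fun v => Nat.zero_le _⟩

end Realizable

/-! ### Restoring all edges of a star. -/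

section Stars

open Finset SimpleGraph
open scoped Classical

variable {V : Type*}

/-- The graph with all edges between `w` and the other vertices of `U`. -/
def starAt (w : V) (U : Finset V) : SimpleGraph V where
  Adj a b := a ≠ b ∧ ((a = w ∧ b ∈ U) ∨ (b = w ∧ a ∈ U))
  symm := ⟨fun _ _ h => ⟨h.1.symm, h.2.symm⟩⟩
  loopless := ⟨fun _ h => h.1 rfl⟩

theorem starAt_adj {w a b : V} {U : Finset V} :
    (starAt w U).Adj a b ↔ a ≠ b ∧ ((a = w ∧ b ∈ U) ∨ (b = w ∧ a ∈ U)) := Iff.rfl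

theorem starAt_empty (w : V) : starAt w ∅ = ⊥ := by
  ext a b; simp [starAt_adj]

theorem starAt_insert (w b : V) (U : Finset V) : starAt w (insert b U) = starAt w U ⊔ edge w b := by
  ext u v
  simp only [starAt_adj, sup_adj, edge_adj, Finset.mem_insert]
  tauto

theorem starAt_union (w : V) (U U' : Finset V) : starAt w (U ∪ U') = starAt w U ⊔ starAt w U' := by
  ext u v
  simp only [starAt_adj, sup_adj, Finset.mem_union]
  tauto

theorem starAt_singleton (w b : V) : starAt w {b} = edge w b := by
  rw [← insert_empty_eq, starAt_insert, starAt_empty, bot_sup_eq]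

theorem edge_le {G : SimpleGraph V} {a b : V} (h : G.Adj a b) : edge a b ≤ G := by
  intro u v huv
  rcases (edge_adj_iff h.ne).1 huv with ⟨rfl, rfl⟩ | ⟨rfl, rfl⟩
  exacts [h, h.symm]

theorem starAt_le {G : SimpleGraph V} {w : V} {U : Finset V} (h : ∀ u ∈ U, G.Adj w u) :
    starAt w U ≤ G := by
  rintro u v ⟨_, ⟨rfl, hv⟩ | ⟨rfl, hu⟩⟩
  exacts [h v hv, (h u hu).symm]

variable [Fintype V]

/-- The neighbours of `a` that lie in `A` or at which no path end is guaranteed. -/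
noncomputable def conflicts (H : SimpleGraph V) (m : V → ℕ) (A : Finset V) (a : V) : Finset V :=
  {v | H.Adj a v ∧ (m v = 0 ∨ v ∈ A)}

theorem mem_conflicts {H : SimpleGraph V} {m : V → ℕ} {A : Finset V} {a v : V} :
    v ∈ conflicts H m A a ↔ H.Adj a v ∧ (m v = 0 ∨ v ∈ A) := by simp [conflicts]

/-- At least half of the edges from `w` to `U` can be added at `w`. -/
theorem Realizable.star_give {N : ℕ} {H : SimpleGraph V} {m : V → ℕ} (h : Realizable N H m)
    {w : V} {U : Finset V} (hwU : w ∉ U) (hadj : ∀ u ∈ U, ¬ H.Adj w u) (hU : ∀ u ∈ U, 1 ≤ m u)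
    (hw : ∀ v, H.Adj w v → 1 ≤ m v) (j : ℕ) (hj : 2 * j ≤ #U + 1) :
    ∃ A ⊆ U, #A = j ∧ Realizable N (H ⊔ starAt w A)
      (fun v => if v = w then m w + j else if v ∈ A then m v - 1 else m v) := by
  induction j with
  | zero =>
    refine ⟨∅, by simp, rfl, ?_⟩
    rw [starAt_empty, sup_bot_eq]
    refine h.mono fun v => ?_
    split_ifs with h1
    · subst h1; rfl
    · simp at *
    · rfl
  | succ j ih =>
    obtain ⟨A, hAU, hA, h'⟩ := ih (by omega)
    have hB : ∀ b ∈ U \ A, w ≠ b ∧ ¬ (H ⊔ starAt w A).Adj w b := by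
      intro b hb
      rw [Finset.mem_sdiff] at hb
      have hwb : w ≠ b := fun e => hwU (e ▸ hb.1)
      refine ⟨hwb, ?_⟩
      simp [starAt_adj, hadj b hb.1, hb.2, hwb.symm]
    -- Only the `j` vertices that already gave an end can be neighbours of `w` without one, while
    -- the #U - j > j others all still carry ends.
    obtain ⟨b, hb, h''⟩ := h'.exists_move w (U \ A) hB (by
      have hcard : #(U \ A) = #U - j := by rw [Finset.card_sdiff_of_subset hAU, hA]
      have h1 : #(U \ A) ≤ ∑ b ∈ U \ A,
          (if b = w then m w + j else if b ∈ A then m b - 1 else m b) := by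
        rw [Finset.card_eq_sum_ones]
        refine Finset.sum_le_sum fun b hb => ?_
        have hbw := (hB b hb).1
        rw [Finset.mem_sdiff] at hb
        rw [if_neg hbw.symm, if_neg hb.2]
        exact hU b hb.1
      refine lt_of_le_of_lt (?_ : _ ≤ #A) (by omega)
      refine Finset.card_le_card fun v hv => ?_
      obtain ⟨hv1, hv2⟩ := mem_zeroNbrs.1 hv
      by_contra hvA
      have hvw : v ≠ w := hv1.ne'
      rw [if_neg hvw, if_neg hvA] at hv2
      rw [sup_adj, starAt_adj] at hv1
      have := hw v (hv1.resolve_right fun e => by simp [hvA, hvw] at e)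
      omega)
    rw [Finset.mem_sdiff] at hb
    refine ⟨insert b A, Finset.insert_subset hb.1 hAU, by rw [Finset.card_insert_of_notMem hb.2, hA],
      ?_⟩
    rw [starAt_insert, ← sup_assoc]
    refine h''.mono fun v => ?_
    have hbw : b ≠ w := fun e => hwU (e ▸ hb.1)
    simp only [shift, Finset.mem_insert]
    by_cases hvw : v = w
    · simp [hvw, add_assoc]
    · by_cases hvb : v = b
      · subst hvb; simp [hvw, hb.2]
      · simp [hvw, hvb]

/-- The edges from `w` to `R` can be added at the vertices of `R`, if `w` carries enough ends. -/
theorem Realizable.star_take {N : ℕ} {H : SimpleGraph V} {m : V → ℕ} (h : Realizable N H m)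
    {w : V} {R Q : Finset V} (hwR : w ∉ R) (hadj : ∀ u ∈ R, ¬ H.Adj w u) (hQ : Q ⊆ R)
    (h2 : ∀ r ∈ R, #(zeroNbrs H m r) ≤ 2)
    (h1 : ∀ r ∈ R, r ∉ Q → #(zeroNbrs H m r) ≤ 1)
    (hR : R.Nonempty → #R + 1 ≤ m w) (hQw : Q.Nonempty → #Q + 2 ≤ m w) :
    Realizable N (H ⊔ starAt w R)
      (fun v => if v = w then m w - #R else if v ∈ R then m v + 1 else m v) := by
  induction hn : #R generalizing H m R Q with
  | zero =>
    rw [Finset.card_eq_zero] at hn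
    subst hn
    rw [starAt_empty, sup_bot_eq]
    refine h.mono fun v => ?_
    split_ifs with h1
    · subst h1; rfl
    · simp at *
    · rfl
  | succ n ih =>
    have hRne : R.Nonempty := by rw [← Finset.card_pos]; omega
    -- Vertices of `Q` come first, while `w` still has three ends; for the others two ends at `w`
    -- are enough.
    have hstep : ∃ r ∈ R, #(zeroNbrs H m r) < m w ∧ (Q.Nonempty → r ∈ Q) := by
      by_cases hQe : Q.Nonempty
      · obtain ⟨r, hr⟩ := hQe
        have := hQw ⟨r, hr⟩
        have := Finset.card_pos.2 ⟨r, hr⟩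
        have := h2 r (hQ hr)
        exact ⟨r, hQ hr, by omega, fun _ => hr⟩
      · obtain ⟨r, hr⟩ := hRne
        have := hR ⟨r, hr⟩
        have := h1 r hr (fun e => hQe ⟨r, e⟩)
        exact ⟨r, hr, by omega, fun e => (hQe e).elim⟩
    obtain ⟨r, hr, hzero, hrQ⟩ := hstep
    have hrw : r ≠ w := fun e => hwR (e ▸ hr)
    have h' := h.move r w hrw (fun e => hadj r hr e.symm) hzero rfl
    have hsub : ∀ r' ∈ R.erase r, #(zeroNbrs (H ⊔ edge r w) (shift m w r) r') ≤
        #(zeroNbrs H m r') := by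
      intro r' hr'
      rw [Finset.mem_erase] at hr'
      have hr'w : r' ≠ w := fun e => hwR (e ▸ hr'.2)
      refine Finset.card_le_card fun v hv => ?_
      obtain ⟨hv1, hv2⟩ := mem_zeroNbrs.1 hv
      have hv3 : H.Adj r' v := by
        rw [sup_adj, edge_adj] at hv1
        exact hv1.resolve_right fun e => by simp [hr'.1, hr'w] at e
      refine mem_zeroNbrs.2 ⟨hv3, ?_⟩
      unfold shift at hv2
      split_ifs at hv2 with e1 e2
      · exact (hadj r' hr'.2 (e2 ▸ hv3.symm)).elim
      · exact hv2
    have hcardR : #(R.erase r) = n := by rw [Finset.card_erase_of_mem hr]; omega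
    have hmw : shift m w r w = m w - 1 := by simp [shift, hrw.symm]
    have key := ih (H := H ⊔ edge r w) (m := shift m w r) (R := R.erase r) (Q := Q.erase r) h'
      (fun e => hwR (Finset.mem_of_mem_erase e))
      (fun u hu => by
        rw [Finset.mem_erase] at hu
        have : w ≠ u := fun e => hwR (e ▸ hu.2)
        simp [edge_adj, hadj u hu.2, hu.1, hrw.symm])
      (Finset.erase_subset_erase r hQ)
      (fun r' hr' => (hsub r' hr').trans (h2 r' (Finset.mem_of_mem_erase hr')))
      (fun r' hr' hq => (hsub r' hr').trans (h1 r' (Finset.mem_of_mem_erase hr')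
        (fun e => hq (Finset.mem_erase.2 ⟨(Finset.mem_erase.1 hr').1, e⟩))))
      (fun _ => by have := hR hRne; rw [hmw, hcardR]; omega)
      (fun hq => by
        have hQe : Q.Nonempty := hq.mono (Finset.erase_subset _ _)
        have := hQw hQe
        have := Finset.card_pos.2 hQe
        rw [hmw, Finset.card_erase_of_mem (hrQ hQe)]; omega) hcardR
    have hG : H ⊔ edge r w ⊔ starAt w (R.erase r) = H ⊔ starAt w R := by
      rw [sup_assoc, sup_comm (edge r w), edge_comm, ← starAt_insert, Finset.insert_erase hr]
    rw [hG] at key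
    refine key.mono fun v => ?_
    have := hR hRne
    by_cases hvw : v = w
    · subst hvw
      rw [if_pos rfl, if_pos rfl, hmw]; omega
    · simp only [if_neg hvw, Finset.mem_erase, shift]
      by_cases hvr : v = r
      · simp [hvr, hr]
      · simp [hvr]

/-- The edges from `w` to `U` can be added. -/
theorem Realizable.star {N : ℕ} {H : SimpleGraph V} {m : V → ℕ} (h : Realizable N H m)
    {w : V} {U : Finset V} (hwU : w ∉ U) (hadj : ∀ u ∈ U, ¬ H.Adj w u) (hU : ∀ u ∈ U, 1 ≤ m u)
    (hw : ∀ v, H.Adj w v → 1 ≤ m v)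
    (hconf : ∀ u ∈ U, #(conflicts H m U u) ≤ 2) (hodd : Odd #U ∨ 1 ≤ m w)
    (hR : ∀ A ⊆ U, #(U \ A) ≤ #A → #A ≤ #(U \ A) + 1 → (U \ A).Nonempty →
      (∃ r ∈ U \ A, #(conflicts H m A r) ≤ 1) ∨ #(U \ A) + 2 ≤ m w + #A) :
    Realizable N (H ⊔ starAt w U) (fun v => if v = w then m w + (if Odd #U then 1 else 0)
      else if v ∈ U then 0 else m v) := by
  -- With half of #U rounded up on the giving side, `w` ends with a net gain of one exactly if #U is
  -- odd.
  obtain ⟨A, hAU, hA, h'⟩ := h.star_give hwU hadj hU hw ((#U + 1) / 2) (by omega)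
  have hRcard : #(U \ A) = #U - #A := Finset.card_sdiff_of_subset hAU
  have hAcard := Finset.card_le_card hAU
  set m' : V → ℕ := fun v => if v = w then m w + (#U + 1) / 2 else if v ∈ A then m v - 1 else m v
    with hm'
  have hsub : ∀ r ∈ U \ A, ∀ v, (H ⊔ starAt w A).Adj r v → m' v = 0 →
      H.Adj r v ∧ (m v = 0 ∨ v ∈ A) := by
    intro r hr v hv1 hv2
    rw [Finset.mem_sdiff] at hr
    have hrw : r ≠ w := fun e => hwU (e ▸ hr.1)
    have hv3 : H.Adj r v := by
      rw [sup_adj, starAt_adj] at hv1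
      exact hv1.resolve_right fun e => by simp [hr.2, hrw] at e
    refine ⟨hv3, ?_⟩
    have hvw : v ≠ w := fun e => hadj r hr.1 (e ▸ hv3.symm)
    simp only [hm', if_neg hvw] at hv2
    by_cases hvA : v ∈ A
    · exact Or.inr hvA
    · rw [if_neg hvA] at hv2; exact Or.inl hv2
  have hm'w : m' w = m w + (#U + 1) / 2 := by simp [hm']
  have hpar : Odd #U ∨ 1 ≤ m w ∧ #U % 2 = 0 := by
    rcases Nat.even_or_odd #U with h1 | h1
    · rcases hodd with h2 | h2
      · exact Or.inl h2
      · exact Or.inr ⟨h2, Nat.even_iff.1 h1⟩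
    · exact Or.inl h1
  rw [Nat.odd_iff] at hpar
  have key := h'.star_take (R := U \ A)
    (Q := {r ∈ U \ A | ¬ #(zeroNbrs (H ⊔ starAt w A) m' r) ≤ 1})
    (fun e => hwU (Finset.mem_sdiff.1 e).1)
    (fun u hu => by
      rw [Finset.mem_sdiff] at hu
      have : u ≠ w := fun e => hwU (e ▸ hu.1)
      simp [starAt_adj, hadj u hu.1, hu.2, this])
    (Finset.filter_subset _ _)
    (fun r hr => (Finset.card_le_card fun v hv => by
      obtain ⟨hv1, hv2⟩ := mem_zeroNbrs.1 hv
      obtain ⟨h3, h4⟩ := hsub r hr v hv1 hv2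
      exact mem_conflicts.2 ⟨h3, h4.imp_right fun e => hAU e⟩).trans
        (hconf r (Finset.mem_sdiff.1 hr).1))
    (fun r hr hr' => by
      by_contra hcon
      exact hr' (Finset.mem_filter.2 ⟨hr, hcon⟩))
    (fun _ => by rw [hm'w]; omega)
    (fun hq => by
      rw [hm'w]
      obtain ⟨r₀, hr₀⟩ := hq
      -- `Q` needs one end more than `R`: either some vertex of `R` is not in `Q`, or `w` has the
      -- end to spare.
      rcases hR A hAU (by omega) (by omega) ⟨r₀, (Finset.mem_filter.1 hr₀).1⟩ with
        ⟨r, hr, hr1⟩ | h3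
      · have hlt : #{r ∈ U \ A | ¬ #(zeroNbrs (H ⊔ starAt w A) m' r) ≤ 1} <
            #(U \ A) := by
          refine Finset.card_lt_card ((Finset.filter_ssubset).2 ⟨r, hr, not_not.2 ?_⟩)
          refine le_trans (Finset.card_le_card fun v hv => ?_) hr1
          obtain ⟨hv1, hv2⟩ := mem_zeroNbrs.1 hv
          exact mem_conflicts.2 (hsub r hr v hv1 hv2)
        omega
      · have hle := Finset.card_filter_le (U \ A)
          (fun r => ¬ #(zeroNbrs (H ⊔ starAt w A) m' r) ≤ 1)
        omega)
  have hG : H ⊔ starAt w A ⊔ starAt w (U \ A) = H ⊔ starAt w U := by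
    rw [sup_assoc, ← starAt_union, Finset.union_sdiff_of_subset hAU]
  rw [hG] at key
  refine key.mono fun v => ?_
  by_cases hvw : v = w
  · subst hvw
    rw [if_pos rfl, if_pos rfl, hm'w]
    simp only [Nat.odd_iff]
    split_ifs <;> omega
  · simp only [if_neg hvw, hm', Finset.mem_sdiff]
    by_cases hvA : v ∈ A
    · simp [hAU hvA]
    · by_cases hvU : v ∈ U
      · simp [hvU]
      · simp [hvU, hvA]

end Stars

/-! ### Admissible graphs, and the reductions down to small components of E. -/

section Admissible

open Finset SimpleGraph
open scoped Classical

variable {V : Type*} [Fintype V]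

/-- The neighbours of `v` that have even degree. -/
noncomputable def evenNbrs (G : SimpleGraph V) (v : V) : Finset V := {u ∈ nbrs G v | IsEven G u}

theorem mem_evenNbrs {G : SimpleGraph V} {u v : V} :
    u ∈ evenNbrs G v ↔ G.Adj v u ∧ IsEven G u := by simp [evenNbrs]

/-- `T` is the vertex set of a component of the E-subgraph that is a triangle. -/
def IsEvenTriangle (G : SimpleGraph V) (T : Finset V) : Prop :=
  #T = 3 ∧ ∀ u ∈ T, IsEven G u ∧ evenNbrs G u = T.erase u

/-- Some vertex `w` of odd degree has exactly one neighbour in `T`, or has a neighbour in `T` and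
a neighbour that is neither in `T` nor adjacent to `T`. -/
def IsGood (G : SimpleGraph V) (T : Finset V) : Prop :=
  ∃ w, ¬ IsEven G w ∧ ∃ x ∈ T, G.Adj w x ∧
    ((∀ y ∈ T, G.Adj w y → y = x) ∨ ∃ v, G.Adj w v ∧ v ∉ T ∧ ∀ u ∈ T, ¬ G.Adj v u)

/-- The graphs to which the reductions apply. -/
def IsAdmissible (G : SimpleGraph V) : Prop :=
  (∀ v, IsEven G v → #(evenNbrs G v) ≤ 3) ∧ ∀ T, IsEvenTriangle G T → IsGood G T

theorem nbrs_sdiff (G J : SimpleGraph V) (v : V) : nbrs (G \ J) v = nbrs G v \ nbrs J v := by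
  ext u; simp [sdiff_adj]

theorem nbrs_sup (G J : SimpleGraph V) (v : V) : nbrs (G ⊔ J) v = nbrs G v ∪ nbrs J v := by
  ext u; simp

theorem nbrs_mono {H G : SimpleGraph V} (h : H ≤ G) (v : V) : nbrs H v ⊆ nbrs G v := by
  intro u hu
  rw [mem_nbrs] at hu ⊢
  exact h hu

theorem isEven_sdiff {G J : SimpleGraph V} (h : J ≤ G) (v : V) :
    IsEven (G \ J) v ↔ (IsEven G v ↔ Even #(nbrs J v)) := by
  have h1 := Finset.card_le_card (nbrs_mono h v)
  rw [IsEven, IsEven, nbrs_sdiff, Finset.card_sdiff_of_subset (nbrs_mono h v), Nat.even_sub h1]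

theorem nbrs_starAt {w : V} {U : Finset V} (hw : w ∉ U) (v : V) :
    nbrs (starAt w U) v = if v = w then U else if v ∈ U then {w} else ∅ := by
  ext u
  rw [mem_nbrs, starAt_adj]
  split_ifs with h1 h2
  · subst h1
    constructor
    · rintro ⟨h3, h4 | h4⟩
      · exact h4.2
      · exact (h3 h4.1.symm).elim
    · exact fun hu => ⟨fun e => hw (e ▸ hu), Or.inl ⟨rfl, hu⟩⟩
  · simp only [h1, h2, Finset.mem_singleton]
    constructor
    · tauto
    · rintro rfl; exact ⟨h1, Or.inr ⟨rfl, trivial⟩⟩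
  · simp [h1, h2]

theorem nbrs_edge {a b : V} (hab : a ≠ b) (v : V) :
    nbrs (edge a b) v = if v = a then {b} else if v = b then {a} else ∅ := by
  rw [← starAt_singleton, nbrs_starAt (by simpa using hab)]
  simp

/-- Twice the number of edges. -/
noncomputable def size (G : SimpleGraph V) : ℕ := ∑ v, #(nbrs G v)

theorem size_sdiff_lt {G J : SimpleGraph V} (h : J ≤ G) {a b : V} (hab : J.Adj a b) :
    size (G \ J) < size G := by
  refine Finset.sum_lt_sum (fun v _ => Finset.card_le_card (nbrs_mono sdiff_le v))
    ⟨a, Finset.mem_univ _, Finset.card_lt_card ?_⟩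
  rw [nbrs_sdiff]
  exact Finset.sdiff_ssubset (nbrs_mono h a) ⟨b, by simpa⟩

theorem oddInd_eq_zero {G : SimpleGraph V} {v : V} : oddInd G v = 0 ↔ IsEven G v := by
  simp [oddInd]

theorem one_le_oddInd {G : SimpleGraph V} {v : V} (h : ¬ IsEven G v) : 1 ≤ oddInd G v := by
  simp [oddInd, h]

theorem oddInd_eq_one {G : SimpleGraph V} {v : V} (h : ¬ IsEven G v) : oddInd G v = 1 := by
  simp [oddInd, h]

/-- The witness keeps its parity and its edges, and the clauses that demand non-adjacency only
become easier in a subgraph. -/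
theorem IsGood.mono {G H : SimpleGraph V} {T : Finset V} (h : IsGood G T) (hHG : H ≤ G)
    (hw : ∀ a, ¬ IsEven G a → (∃ u ∈ T, G.Adj a u) →
      ¬ IsEven H a ∧ ∀ b, G.Adj a b → H.Adj a b) : IsGood H T := by
  obtain ⟨w, hw1, x, hx, hwx, hor⟩ := h
  obtain ⟨h1, h2⟩ := hw w hw1 ⟨x, hx, hwx⟩
  refine ⟨w, h1, x, hx, h2 x hwx, ?_⟩
  rcases hor with h3 | ⟨v, h3, h4, h5⟩
  · exact Or.inl fun y hy hwy => h3 y hy (hHG hwy)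
  · exact Or.inr ⟨v, h2 v h3, h4, fun u hu huv => h5 u hu (hHG huv)⟩

/-- Newly even vertices are isolated in the new E, so no component of E grows. A triangle component
of the new E already exhausts the even degree 2 allowed in `G`, hence was a component there. -/
theorem IsAdmissible.of_le {G H : SimpleGraph V} (hG : IsAdmissible G) (hHG : H ≤ G)
    (h0 : ∀ u, IsEven G u → #(evenNbrs G u) ≤ 2)
    (h1 : ∀ u, IsEven H u → ¬ IsEven G u → evenNbrs H u = ∅)
    (h2 : ∀ T, IsEvenTriangle G T → (∀ u ∈ T, IsEven H u) → ∀ a, ¬ IsEven G a →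
      (∃ u ∈ T, G.Adj a u) → ¬ IsEven H a ∧ ∀ b, G.Adj a b → H.Adj a b) : IsAdmissible H := by
  have hsub : ∀ u, IsEven H u → evenNbrs H u ⊆ evenNbrs G u := by
    intro u hu v hv
    rw [mem_evenNbrs] at hv ⊢
    refine ⟨hHG hv.1, ?_⟩
    by_contra hvG
    have h3 : u ∈ evenNbrs H v := mem_evenNbrs.2 ⟨hv.1.symm, hu⟩
    rw [h1 v hv.2 hvG] at h3
    simp at h3
  refine ⟨fun v hv => ?_, fun T hT => ?_⟩
  · by_cases hvG : IsEven G v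
    · exact (Finset.card_le_card (hsub v hv)).trans ((h0 v hvG).trans (by norm_num))
    · rw [h1 v hv hvG]; simp
  · have hTG : IsEvenTriangle G T := by
      refine ⟨hT.1, fun u hu => ?_⟩
      obtain ⟨hu1, hu2⟩ := hT.2 u hu
      have hcard : #(T.erase u) = 2 := by rw [Finset.card_erase_of_mem hu, hT.1]
      have huG : IsEven G u := by
        by_contra huG
        rw [← hu2, h1 u hu1 huG] at hcard
        simp at hcard
      refine ⟨huG, ?_⟩
      rw [← hu2]
      refine (Finset.eq_of_subset_of_card_le (hsub u hu1) ?_).symm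
      rw [hu2, hcard]; exact h0 u huG
    exact (hG.2 T hTG).mono hHG (h2 T hTG fun u hu => (hT.2 u hu).1)

/-- Reduction at a vertex `x` of degree three of the E-subgraph. -/
theorem realizable_of_three {G : SimpleGraph V} (hG : IsAdmissible G)
    (ih : ∀ H : SimpleGraph V, size H < size G → IsAdmissible H →
      Realizable (Fintype.card V) H 0)
    {x : V} (hx : IsEven G x) (hx3 : #(evenNbrs G x) = 3)
    (hC : ∀ s ∈ evenNbrs G x, ∀ t₁ ∈ evenNbrs G s, ∀ t₂ ∈ evenNbrs G s, ∀ t₃ ∈ evenNbrs G t₁,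
      t₁ ∉ evenNbrs G x → t₂ ∉ evenNbrs G x → t₁ ≠ x → t₂ ≠ x → t₃ ≠ s →
      G.Adj t₁ t₂ → G.Adj t₂ t₃ → False) :
    Realizable (Fintype.card V) G 0 := by
  set U := evenNbrs G x with hU
  have hxU : x ∉ U := fun h => G.irrefl (mem_evenNbrs.1 h).1
  have hle : starAt x U ≤ G := starAt_le fun u hu => (mem_evenNbrs.1 hu).1
  set H := G \ starAt x U with hH
  have hHG : H ≤ G := sdiff_le
  have hHadj : ∀ a b, H.Adj a b ↔ G.Adj a b ∧ ¬ ((a = x ∧ b ∈ U) ∨ (b = x ∧ a ∈ U)) := by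
    intro a b
    rw [hH, sdiff_adj, starAt_adj]
    constructor
    · exact fun h => ⟨h.1, fun h' => h.2 ⟨h.1.ne, h'⟩⟩
    · exact fun h => ⟨h.1, fun h' => h.2 h'.2⟩
  have hev : ∀ v, IsEven H v ↔ IsEven G v ∧ v ≠ x ∧ v ∉ U := by
    intro v
    rw [hH, isEven_sdiff hle, nbrs_starAt hxU]
    split_ifs with h1 h2
    · subst h1
      have : ¬ Even 3 := by decide
      simp [hx3, hx, this]
    · have := (mem_evenNbrs.1 h2).2
      simp [this, h2]
    · simp [h1, h2]
  have hsub : ∀ v, evenNbrs H v ⊆ evenNbrs G v := by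
    intro v u hu
    rw [mem_evenNbrs] at hu ⊢
    exact ⟨hHG hu.1, ((hev u).1 hu.2).1⟩
  have hadm : IsAdmissible H := by
    refine ⟨fun v hv => (Finset.card_le_card (hsub v)).trans (hG.1 v ((hev v).1 hv).1),
      fun T hT => ?_⟩
    by_cases hTG : IsEvenTriangle G T
    · refine (hG.2 T hTG).mono hHG fun a ha _ => ⟨fun h => ha ((hev a).1 h).1, fun b hab => ?_⟩
      rw [hHadj]
      refine ⟨hab, ?_⟩
      rintro (⟨rfl, _⟩ | ⟨_, h⟩)
      · exact ha hx
      · exact ha (mem_evenNbrs.1 h).2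
    -- A triangle becomes a new component only because some neighbour `s` in `U` turned odd. This
    -- `s` witnesses goodness: a second neighbour in `T` is excluded by `hC`.
    · have : ∃ t ∈ T, evenNbrs G t ≠ T.erase t := by
        by_contra hcon
        push Not at hcon
        exact hTG ⟨hT.1, fun u hu => ⟨((hev u).1 (hT.2 u hu).1).1, hcon u hu⟩⟩
      obtain ⟨t, ht, hne⟩ := this
      obtain ⟨htH, htN⟩ := hT.2 t ht
      have htG := (hev t).1 htH
      obtain ⟨s, hs, hs'⟩ : ∃ s ∈ evenNbrs G t, s ∉ evenNbrs H t := by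
        by_contra hcon
        push Not at hcon
        exact hne (htN ▸ Finset.Subset.antisymm hcon (hsub t))
      rw [mem_evenNbrs] at hs
      have hts : H.Adj t s := by
        rw [hHadj]
        refine ⟨hs.1, ?_⟩
        rintro (⟨h, _⟩ | ⟨_, h⟩)
        · exact htG.2.1 h
        · exact htG.2.2 h
      have hsH : ¬ IsEven H s := fun h => hs' (mem_evenNbrs.2 ⟨hts, h⟩)
      have hsU : s ∈ U := by
        by_contra hsU
        refine hsH ((hev s).2 ⟨hs.2, ?_, hsU⟩)
        rintro rfl
        exact htG.2.2 (mem_evenNbrs.2 ⟨hs.1.symm, htG.1⟩)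
      refine ⟨s, hsH, t, ht, hts.symm, Or.inl fun t₂ ht₂ hst₂ => ?_⟩
      by_contra hne'
      have ht₂G := (hev t₂).1 (hT.2 t₂ ht₂).1
      have hadjT : ∀ a ∈ T, ∀ b ∈ T, a ≠ b → G.Adj a b ∧ IsEven G b := by
        intro a ha b hb hab
        have : b ∈ evenNbrs H a := by
          rw [(hT.2 a ha).2]; exact Finset.mem_erase.2 ⟨hab.symm, hb⟩
        exact mem_evenNbrs.1 (hsub a this)
      obtain ⟨t₃, ht₃⟩ : ((T.erase t).erase t₂).Nonempty := by
        rw [← Finset.card_pos, Finset.card_erase_of_mem (Finset.mem_erase.2 ⟨hne', ht₂⟩),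
          Finset.card_erase_of_mem ht, hT.1]
        norm_num
      simp only [Finset.mem_erase] at ht₃
      have hst₃ : t₃ ≠ s := fun e => hsH (e ▸ (hT.2 t₃ ht₃.2.2).1)
      exact hC s hsU t (mem_evenNbrs.2 ⟨hs.1.symm, htG.1⟩) t₂ (mem_evenNbrs.2 ⟨hHG hst₂, ht₂G.1⟩)
        t₃ (mem_evenNbrs.2 (hadjT t ht t₃ ht₃.2.2 ht₃.2.1.symm)) htG.2.2 ht₂G.2.2 htG.2.1 ht₂G.2.1
        hst₃ (hadjT t ht t₂ ht₂ (Ne.symm hne')).1 (hadjT t₂ ht₂ t₃ ht₃.2.2 ht₃.1.symm).1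
  obtain ⟨u₀, hu₀⟩ : U.Nonempty := by rw [← Finset.card_pos, hx3]; norm_num
  have hreal := (ih H (size_sdiff_lt hle (a := x) (b := u₀)
    ⟨fun e => hxU (e ▸ hu₀), Or.inl ⟨rfl, hu₀⟩⟩) hadm).odd
  have hHx : ∀ u ∈ U, ¬ H.Adj x u := fun u hu h => ((hHadj x u).1 h).2 (Or.inl ⟨rfl, hu⟩)
  have hfin := hreal.star hxU hHx
    (fun u hu => one_le_oddInd fun h => ((hev u).1 h).2.2 hu)
    (fun v hv => one_le_oddInd fun h => by
      have h1 := (hev v).1 h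
      exact h1.2.2 (mem_evenNbrs.2 ⟨hHG hv, h1.1⟩))
    (fun u hu => by
      have hxu : x ∈ evenNbrs G u := mem_evenNbrs.2 ⟨(mem_evenNbrs.1 hu).1.symm, hx⟩
      have h3 := hG.1 u (mem_evenNbrs.1 hu).2
      have h4 : conflicts H (oddInd H) U u ⊆ (evenNbrs G u).erase x := by
        intro v hv
        obtain ⟨hv1, hv2⟩ := mem_conflicts.1 hv
        refine Finset.mem_erase.2 ⟨fun e => hHx u hu (e ▸ hv1.symm), mem_evenNbrs.2 ⟨hHG hv1, ?_⟩⟩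
        rcases hv2 with hv2 | hv2
        · exact ((hev v).1 (oddInd_eq_zero.1 hv2)).1
        · exact (mem_evenNbrs.1 hv2).2
      have h5 := Finset.card_le_card h4
      rw [Finset.card_erase_of_mem hxu] at h5
      omega)
    (Or.inl (by rw [hx3]; decide))
    -- Here #U = 3, so two edges are given and one is taken; `x` is odd in `H` and contributes the
    -- spare end.
    (fun A hA h1 h2 _ => Or.inr (by
      have h3 : #(U \ A) = #U - #A := Finset.card_sdiff_of_subset hA
      have h4 := one_le_oddInd (G := H) (v := x) fun h => ((hev x).1 h).2.1 rfl
      omega))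
  rw [hH, sdiff_sup_cancel hle] at hfin
  exact hfin.mono fun v => Nat.zero_le _

/-- Reduction when the E-subgraph has a vertex of degree three. -/
theorem realizable_of_exists_three {G : SimpleGraph V} (hG : IsAdmissible G)
    (ih : ∀ H : SimpleGraph V, size H < size G → IsAdmissible H →
      Realizable (Fintype.card V) H 0)
    {x : V} (hx : IsEven G x) (hx3 : #(evenNbrs G x) = 3) :
    Realizable (Fintype.card V) G 0 := by
  by_contra hcon
  refine hcon (realizable_of_three hG ih hx hx3 ?_)
  intro s hs t₁ ht₁ t₂ ht₂ t₃ ht₃ _ _ _ _ ht₃s h12 h23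
  rw [mem_evenNbrs] at hs ht₁ ht₂ ht₃
  have hsub : {t₂, t₃, s} ⊆ evenNbrs G t₁ := by
    intro v hv
    simp only [Finset.mem_insert, Finset.mem_singleton] at hv
    rcases hv with rfl | rfl | rfl
    exacts [mem_evenNbrs.2 ⟨h12, ht₂.2⟩, mem_evenNbrs.2 ht₃, mem_evenNbrs.2 ⟨ht₁.1.symm, hs.2⟩]
  have hcard : #({t₂, t₃, s} : Finset V) = 3 := by
    rw [Finset.card_eq_three]
    exact ⟨t₂, t₃, s, h23.ne, ht₂.1.ne', ht₃s, rfl⟩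
  have heq : evenNbrs G t₁ = {t₂, t₃, s} :=
    (Finset.eq_of_subset_of_card_le hsub (by rw [hcard]; exact hG.1 t₁ ht₁.2)).symm
  have hout : ∀ s' a b c d, IsEven G s' → a ∈ evenNbrs G s' → b ∈ evenNbrs G s' →
      c ∈ evenNbrs G s' → d ∈ evenNbrs G s' → a ≠ b → c ≠ d → c ≠ a → c ≠ b → d ≠ a → d ≠ b →
      False := by
    intro s' a b c d hs' ha hb hc hd h1 h2 h3 h4 h5 h6
    have h7 : ({a, b, c, d} : Finset V) ⊆ evenNbrs G s' := by
      intro v hv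
      simp only [Finset.mem_insert, Finset.mem_singleton] at hv
      rcases hv with rfl | rfl | rfl | rfl <;> assumption
    have h8 := (Finset.card_le_card h7).trans (hG.1 s' hs')
    rw [Finset.card_insert_of_notMem (by simp [h1, h3.symm, h5.symm]),
      Finset.card_insert_of_notMem (by simp [h4.symm, h6.symm]), Finset.card_pair h2] at h8
    omega
  -- If the condition fails at `x`, the vertex `t₁` has degree 3 in E and serves instead: each of
  -- its three even neighbours already has two even neighbours among `t₁` and the others, so a
  -- failure there would force a fourth.
  refine hcon (realizable_of_three hG ih ht₁.2 (by rw [heq, hcard]) ?_)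
  intro s' hs' a ha b hb c hc ha1 hb1 ha2 hb2 hcs hab hbc
  rw [heq] at hs' ha1 hb1
  simp only [Finset.mem_insert, Finset.mem_singleton, not_or] at hs' ha1 hb1
  have m21 : t₁ ∈ evenNbrs G t₂ := mem_evenNbrs.2 ⟨h12.symm, ht₁.2⟩
  have m23 : t₃ ∈ evenNbrs G t₂ := mem_evenNbrs.2 ⟨h23, ht₃.2⟩
  have m31 : t₁ ∈ evenNbrs G t₃ := mem_evenNbrs.2 ⟨ht₃.1.symm, ht₁.2⟩
  have m32 : t₂ ∈ evenNbrs G t₃ := mem_evenNbrs.2 ⟨h23.symm, ht₂.2⟩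
  rcases hs' with rfl | rfl | rfl
  · exact hout s' t₁ t₃ a b ht₂.2 m21 m23 ha hb ht₃.1.ne hab.ne ha2 ha1.2.1 hb2 hb1.2.1
  · exact hout s' t₁ t₂ a b ht₃.2 m31 m32 ha hb h12.ne hab.ne ha2 ha1.1 hb2 hb1.1
  · exact hout s' t₁ t₂ a b hs.2 (mem_evenNbrs.2 ht₁) (mem_evenNbrs.2 ht₂) ha hb h12.ne hab.ne
      ha2 ha1.1 hb2 hb1.1

/-- Reduction at a vertex of degree one of the E-subgraph. -/
theorem realizable_of_leaf {G : SimpleGraph V} (hG : IsAdmissible G)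
    (ih : ∀ H : SimpleGraph V, size H < size G → IsAdmissible H →
      Realizable (Fintype.card V) H 0)
    (h2 : ∀ u, IsEven G u → #(evenNbrs G u) ≤ 2) {x y : V} (hx : IsEven G x)
    (hxy : evenNbrs G x = {y}) : Realizable (Fintype.card V) G 0 := by
  have hy : y ∈ evenNbrs G x := by simp [hxy]
  rw [mem_evenNbrs] at hy
  have hle : edge x y ≤ G := edge_le hy.1
  set H := G \ edge x y with hH
  have hHG : H ≤ G := sdiff_le
  have hev : ∀ v, IsEven H v ↔ IsEven G v ∧ v ≠ x ∧ v ≠ y := by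
    intro v
    rw [hH, isEven_sdiff hle, nbrs_edge hy.1.ne]
    split_ifs with h1 h2
    · subst h1; simp [hx]
    · subst h2; simp [hy.2]
    · simp [h1, h2]
  have hadm : IsAdmissible H := by
    refine hG.of_le hHG h2 (fun u h h' => (h' ((hev u).1 h).1).elim) fun T hT hTH a ha _ => ?_
    refine ⟨fun h => ha ((hev a).1 h).1, fun b hab => ?_⟩
    rw [hH, sdiff_adj, edge_adj_iff hy.1.ne]
    refine ⟨hab, ?_⟩
    rintro (⟨rfl, _⟩ | ⟨rfl, _⟩)
    exacts [ha hx, ha hy.2]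
  have hreal := (ih H (size_sdiff_lt hle (a := x) (b := y) (by simp [edge_adj, hy.1.ne])) hadm).odd
  have hnadj : ¬ H.Adj x y := by simp [hH, sdiff_adj, edge_adj, hy.1.ne]
  refine (hreal.move x y hy.1.ne hnadj (H' := G) ?_ ?_).mono fun v => Nat.zero_le _
  -- The end at `y` pays for the edge, since `y` was the only even neighbour of `x`.
  · rw [oddInd_eq_one fun h => ((hev y).1 h).2.2 rfl, Nat.lt_one_iff, Finset.card_eq_zero,
      Finset.eq_empty_iff_forall_notMem]
    intro v hv
    obtain ⟨h3, h4⟩ := mem_zeroNbrs.1 hv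
    have h5 : v ∈ evenNbrs G x :=
      mem_evenNbrs.2 ⟨hHG h3, ((hev v).1 (oddInd_eq_zero.1 h4)).1⟩
    rw [hxy, Finset.mem_singleton] at h5
    exact hnadj (h5 ▸ h3)
  · rw [hH, sdiff_sup_cancel hle]

/-- Reduction at two adjacent vertices of degree two of the E-subgraph. -/
theorem realizable_of_path {G : SimpleGraph V} (hG : IsAdmissible G)
    (ih : ∀ H : SimpleGraph V, size H < size G → IsAdmissible H →
      Realizable (Fintype.card V) H 0)
    (h2 : ∀ u, IsEven G u → #(evenNbrs G u) ≤ 2) {a b c d : V}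
    (hac : a ≠ c) (hbd : b ≠ d) (had : a ≠ d)
    (hb : evenNbrs G b = {a, c}) (hc : evenNbrs G c = {b, d}) :
    Realizable (Fintype.card V) G 0 := by
  have hba : G.Adj b a ∧ IsEven G a := mem_evenNbrs.1 (by simp [hb])
  have hbc : G.Adj b c ∧ IsEven G c := mem_evenNbrs.1 (by simp [hb])
  have hcb : G.Adj c b ∧ IsEven G b := mem_evenNbrs.1 (by simp [hc])
  have hcd : G.Adj c d ∧ IsEven G d := mem_evenNbrs.1 (by simp [hc])
  have nba := hba.1.ne
  have ncd := hcd.1.ne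
  have nbc := hbc.1.ne
  have hle : edge b a ⊔ edge c d ≤ G := sup_le (edge_le hba.1) (edge_le hcd.1)
  set H := G \ (edge b a ⊔ edge c d) with hH
  have hHG : H ≤ G := sdiff_le
  have hev : ∀ v, IsEven H v ↔ IsEven G v ∧ v ≠ a ∧ v ≠ b ∧ v ≠ c ∧ v ≠ d := by
    intro v
    rw [hH, isEven_sdiff hle, nbrs_sup, nbrs_edge nba, nbrs_edge ncd]
    by_cases e1 : v = b
    · subst e1; simp [hcb.2, nbc, hbd]
    by_cases e2 : v = a
    · subst e2; simp [hba.2, e1, hac, had]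
    by_cases e3 : v = c
    · subst e3; simp [hbc.2, e1, e2]
    by_cases e4 : v = d
    · subst e4; simp [hcd.2, e1, e2, e3]
    · simp [e1, e2, e3, e4]
  have hadm : IsAdmissible H := by
    refine hG.of_le hHG h2 (fun u h h' => (h' ((hev u).1 h).1).elim) fun T hT hTH x hx _ => ?_
    refine ⟨fun h => hx ((hev x).1 h).1, fun y hxy => ?_⟩
    rw [hH, sdiff_adj, sup_adj, edge_adj_iff nba, edge_adj_iff ncd]
    refine ⟨hxy, ?_⟩
    rintro ((⟨rfl, _⟩ | ⟨rfl, _⟩) | (⟨rfl, _⟩ | ⟨rfl, _⟩))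
    exacts [hx hcb.2, hx hba.2, hx hbc.2, hx hcd.2]
  have hreal := (ih H (size_sdiff_lt hle (a := b) (b := a) (by simp [edge_adj, nba])) hadm).odd
  have hHba : ¬ H.Adj b a := by simp [hH, sdiff_adj, edge_adj, nba]
  have hHcd : ¬ (H ⊔ edge b a).Adj c d := by
    simp [hH, sdiff_adj, edge_adj, ncd, nbc.symm, hac.symm]
  have h3 := hreal.move b a nba hHba (H' := H ⊔ edge b a) (by
    rw [oddInd_eq_one fun h => ((hev a).1 h).2.1 rfl, Nat.lt_one_iff, Finset.card_eq_zero,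
      Finset.eq_empty_iff_forall_notMem]
    intro v hv
    obtain ⟨h3, h4⟩ := mem_zeroNbrs.1 hv
    have h5 := (hev v).1 (oddInd_eq_zero.1 h4)
    have h6 : v ∈ evenNbrs G b := mem_evenNbrs.2 ⟨hHG h3, h5.1⟩
    simp [hb, h5.2] at h6) rfl
  have hG' : H ⊔ edge b a ⊔ edge c d = G := by rw [sup_assoc, hH, sdiff_sup_cancel hle]
  -- The vertex `a`, whose end was spent, is not adjacent to `c`, because the even neighbours of `c`
  -- are just `b` and `d`; `b` has gained an end.
  refine (h3.move c d ncd hHcd (H' := G) ?_ hG'.symm).mono fun v => Nat.zero_le _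
  have hd1 : shift (oddInd H) a b d = 1 := by
    simp [shift, hbd.symm, had.symm, oddInd_eq_one fun h => ((hev d).1 h).2.2.2.2 rfl]
  rw [hd1, Nat.lt_one_iff, Finset.card_eq_zero, Finset.eq_empty_iff_forall_notMem]
  intro v hv
  obtain ⟨h4, h5⟩ := mem_zeroNbrs.1 hv
  have hvG : G.Adj c v := by rw [← hG']; exact Or.inl h4
  have hvE : IsEven G v := by
    unfold shift at h5
    split_ifs at h5 with e1 e2
    · exact e2 ▸ hba.2
    · exact ((hev v).1 (oddInd_eq_zero.1 h5)).1
  have h6 : v ∈ evenNbrs G c := mem_evenNbrs.2 ⟨hvG, hvE⟩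
  rw [hc, Finset.mem_insert, Finset.mem_singleton] at h6
  rcases h6 with rfl | rfl
  · simp [shift] at h5
  · exact hHcd h4

end Admissible

/-! ### The star reduction at an odd vertex. -/

section StarReduction

open Finset SimpleGraph
open scoped Classical

variable {V : Type*}

/-- The graph with the edges between `y T` and `z T`, for `T` in `S`. -/
noncomputable def mateGraph (S : Finset (Finset V)) (y z : Finset V → V) : SimpleGraph V :=
  S.sup fun T => edge (y T) (z T)

theorem mateGraph_adj {S : Finset (Finset V)} {y z : Finset V → V} {a b : V} :
    (mateGraph S y z).Adj a b ↔ ∃ T ∈ S, (edge (y T) (z T)).Adj a b := by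
  unfold mateGraph
  induction S using Finset.induction_on with
  | empty => simp
  | insert T S _ ih => rw [Finset.sup_insert, sup_adj, ih]; simp

variable [Fintype V]

theorem IsEvenTriangle.eq_insert {G : SimpleGraph V} {T : Finset V} (hT : IsEvenTriangle G T)
    {u : V} (hu : u ∈ T) : T = insert u (evenNbrs G u) := by
  rw [(hT.2 u hu).2, Finset.insert_erase hu]

theorem IsEvenTriangle.eq_of_mem {G : SimpleGraph V} {T T' : Finset V} (hT : IsEvenTriangle G T)
    (hT' : IsEvenTriangle G T') {u : V} (hu : u ∈ T) (hu' : u ∈ T') : T = T' := by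
  rw [hT.eq_insert hu, hT'.eq_insert hu']

theorem IsEvenTriangle.mem_of_adj {G : SimpleGraph V} {T : Finset V} (hT : IsEvenTriangle G T)
    {u v : V} (hu : u ∈ T) (huv : G.Adj u v) (hv : IsEven G v) : v ∈ T := by
  have : v ∈ evenNbrs G u := mem_evenNbrs.2 ⟨huv, hv⟩
  rw [(hT.2 u hu).2] at this
  exact Finset.mem_of_mem_erase this

theorem IsEvenTriangle.adj {G : SimpleGraph V} {T : Finset V} (hT : IsEvenTriangle G T)
    {u v : V} (hu : u ∈ T) (hv : v ∈ T) (huv : u ≠ v) : G.Adj u v := by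
  have : v ∈ evenNbrs G u := by
    rw [(hT.2 u hu).2]; exact Finset.mem_erase.2 ⟨huv.symm, hv⟩
  exact (mem_evenNbrs.1 this).1

/-- Every component of the E-subgraph is a vertex or a triangle. -/
def HasSmallParts (G : SimpleGraph V) : Prop :=
  ∀ u, IsEven G u → evenNbrs G u = ∅ ∨ IsEvenTriangle G (insert u (evenNbrs G u))

theorem HasSmallParts.card_le {G : SimpleGraph V} (h : HasSmallParts G) {u : V}
    (hu : IsEven G u) : #(evenNbrs G u) ≤ 2 := by
  rcases h u hu with h1 | h1
  · simp [h1]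
  · have h2 := h1.1
    rw [Finset.card_insert_of_notMem fun e => G.irrefl (mem_evenNbrs.1 e).1] at h2
    omega

/-- Reduction at a vertex `w` of odd degree. The edges from `w` to its even neighbours are removed,
and for each triangle in `𝓜` the edge `y T z T`; then the vertices `z T` keep their edges to `w`. -/
theorem realizable_of_star {G : SimpleGraph V} (hG : IsAdmissible G)
    (ih : ∀ H : SimpleGraph V, size H < size G → IsAdmissible H →
      Realizable (Fintype.card V) H 0)
    (hsp : HasSmallParts G) {w : V} (hw : ¬ IsEven G w) (𝓜 : Finset (Finset V))
    (y z : Finset V → V)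
    (h𝓜 : ∀ T ∈ 𝓜, IsEvenTriangle G T ∧ y T ∈ T ∧ z T ∈ T ∧ y T ≠ z T ∧ ¬ G.Adj w (y T) ∧
      ∀ v ∈ T, v ≠ y T → v ≠ z T → G.Adj w v)
    {U : Finset V} (hU : ∀ u, u ∈ U ↔ u ∈ evenNbrs G w ∧ ∀ T ∈ 𝓜, u ≠ z T) (hne : U.Nonempty)
    (hz : Even #U ∨ ∀ T ∈ 𝓜, ¬ G.Adj w (z T))
    (hR : ∀ A ⊆ U, #(U \ A) ≤ #A → #A ≤ #(U \ A) + 1 → (U \ A).Nonempty →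
      ∃ r ∈ U \ A, evenNbrs G r = ∅ ∨
        ∃ v ∈ evenNbrs G r, v ∉ A ∧ (v ∈ U ∨ ∃ T ∈ 𝓜, v = z T)) :
    Realizable (Fintype.card V) G 0 := by
  have hUe : ∀ u ∈ U, G.Adj w u ∧ IsEven G u := fun u hu => mem_evenNbrs.1 ((hU u).1 hu).1
  have hwU : w ∉ U := fun h => G.irrefl (hUe w h).1
  have hTe : ∀ T ∈ 𝓜, ∀ v ∈ T, IsEven G v := fun T hT v hv => ((h𝓜 T hT).1.2 v hv).1
  have hwT : ∀ T ∈ 𝓜, w ∉ T := fun T hT h => hw (hTe T hT w h)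
  have huniq : ∀ T ∈ 𝓜, ∀ T' ∈ 𝓜, ∀ v ∈ T, v ∈ T' → T = T' := fun T hT T' hT' v hv hv' =>
    (h𝓜 T hT).1.eq_of_mem (h𝓜 T' hT').1 hv hv'
  have hUy : ∀ u ∈ U, ∀ T ∈ 𝓜, u ≠ y T := fun u hu T hT e => (h𝓜 T hT).2.2.2.2.1 (e ▸ (hUe u hu).1)
  have hUz : ∀ u ∈ U, ∀ T ∈ 𝓜, u ≠ z T := fun u hu => ((hU u).1 hu).2
  have hmate : ∀ S ⊆ 𝓜, ∀ a b, (mateGraph S y z).Adj a b ↔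
      ∃ T ∈ S, (a = y T ∧ b = z T) ∨ (a = z T ∧ b = y T) := by
    intro S hS a b
    rw [mateGraph_adj]
    refine exists_congr fun T => and_congr_right fun hT => ?_
    rw [edge_adj_iff (h𝓜 T (hS hT)).2.2.2.1]
  have hmem : ∀ T ∈ 𝓜, ∀ v, v = y T ∨ v = z T → v ∈ T := by
    rintro T hT v (rfl | rfl)
    exacts [(h𝓜 T hT).2.1, (h𝓜 T hT).2.2.1]
  have hMle : mateGraph 𝓜 y z ≤ G := by
    intro a b hab
    obtain ⟨T, hT, h⟩ := (hmate 𝓜 subset_rfl a b).1 hab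
    obtain ⟨h1, h2, h3, h4, _⟩ := h𝓜 T hT
    rcases h with ⟨rfl, rfl⟩ | ⟨rfl, rfl⟩
    exacts [h1.adj h2 h3 h4, (h1.adj h2 h3 h4).symm]
  have hle : starAt w U ⊔ mateGraph 𝓜 y z ≤ G :=
    sup_le (starAt_le fun u hu => (hUe u hu).1) hMle
  set H := G \ (starAt w U ⊔ mateGraph 𝓜 y z) with hH
  have hHG : H ≤ G := sdiff_le
  have hMw : ∀ S ⊆ 𝓜, ∀ v, ¬ (mateGraph S y z).Adj w v := by
    intro S hS v h
    obtain ⟨T, hT, h⟩ := (hmate S hS w v).1 h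
    exact hwT T (hS hT) (hmem T (hS hT) w (h.imp And.left And.left))
  have hMe : ∀ v, nbrs (mateGraph 𝓜 y z) v =
      if h : ∃ T ∈ 𝓜, v = y T ∨ v = z T then
        (if v = y h.choose then {z h.choose} else {y h.choose}) else ∅ := by
    intro v
    ext u
    rw [mem_nbrs, hmate 𝓜 subset_rfl]
    split_ifs with h h1
    · obtain ⟨hT, hor⟩ := h.choose_spec
      set T := h.choose
      rw [Finset.mem_singleton]
      constructor
      · rintro ⟨T', hT', h2⟩
        have e : T' = T := huniq T' hT' T hT v (hmem T' hT' v (h2.imp And.left And.left))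
          (hmem T hT v hor)
        subst e
        rcases h2 with h2 | h2
        · exact h2.2
        · exact ((h𝓜 _ hT).2.2.2.1 (h1.symm.trans h2.1)).elim
      · exact fun h2 => ⟨T, hT, Or.inl ⟨h1, h2⟩⟩
    · obtain ⟨hT, hor⟩ := h.choose_spec
      set T := h.choose
      rw [Finset.mem_singleton]
      constructor
      · rintro ⟨T', hT', h2⟩
        have e : T' = T := huniq T' hT' T hT v (hmem T' hT' v (h2.imp And.left And.left))
          (hmem T hT v hor)
        subst e
        rcases h2 with h2 | h2
        · exact (h1 h2.1).elim
        · exact h2.2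
      · exact fun h2 => ⟨T, hT, Or.inr ⟨hor.resolve_left h1, h2⟩⟩
    · simp only [Finset.notMem_empty, iff_false]
      rintro ⟨T, hT, h2⟩
      exact h ⟨T, hT, h2.imp And.left And.left⟩
  -- The centre `w` is the only vertex that can turn even, and does so exactly if #U is odd.
  have hev : ∀ v, IsEven H v ↔ (v = w ∧ Odd #U) ∨
      (IsEven G v ∧ v ∉ U ∧ ¬ ∃ T ∈ 𝓜, v = y T ∨ v = z T) := by
    intro v
    rw [hH, isEven_sdiff hle, nbrs_sup, nbrs_starAt hwU, hMe]
    by_cases h1 : v = w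
    · subst h1
      have h2 : ¬ ∃ T ∈ 𝓜, v = y T ∨ v = z T := fun ⟨T, hT, h⟩ => hwT T hT (hmem T hT v h)
      rw [dif_neg h2]
      simp [hw]
    · by_cases h2 : v ∈ U
      · have h3 : ¬ ∃ T ∈ 𝓜, v = y T ∨ v = z T := by
          rintro ⟨T, hT, h | h⟩
          exacts [hUy v h2 T hT h, hUz v h2 T hT h]
        rw [dif_neg h3]
        simp [h1, h2, (hUe v h2).2]
      · by_cases h3 : ∃ T ∈ 𝓜, v = y T ∨ v = z T
        · rw [dif_pos h3]
          obtain ⟨T, hT, h4⟩ := h3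
          have h5 : IsEven G v := hTe T hT v (hmem T hT v h4)
          have h6 : ∃ T ∈ 𝓜, v = y T ∨ v = z T := ⟨T, hT, h4⟩
          simp only [h1, h2, h5, h6, if_false]
          split_ifs <;> simp
        · rw [dif_neg h3]
          simp [h1, h2]
          push Not at h3
          exact fun _ T hT => h3 T hT
  have hTodd : ∀ T ∈ 𝓜, ∀ v ∈ T, ¬ IsEven H v := by
    intro T hT v hv h
    rcases (hev v).1 h with ⟨rfl, _⟩ | ⟨h1, h2, h3⟩
    · exact hwT T hT hv
    · have h4 : v ≠ y T := fun e => h3 ⟨T, hT, Or.inl e⟩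
      have h5 : v ≠ z T := fun e => h3 ⟨T, hT, Or.inr e⟩
      refine h2 ((hU v).2 ⟨mem_evenNbrs.2 ⟨(h𝓜 T hT).2.2.2.2.2 v hv h4 h5, h1⟩, ?_⟩)
      exact fun T' hT' e => h3 ⟨T', hT', Or.inr e⟩
  have hwN : ∀ v, G.Adj w v → ¬ IsEven H v ∨ ¬ IsEven G v := by
    intro v hv
    by_contra hcon
    push Not at hcon
    rcases (hev v).1 hcon.1 with ⟨rfl, _⟩ | ⟨h1, h2, h3⟩
    · exact G.irrefl hv
    · exact h2 ((hU v).2 ⟨mem_evenNbrs.2 ⟨hv, h1⟩, fun T hT e => h3 ⟨T, hT, Or.inr e⟩⟩)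
  have hadm : IsAdmissible H := by
    refine hG.of_le hHG (fun u hu => hsp.card_le hu) ?_ ?_
    · intro u hu hu'
      obtain ⟨rfl, _⟩ := ((hev u).1 hu).resolve_right fun h => hu' h.1
      rw [Finset.eq_empty_iff_forall_notMem]
      intro v hv
      obtain ⟨h1, h2⟩ := mem_evenNbrs.1 hv
      rcases hwN v (hHG h1) with h | h
      · exact h h2
      · rcases (hev v).1 h2 with h3 | h3
        · exact H.irrefl (h3.1 ▸ h1)
        · exact h h3.1
    · intro T hT hTH a ha ⟨u, hu, hau⟩
      have haw : a ≠ w := by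
        rintro rfl
        rcases hwN u hau with h | h
        exacts [h (hTH u hu), h (hT.2 u hu).1]
      refine ⟨fun h => ?_, fun b hab => ?_⟩
      · rcases (hev a).1 h with h | h
        exacts [haw h.1, ha h.1]
      · rw [hH, sdiff_adj, sup_adj, starAt_adj, hmate 𝓜 subset_rfl]
        refine ⟨hab, ?_⟩
        rintro (⟨_, h | h⟩ | ⟨T', hT', h⟩)
        · exact haw h.1
        · exact ha (hUe a h.2).2
        · exact ha (hTe T' hT' a (hmem T' hT' a (h.imp And.left And.left)))
  obtain ⟨u₀, hu₀⟩ := hne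
  have hreal := (ih H (size_sdiff_lt hle (a := w) (b := u₀)
    (Or.inl ⟨fun e => hwU (e ▸ hu₀), Or.inl ⟨rfl, hu₀⟩⟩)) hadm).odd
  -- Restoring the edge `y T z T` moves the end of `y T` to `z T`. The loss is harmless for `w`,
  -- which is not adjacent to `y T`, and `z T` can then safely neighbour other vertices.
  set mS : Finset (Finset V) → V → ℕ := fun S v => if ∃ T ∈ S, v = y T then 0 else
    if ∃ T ∈ S, v = z T then 2 else oddInd H v with hmS
  have hM : ∀ S ⊆ 𝓜, Realizable (Fintype.card V) (H ⊔ mateGraph S y z) (mS S) := by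
    intro S
    induction S using Finset.induction_on with
    | empty =>
      intro _
      simpa [mateGraph, hmS] using hreal
    | insert T S hTS ihS =>
      intro hS
      have hS' : S ⊆ 𝓜 := (Finset.subset_insert _ _).trans hS
      have hT : T ∈ 𝓜 := hS (Finset.mem_insert_self _ _)
      obtain ⟨hTri, hyT, hzT, hyz, hwy, hx⟩ := h𝓜 T hT
      have hnot : ∀ v ∈ T, ¬ ∃ T' ∈ S, v = y T' ∨ v = z T' := by
        rintro v hv ⟨T', hT', h⟩
        exact hTS (huniq T' (hS' hT') T hT v (hmem T' (hS' hT') v h) hv ▸ hT')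
      have hmT : ∀ v ∈ T, mS S v = 1 := by
        intro v hv
        have h1 : ¬ ∃ T' ∈ S, v = y T' := fun ⟨T', h, h'⟩ => hnot v hv ⟨T', h, Or.inl h'⟩
        have h2 : ¬ ∃ T' ∈ S, v = z T' := fun ⟨T', h, h'⟩ => hnot v hv ⟨T', h, Or.inr h'⟩
        simp only [hmS, if_neg h1, if_neg h2]
        exact oddInd_eq_one (hTodd T hT v hv)
      have hnadj : ¬ (H ⊔ mateGraph S y z).Adj (z T) (y T) := by
        rw [sup_adj, hH, sdiff_adj, sup_adj, hmate 𝓜 subset_rfl, hmate S hS']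
        rintro (⟨_, h⟩ | ⟨T', hT', h⟩)
        · exact h (Or.inr ⟨T, hT, Or.inr ⟨rfl, rfl⟩⟩)
        · exact hnot (z T) hzT ⟨T', hT', h.imp And.left And.left⟩
      -- All of `T` is odd in `H`, so the only neighbour of `z T` that might lack an end is `w`,
      -- when #U is odd; `hz` rules that out.
      have hmove := (ihS hS').move (z T) (y T) hyz.symm hnadj
        (H' := H ⊔ mateGraph (insert T S) y z) (by
          rw [hmT _ hyT, Nat.lt_one_iff, Finset.card_eq_zero, Finset.eq_empty_iff_forall_notMem]
          intro v hv
          obtain ⟨h1, h2⟩ := mem_zeroNbrs.1 hv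
          have h3 : G.Adj (z T) v := by
            rcases h1 with h1 | h1
            · exact hHG h1
            · obtain ⟨T', hT', h⟩ := (hmate S hS' _ _).1 h1
              exact (hnot (z T) hzT ⟨T', hT', h.imp And.left And.left⟩).elim
          by_cases h4 : IsEven G v
          · rw [hmT v (hTri.mem_of_adj hzT h3 h4)] at h2
            omega
          · have h5 : ¬ ∃ T' ∈ S, v = y T' := by
              rintro ⟨T', hT', rfl⟩
              exact h4 (hTe T' (hS' hT') _ (h𝓜 T' (hS' hT')).2.1)
            simp only [hmS, if_neg h5] at h2
            split_ifs at h2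
            rcases (hev v).1 (oddInd_eq_zero.1 h2) with ⟨rfl, h6⟩ | h6
            · rcases hz with h7 | h7
              · exact (Nat.not_even_iff_odd.2 h6) h7
              · exact h7 T hT h3.symm
            · exact h4 h6.1) (by
          rw [mateGraph, Finset.sup_insert, sup_comm (edge (y T) (z T)), ← sup_assoc,
            edge_comm (y T)]
          rfl)
      refine hmove.mono fun v => ?_
      by_cases h1 : v = z T
      · subst h1
        have h2 : ¬ ∃ T' ∈ insert T S, z T = y T' := by
          rintro ⟨T', hT', h⟩
          rcases Finset.mem_insert.1 hT' with rfl | hT'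
          · exact hyz h.symm
          · exact hnot _ hzT ⟨T', hT', Or.inl h⟩
        simp only [shift, if_true, hmT _ hzT]
        simp only [hmS, if_neg h2]
        rw [if_pos ⟨T, Finset.mem_insert_self _ _, rfl⟩]
      · by_cases h2 : v = y T
        · subst h2
          simp only [hmS]
          rw [if_pos ⟨T, Finset.mem_insert_self _ _, rfl⟩]
          exact Nat.zero_le _
        · simp [shift, h1, h2, hmS, Finset.mem_insert]
  have hM' := hM 𝓜 subset_rfl
  set H₁ := H ⊔ mateGraph 𝓜 y z with hH₁
  have hH₁G : H₁ ≤ G := sup_le hHG hMle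
  have hwH₁ : ∀ u ∈ U, ¬ H₁.Adj w u := by
    rintro u hu (h | h)
    · rw [hH, sdiff_adj, sup_adj, starAt_adj] at h
      exact h.2 (Or.inl ⟨h.1.ne, Or.inl ⟨rfl, hu⟩⟩)
    · exact hMw 𝓜 subset_rfl u h
  have hmz : ∀ v, (∃ T ∈ 𝓜, v = z T) → mS 𝓜 v = 2 := by
    rintro v ⟨T, hT, rfl⟩
    have h2 : ¬ ∃ T' ∈ 𝓜, z T = y T' := by
      rintro ⟨T', hT', h⟩
      have e := huniq T hT T' hT' (z T) (h𝓜 T hT).2.2.1 (h ▸ (h𝓜 T' hT').2.1)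
      subst e
      exact (h𝓜 T hT).2.2.2.1 h.symm
    simp only [hmS, if_neg h2]
    rw [if_pos ⟨T, hT, rfl⟩]
  have hmU : ∀ u ∈ U, 1 ≤ mS 𝓜 u := by
    intro u hu
    have h1 : ¬ ∃ T ∈ 𝓜, u = y T := fun ⟨T, hT, e⟩ => hUy u hu T hT e
    have h2 : ¬ ∃ T ∈ 𝓜, u = z T := fun ⟨T, hT, e⟩ => hUz u hu T hT e
    simp only [hmS, if_neg h1, if_neg h2]
    refine one_le_oddInd fun h => ?_
    rcases (hev u).1 h with h | h
    exacts [hwU (h.1 ▸ hu), h.2.1 hu]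
  have hconf : ∀ u ∈ U, ∀ v, H₁.Adj u v → mS 𝓜 v = 0 → IsEven G v := by
    intro u hu v hv h0
    by_cases h1 : ∃ T ∈ 𝓜, v = y T
    · obtain ⟨T, hT, rfl⟩ := h1
      exact hTe T hT _ (h𝓜 T hT).2.1
    · simp only [hmS, if_neg h1] at h0
      split_ifs at h0
      rcases (hev v).1 (oddInd_eq_zero.1 h0) with ⟨rfl, _⟩ | h
      · exact (hwH₁ u hu hv.symm).elim
      · exact h.1
  have hfin := hM'.star hwU hwH₁ hmU
    (fun v hv => by
      have h1 : ¬ ∃ T ∈ 𝓜, v = y T := by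
        rintro ⟨T, hT, rfl⟩
        exact (h𝓜 T hT).2.2.2.2.1 (hH₁G hv)
      by_cases h2 : ∃ T ∈ 𝓜, v = z T
      · rw [hmz v h2]; norm_num
      · simp only [hmS, if_neg h1, if_neg h2]
        refine one_le_oddInd fun h => ?_
        rcases (hev v).1 h with ⟨rfl, _⟩ | ⟨h3, h4, _⟩
        · exact H₁.irrefl hv
        · exact h4 ((hU v).2 ⟨mem_evenNbrs.2 ⟨hH₁G hv, h3⟩, fun T hT e => h2 ⟨T, hT, e⟩⟩))
    (fun u hu => by
      refine (Finset.card_le_card fun v hv => ?_).trans (hsp.card_le (hUe u hu).2)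
      obtain ⟨h1, h2⟩ := mem_conflicts.1 hv
      refine mem_evenNbrs.2 ⟨hH₁G h1, ?_⟩
      rcases h2 with h2 | h2
      exacts [hconf u hu v h1 h2, (hUe v h2).2])
    (by
      rcases Nat.even_or_odd #U with h | h
      · right
        have h1 : ¬ ∃ T ∈ 𝓜, w = y T := fun ⟨T, hT, e⟩ => hwT T hT (hmem T hT w (Or.inl e))
        have h2 : ¬ ∃ T ∈ 𝓜, w = z T := fun ⟨T, hT, e⟩ => hwT T hT (hmem T hT w (Or.inr e))
        simp only [hmS, if_neg h1, if_neg h2]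
        refine one_le_oddInd fun h' => ?_
        rcases (hev w).1 h' with ⟨_, h3⟩ | ⟨h3, _⟩
        exacts [(Nat.not_even_iff_odd.2 h3) h, hw h3]
      · exact Or.inl h)
    (fun A hA h1 h2 h3 => by
      left
      obtain ⟨r, hr, hor⟩ := hR A hA h1 h2 h3
      have hrU := (Finset.mem_sdiff.1 hr).1
      have hsub : conflicts H₁ (mS 𝓜) A r ⊆ evenNbrs G r := by
        intro v hv
        obtain ⟨h1, h2⟩ := mem_conflicts.1 hv
        refine mem_evenNbrs.2 ⟨hH₁G h1, ?_⟩
        rcases h2 with h2 | h2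
        exacts [hconf r hrU v h1 h2, (hUe v (hA h2)).2]
      refine ⟨r, hr, ?_⟩
      rcases hor with h4 | ⟨v, hv, hvA, hvor⟩
      · rw [h4, Finset.subset_empty] at hsub
        simp [hsub]
      -- The vertex `v` carries an end and gives none away, which leaves at most one conflict among
      -- the at most two even neighbours of `r`.
      · have h5 : conflicts H₁ (mS 𝓜) A r ⊆ (evenNbrs G r).erase v := by
          refine Finset.subset_erase.2 ⟨hsub, fun h => ?_⟩
          have h6 := (mem_conflicts.1 h).2.resolve_right hvA
          rcases hvor with h7 | h7
          · have := hmU v h7; omega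
          · have := hmz v h7; omega
        have h6 := Finset.card_le_card h5
        rw [Finset.card_erase_of_mem hv] at h6
        have := hsp.card_le (hUe r hrU).2
        omega)
  have hG' : H₁ ⊔ starAt w U = G := by
    rw [hH₁, sup_assoc, sup_comm (mateGraph 𝓜 y z), hH, sdiff_sup_cancel hle]
  rw [hG'] at hfin
  exact hfin.mono fun v => Nat.zero_le _

end StarReduction

/-! ### Choosing the triangles for the star reduction. -/

section NotStuck

open Finset SimpleGraph
open scoped Classical

variable {V : Type*}

/-- Disjoint subsets of `A` are packed, two elements for each `r`, or only one for `r` in the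
exceptional set `T`. -/
theorem two_mul_card_le {R A T : Finset V} (f : V → Finset V)
    (hdis : ∀ r ∈ R, ∀ r' ∈ R, r ≠ r' → Disjoint (f r) (f r')) (hfA : ∀ r ∈ R, f r ⊆ A)
    (hf : ∀ r ∈ R, 2 ≤ #(f r) + if r ∈ T then 1 else 0) : 2 * #R ≤ #A + #{r ∈ R | r ∈ T} := by
  have h1 : ∑ r ∈ R, #(f r) ≤ #A := by
    rw [← Finset.card_biUnion (fun r hr r' hr' h => hdis r hr r' hr' h)]
    exact Finset.card_le_card (Finset.biUnion_subset.2 hfA)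
  have h2 := Finset.sum_le_sum hf
  rw [Finset.sum_add_distrib, ← Finset.card_filter, Finset.sum_const, smul_eq_mul] at h2
  omega

variable [Fintype V]

/-- The even neighbours of `w` lie in one triangle of the E-subgraph, and there are at least two. -/
def IsStuck (G : SimpleGraph V) (w : V) : Prop :=
  ∃ T, IsEvenTriangle G T ∧ evenNbrs G w ⊆ T ∧ 2 ≤ #(evenNbrs G w)

/-- Reduction at a vertex of odd degree that has even neighbours and is not stuck. -/
theorem realizable_of_not_isStuck {G : SimpleGraph V} (hG : IsAdmissible G)
    (ih : ∀ H : SimpleGraph V, size H < size G → IsAdmissible H →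
      Realizable (Fintype.card V) H 0)
    (hsp : HasSmallParts G) {w : V} (hw : ¬ IsEven G w) (hne : (evenNbrs G w).Nonempty)
    (hstuck : ¬ IsStuck G w) : Realizable (Fintype.card V) G 0 := by
  -- The triangles that `w` meets only in part. In each, `y` is a vertex missed by `w`, and `z` is
  -- chosen so that the third vertex is adjacent to `w`.
  set 𝓣 : Finset (Finset V) := {T | IsEvenTriangle G T ∧ (∃ v ∈ T, G.Adj w v) ∧
    ∃ v ∈ T, ¬ G.Adj w v} with h𝓣
  have hchoice : ∀ T : Finset V, ∃ a : V × V, T ∈ 𝓣 → a.1 ∈ T ∧ a.2 ∈ T ∧ a.1 ≠ a.2 ∧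
      ¬ G.Adj w a.1 ∧ ∀ v ∈ T, v ≠ a.1 → v ≠ a.2 → G.Adj w v := by
    intro T
    by_cases hT : T ∈ 𝓣
    · obtain ⟨hTri, ⟨x, hx, hwx⟩, y, hy, hwy⟩ := (Finset.mem_filter.1 hT).2
      have hxy : x ≠ y := fun e => hwy (e ▸ hwx)
      obtain ⟨z, hz⟩ := Finset.card_eq_one.1 (show #((T.erase y).erase x) = 1 by
        rw [Finset.card_erase_of_mem (Finset.mem_erase.2 ⟨hxy, hx⟩), Finset.card_erase_of_mem hy,
          hTri.1])
      have hz' : z ∈ (T.erase y).erase x := by simp [hz]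
      simp only [Finset.mem_erase] at hz'
      refine ⟨(y, z), fun _ => ⟨hy, hz'.2.2, hz'.2.1.symm, hwy, fun v hv h1 h2 => ?_⟩⟩
      have : v ∉ (T.erase y).erase x := by rw [hz]; simpa using h2
      simp only [Finset.mem_erase, not_and] at this
      by_cases h3 : v = x
      · exact h3 ▸ hwx
      · exact (this h3 h1 hv).elim
    · exact ⟨(w, w), fun h => (hT h).elim⟩
  choose yz hyz using hchoice
  set y : Finset V → V := fun T => (yz T).1
  set z : Finset V → V := fun T => (yz T).2
  have hTri : ∀ T ∈ 𝓣, IsEvenTriangle G T := fun T hT => (Finset.mem_filter.1 hT).2.1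
  have huniq : ∀ T ∈ 𝓣, ∀ T', IsEvenTriangle G T' → ∀ v ∈ T, v ∈ T' → T = T' :=
    fun T hT T' hT' v hv hv' => (hTri T hT).eq_of_mem hT' hv hv'
  have h𝓜 : ∀ 𝓜 ⊆ 𝓣, ∀ T ∈ 𝓜, IsEvenTriangle G T ∧ y T ∈ T ∧ z T ∈ T ∧ y T ≠ z T ∧
      ¬ G.Adj w (y T) ∧ ∀ v ∈ T, v ≠ y T → v ≠ z T → G.Adj w v :=
    fun 𝓜 h T hT => ⟨hTri T (h hT), hyz T (h hT)⟩
  set U : Finset (Finset V) → Finset V := fun 𝓜 => {u ∈ evenNbrs G w | ∀ T ∈ 𝓜, u ≠ z T}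
  have hU : ∀ 𝓜 u, u ∈ U 𝓜 ↔ u ∈ evenNbrs G w ∧ ∀ T ∈ 𝓜, u ≠ z T := fun 𝓜 u => Finset.mem_filter
  -- a triangle of `𝓣` has a vertex that keeps its role as a neighbour of `w`
  have hx : ∀ T ∈ 𝓣, ∃ x ∈ T, x ≠ y T ∧ x ≠ z T ∧ G.Adj w x ∧ ∀ 𝓜 ⊆ 𝓣, x ∈ U 𝓜 := by
    intro T hT
    obtain ⟨h1, h2, h3, h4, h5⟩ := hyz T hT
    obtain ⟨x, hx⟩ : ((T.erase (y T)).erase (z T)).Nonempty := by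
      rw [← Finset.card_pos, Finset.card_erase_of_mem (Finset.mem_erase.2 ⟨h3.symm, h2⟩),
        Finset.card_erase_of_mem h1, (hTri T hT).1]
      norm_num
    simp only [Finset.mem_erase] at hx
    have hwx := h5 x hx.2.2 hx.2.1 hx.1
    refine ⟨x, hx.2.2, hx.2.1, hx.1, hwx, fun 𝓜 h => (hU 𝓜 x).2
      ⟨mem_evenNbrs.2 ⟨hwx, ((hTri T hT).2 x hx.2.2).1⟩, fun T' hT' e => hx.1 ?_⟩⟩
    have hxT' : x ∈ T' := e ▸ (hyz T' (h hT')).2.1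
    rw [huniq T hT T' (hTri T' (h hT')) x hx.2.2 hxT']
    exact e
  have hUne : ∀ 𝓜 ⊆ 𝓣, (U 𝓜).Nonempty := by
    intro 𝓜 h
    obtain ⟨v, hv⟩ := hne
    by_cases hv' : ∃ T ∈ 𝓜, v = z T
    · obtain ⟨T, hT, _⟩ := hv'
      obtain ⟨x, _, _, _, _, hx⟩ := hx T (h hT)
      exact ⟨x, hx 𝓜 h⟩
    · push Not at hv'
      exact ⟨v, (hU 𝓜 v).2 ⟨hv, hv'⟩⟩
  -- consequences of a blocked second stage
  have hblock : ∀ 𝓜 ⊆ 𝓣, ∀ A ⊆ U 𝓜, (∀ r ∈ U 𝓜 \ A, ¬ (evenNbrs G r = ∅ ∨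
      ∃ v ∈ evenNbrs G r, v ∉ A ∧ (v ∈ U 𝓜 ∨ ∃ T ∈ 𝓜, v = z T))) →
      (∀ r ∈ U 𝓜 \ A, ∃ T, IsEvenTriangle G T ∧ r ∈ T ∧ T ∉ 𝓜 ∧ evenNbrs G r = T.erase r ∧
        (T ∉ 𝓣 → evenNbrs G r ⊆ A)) ∧
      (∀ r ∈ U 𝓜 \ A, ∀ r' ∈ U 𝓜 \ A, r' ∉ evenNbrs G r) ∧
      ∀ r ∈ U 𝓜 \ A, ∀ r' ∈ U 𝓜 \ A, r ≠ r' →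
        Disjoint (evenNbrs G r ∩ A) (evenNbrs G r' ∩ A) := by
    intro 𝓜 h A hA hneg
    have hfirst : ∀ r ∈ U 𝓜 \ A, ∃ T, IsEvenTriangle G T ∧ r ∈ T ∧ T ∉ 𝓜 ∧
        evenNbrs G r = T.erase r ∧ (T ∉ 𝓣 → evenNbrs G r ⊆ A) := by
      intro r hr
      have hn := hneg r hr
      push Not at hn
      obtain ⟨hrU, hrA⟩ := Finset.mem_sdiff.1 hr
      obtain ⟨hr1, hr2⟩ := (hU 𝓜 r).1 hrU
      have hre := (mem_evenNbrs.1 hr1)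
      have hT := (hsp r hre.2).resolve_left hn.1.ne_empty
      set T := insert r (evenNbrs G r) with hTdef
      have hrT : r ∈ T := Finset.mem_insert_self _ _
      -- In a triangle of `𝓜` the vertex `z T` would be a neighbour of `r` with ends to spare, so
      -- `r` would not be blocked.
      have hTM : T ∉ 𝓜 := by
        intro hTM
        have hzT := (hyz T (h hTM)).2.1
        have hzr : z T ∈ evenNbrs G r := by
          rw [(hT.2 r hrT).2]
          exact Finset.mem_erase.2 ⟨(hr2 T hTM).symm, hzT⟩
        have hzA : z T ∉ A := fun hzA => ((hU 𝓜 _).1 (hA hzA)).2 T hTM rfl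
        exact (hn.2 _ hzr hzA).2 T hTM rfl
      refine ⟨T, hT, hrT, hTM, (hT.2 r hrT).2, fun hTT v hv => ?_⟩
      by_contra hvA
      have hvT : v ∈ T := Finset.mem_insert_of_mem hv
      have hwv : G.Adj w v := by
        by_contra hwv
        exact hTT (Finset.mem_filter.2 ⟨Finset.mem_univ _, hT, ⟨r, hrT, hre.1⟩, v, hvT, hwv⟩)
      refine (hn.2 v hv hvA).1 ((hU 𝓜 v).2 ⟨mem_evenNbrs.2 ⟨hwv, (hT.2 v hvT).1⟩, ?_⟩)
      exact (hn.2 v hv hvA).2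
    have hsecond : ∀ r ∈ U 𝓜 \ A, ∀ r' ∈ U 𝓜 \ A, r' ∉ evenNbrs G r := by
      intro r hr r' hr' hrr'
      have hn := hneg r hr
      push Not at hn
      exact (hn.2 r' hrr' (Finset.mem_sdiff.1 hr').2).1 (Finset.mem_sdiff.1 hr').1
    refine ⟨hfirst, hsecond, fun r hr r' hr' hne' => Finset.disjoint_left.2 fun a ha ha' => ?_⟩
    obtain ⟨T, hT, hrT, _, hTr, _⟩ := hfirst r hr
    obtain ⟨T', hT', hrT', _, hTr', _⟩ := hfirst r' hr'
    have haT : a ∈ T := Finset.mem_of_mem_erase (hTr ▸ (Finset.mem_inter.1 ha).1)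
    have haT' : a ∈ T' := Finset.mem_of_mem_erase (hTr' ▸ (Finset.mem_inter.1 ha').1)
    have e := hT.eq_of_mem hT' haT haT'
    refine hsecond r hr r' hr' ?_
    rw [hTr, e]
    exact Finset.mem_erase.2 ⟨hne'.symm, hrT'⟩
  by_cases hcase : Even #(U 𝓣) ∨ ∀ T ∈ 𝓣, ¬ G.Adj w (z T)
  · refine realizable_of_star hG ih hsp hw 𝓣 y z (h𝓜 𝓣 subset_rfl) (hU 𝓣) (hUne 𝓣 subset_rfl)
      hcase fun A hA h1 h2 h3 => ?_
    by_contra hcon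
    push Not at hcon
    obtain ⟨hb1, hb2, hb3⟩ := hblock 𝓣 subset_rfl A hA (fun r hr h => by
      obtain ⟨h4, h5⟩ := hcon r hr
      rcases h with h | ⟨v, hv1, hv2, hv3⟩
      · exact h4.ne_empty h
      · obtain ⟨h6, h7⟩ := h5 v hv1 hv2
        rcases hv3 with hv3 | ⟨T, hT, hv3⟩
        exacts [h6 hv3, h7 T hT hv3])
    -- Now 2 * #R ≤ #A ≤ #R + 1 for R = U \ A, so #R = 1 and #A = 2: `U` is a single triangle and
    -- `w` is stuck.
    have hcount := two_mul_card_le (T := ∅) (fun r => evenNbrs G r ∩ A) hb3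
      (fun r _ => Finset.inter_subset_right) (fun r hr => by
        obtain ⟨T, hT, hrT, hTM, hTr, hTA⟩ := hb1 r hr
        rw [Finset.inter_eq_left.2 (hTA hTM), hTr, Finset.card_erase_of_mem hrT, hT.1]
        omega)
    simp only [Finset.notMem_empty, Finset.filter_false, Finset.card_empty] at hcount
    have hR1 := Finset.card_pos.2 h3
    have hUA : #(U 𝓣 \ A) = #(U 𝓣) - #A := Finset.card_sdiff_of_subset hA
    have hU3 : #(U 𝓣) = 3 := by omega
    have hzn := hcase.resolve_left (by rw [hU3]; decide)
    obtain ⟨r, hr⟩ := h3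
    obtain ⟨T, hT, hrT, hTM, hTr, hTA⟩ := hb1 r hr
    have hTU : T ⊆ U 𝓣 := by
      intro v hv
      by_cases hvr : v = r
      · exact hvr ▸ (Finset.mem_sdiff.1 hr).1
      · exact hA (hTA hTM (hTr ▸ Finset.mem_erase.2 ⟨hvr, hv⟩))
    have hTeq : T = U 𝓣 := Finset.eq_of_subset_of_card_le hTU (by rw [hU3, hT.1])
    have hwU : evenNbrs G w = U 𝓣 := by
      refine Finset.Subset.antisymm (fun v hv => (hU 𝓣 v).2 ⟨hv, ?_⟩) (Finset.filter_subset _ _)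
      rintro T' hT' rfl
      exact hzn T' hT' (mem_evenNbrs.1 hv).1
    exact hstuck ⟨T, hT, by rw [hTeq, hwU], by rw [hwU, hU3]; norm_num⟩
  · push Not at hcase
    obtain ⟨hodd, T₀, hT₀, hwz⟩ := hcase
    rw [Nat.not_even_iff_odd] at hodd
    -- Leaving `T₀` out moves `z T₀` into the star and makes its size even, so `w` stays odd.
    have h𝓜' : 𝓣.erase T₀ ⊆ 𝓣 := Finset.erase_subset _ _
    obtain ⟨hy₀, hz₀, hyz₀, hwy₀, _⟩ := hyz T₀ hT₀
    have hz₀U : z T₀ ∈ U (𝓣.erase T₀) := by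
      refine (hU _ _).2 ⟨mem_evenNbrs.2 ⟨hwz, ((hTri T₀ hT₀).2 _ hz₀).1⟩, fun T hT e => ?_⟩
      rw [Finset.mem_erase] at hT
      exact hT.1 (huniq T hT.2 T₀ (hTri T₀ hT₀) (z T) (hyz T hT.2).2.1 (e ▸ hz₀))
    have hUins : U (𝓣.erase T₀) = insert (z T₀) (U 𝓣) := by
      ext u
      rw [Finset.mem_insert, hU 𝓣]
      constructor
      · intro hu
        by_cases huz : u = z T₀
        · exact Or.inl huz
        · obtain ⟨h1, h2⟩ := (hU _ _).1 hu
          refine Or.inr ⟨h1, fun T hT => ?_⟩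
          by_cases hTT : T = T₀
          · exact hTT ▸ huz
          · exact h2 T (Finset.mem_erase.2 ⟨hTT, hT⟩)
      · rintro (rfl | ⟨h1, h2⟩)
        · exact hz₀U
        · exact (hU _ _).2 ⟨h1, fun T hT => h2 T (h𝓜' hT)⟩
    have hUcard : #(U (𝓣.erase T₀)) = #(U 𝓣) + 1 := by
      rw [hUins, Finset.card_insert_of_notMem]
      exact fun h => ((hU _ _).1 h).2 T₀ hT₀ rfl
    have heven : Even #(U (𝓣.erase T₀)) := by rw [hUcard]; exact hodd.add_one
    refine realizable_of_star hG ih hsp hw _ y z (h𝓜 _ h𝓜') (hU _) (hUne _ h𝓜')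
      (Or.inl heven) fun A hA h1 h2 h3 => ?_
    by_contra hcon
    push Not at hcon
    obtain ⟨hb1, hb2, hb3⟩ := hblock _ h𝓜' A hA (fun r hr h => by
      obtain ⟨h4, h5⟩ := hcon r hr
      rcases h with h | ⟨v, hv1, hv2, hv3⟩
      · exact h4.ne_empty h
      · obtain ⟨h6, h7⟩ := h5 v hv1 hv2
        rcases hv3 with hv3 | ⟨T, hT, hv3⟩
        exacts [h6 hv3, h7 T hT hv3])
    obtain ⟨x, hxT, hxy, hxz, hwx, hxU⟩ := hx T₀ hT₀
    have hxU := hxU _ h𝓜'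
    have hcount := two_mul_card_le (T := T₀) (fun r => evenNbrs G r ∩ A) hb3
      (fun r _ => Finset.inter_subset_right) (fun r hr => by
        obtain ⟨T, hT, hrT, hTM, hTr, hTA⟩ := hb1 r hr
        by_cases hTT : T ∈ 𝓣
        · have hTT₀ : T = T₀ := by
            by_contra hne'
            exact hTM (Finset.mem_erase.2 ⟨hne', hTT⟩)
          subst hTT₀
          obtain ⟨o, ho, hor, hoU⟩ : ∃ o ∈ T, o ≠ r ∧ o ∈ U (𝓣.erase T) := by
            by_cases hrx : r = x
            · exact ⟨z T, hz₀, fun e => hxz (hrx ▸ e.symm), hz₀U⟩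
            · exact ⟨x, hxT, Ne.symm hrx, hxU⟩
          have hor' : o ∈ evenNbrs G r := hTr ▸ Finset.mem_erase.2 ⟨hor, ho⟩
          have hoA : o ∈ A := by
            by_contra hoA
            exact hb2 r hr o (Finset.mem_sdiff.2 ⟨hoU, hoA⟩) hor'
          have := Finset.card_pos.2 ⟨o, Finset.mem_inter.2 ⟨hor', hoA⟩⟩
          rw [if_pos hrT]; omega
        · rw [Finset.inter_eq_left.2 (hTA hTT), hTr, Finset.card_erase_of_mem hrT, hT.1]
          omega)
    have hone : #{r ∈ U (𝓣.erase T₀) \ A | r ∈ T₀} ≤ 1 := by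
      rw [Finset.card_le_one]
      intro a ha b hb
      rw [Finset.mem_filter] at ha hb
      by_contra hab
      refine hb2 a ha.1 b hb.1 ?_
      rw [((hTri T₀ hT₀).2 a ha.2).2]
      exact Finset.mem_erase.2 ⟨Ne.symm hab, hb.2⟩
    have hR1 := Finset.card_pos.2 h3
    have hUA : #(U (𝓣.erase T₀) \ A) = #(U (𝓣.erase T₀)) - #A := Finset.card_sdiff_of_subset hA
    have hAU := Finset.card_le_card hA
    obtain ⟨c, hc⟩ := heven
    -- From 2 * #R ≤ #A + 1, where R = U \ A and the extra 1 comes from `T₀`, and from the even size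
    -- of the star, #R = #A = 1.
    have hU2 : #(U (𝓣.erase T₀)) = 2 := by omega
    have hUeq : {x, z T₀} = U (𝓣.erase T₀) := by
      refine Finset.eq_of_subset_of_card_le ?_ (by rw [hU2, Finset.card_pair hxz])
      intro v hv
      rw [Finset.mem_insert, Finset.mem_singleton] at hv
      rcases hv with rfl | rfl
      exacts [hxU, hz₀U]
    have hUT : U (𝓣.erase T₀) ⊆ T₀ := by
      rw [← hUeq]
      intro v hv
      rw [Finset.mem_insert, Finset.mem_singleton] at hv
      rcases hv with rfl | rfl
      exacts [hxT, hz₀]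
    refine hstuck ⟨T₀, hTri T₀ hT₀, fun v hv => ?_, ?_⟩
    · by_cases hvU : v ∈ U (𝓣.erase T₀)
      · exact hUT hvU
      · have : ∃ T ∈ 𝓣.erase T₀, v = z T := by
          by_contra hcon'
          push Not at hcon'
          exact hvU ((hU _ _).2 ⟨hv, hcon'⟩)
        obtain ⟨T, hT, _⟩ := this
        rw [Finset.mem_erase] at hT
        -- Another partially met triangle would contribute a vertex of its own to the star, which
        -- lies inside `T₀`.
        obtain ⟨x', hx'T, _, _, _, hx'U⟩ := hx T hT.2
        exact (hT.1 (huniq T hT.2 T₀ (hTri T₀ hT₀) x' hx'T (hUT (hx'U _ h𝓜')))).elim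
    · rw [← hU2]
      exact Finset.card_le_card (Finset.filter_subset _ _)

end NotStuck

/-! ### Passing a path end from one triangle to another. -/

section Stuck

open Finset SimpleGraph
open scoped Classical

variable {V : Type*} [Fintype V]

/-- A triangle `T` can pass one path end on to a vertex `w` that carries a path end already. -/
theorem IsEvenTriangle.exists_give {G : SimpleGraph V} {T : Finset V} (hT : IsEvenTriangle G T)
    {w : V} (hwT : w ∉ T) (h2 : ∃ x ∈ T, ∃ z ∈ T, x ≠ z ∧ G.Adj w x ∧ G.Adj w z) :
    ∃ J ≤ G, (∀ a b, J.Adj a b → a ∈ insert w T) ∧ (∀ u ∈ insert w T, Odd #(nbrs J u)) ∧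
      ∀ (N : ℕ) (H : SimpleGraph V) (m : V → ℕ), H ≤ G → (∀ a b, J.Adj a b → ¬ H.Adj a b) →
        (∀ u ∈ insert w T, 1 ≤ m u) → (∀ u ∈ insert w T, ∀ a, H.Adj u a → 1 ≤ m a) →
        Realizable N H m →
        Realizable N (H ⊔ J) (fun a => if a = w then m a + 1 else if a ∈ T then 0 else m a) := by
  obtain ⟨x, hx, z, hz, hxz, hwx, hwz⟩ := h2
  by_cases htriple : ∀ u ∈ T, G.Adj w u
  · refine ⟨starAt w T, starAt_le htriple, ?_, ?_, ?_⟩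
    · rintro a b ⟨_, ⟨rfl, _⟩ | ⟨_, h⟩⟩
      exacts [Finset.mem_insert_self _ _, Finset.mem_insert_of_mem h]
    · intro u hu
      rw [nbrs_starAt hwT]
      rcases Finset.mem_insert.1 hu with rfl | hu
      · rw [if_pos rfl, hT.1]; decide
      · have hne : u ≠ w := fun e => hwT (e ▸ hu)
        rw [if_neg hne, if_pos hu]; simp
    · intro N H m hHG hJ hm hH h
      have hstar := h.star hwT (fun u hu => hJ w u ⟨fun e => hwT (e ▸ hu), Or.inl ⟨rfl, hu⟩⟩)
        (fun u hu => hm u (Finset.mem_insert_of_mem hu))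
        (hH w (Finset.mem_insert_self _ _))
        (fun u hu => by
          have h3 : conflicts H m T u ⊆ T.erase u := by
            intro a ha
            obtain ⟨h4, h5⟩ := mem_conflicts.1 ha
            have := hH u (Finset.mem_insert_of_mem hu) a h4
            exact Finset.mem_erase.2 ⟨h4.ne', h5.resolve_left (by omega)⟩
          have := Finset.card_le_card h3
          rwa [Finset.card_erase_of_mem hu, hT.1] at this)
        (Or.inl (by rw [hT.1]; decide))
        (fun A hA h3 h4 _ => Or.inr (by
          have h5 : #(T \ A) = #T - #A := Finset.card_sdiff_of_subset hA
          have h6 := hT.1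
          have h7 := hm w (Finset.mem_insert_self _ _)
          omega))
      rw [if_pos (by rw [hT.1]; decide)] at hstar
      refine hstar.mono fun a => ?_
      by_cases ha : a = w
      · subst ha; simp
      · simp [ha]
  · push Not at htriple
    obtain ⟨y, hy, hwy⟩ := htriple
    have hxy : x ≠ y := fun e => hwy (e ▸ hwx)
    have hzy : z ≠ y := fun e => hwy (e ▸ hwz)
    have hwx' := hwx.ne
    have hw : ∀ u ∈ T, u ≠ w := fun u hu e => hwT (e ▸ hu)
    have hTeq : ∀ u ∈ T, u = x ∨ u = y ∨ u = z := by
      have h3 : ({x, y, z} : Finset V) = T := by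
        refine Finset.eq_of_subset_of_card_le ?_ ?_
        · intro v hv
          simp only [Finset.mem_insert, Finset.mem_singleton] at hv
          rcases hv with rfl | rfl | rfl <;> assumption
        · rw [hT.1, Finset.card_eq_three.2 ⟨x, y, z, hxy, hxz, hzy.symm, rfl⟩]
      intro u hu
      rw [← h3] at hu
      simpa using hu
    -- A perfect matching of `w` and `T`. Restoring `zy` at `z` exhausts `y`, which `w` does not
    -- see; restoring `wx` at `w` then brings the end of `x` to `w`.
    refine ⟨edge w x ⊔ edge z y, sup_le (edge_le hwx) (edge_le (hT.adj hz hy hzy)), ?_, ?_, ?_⟩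
    · rintro a b h
      rw [sup_adj, edge_adj_iff hwx', edge_adj_iff hzy] at h
      rw [Finset.mem_insert]
      rcases h with (⟨rfl, _⟩ | ⟨rfl, _⟩) | (⟨rfl, _⟩ | ⟨rfl, _⟩)
      exacts [Or.inl rfl, Or.inr hx, Or.inr hz, Or.inr hy]
    · intro u hu
      rw [nbrs_sup, nbrs_edge hwx', nbrs_edge hzy]
      rcases Finset.mem_insert.1 hu with rfl | hu
      · simp [(hw z hz).symm, (hw y hy).symm]
      · rcases hTeq u hu with rfl | rfl | rfl
        · simp [hw _ hx, hxz, hxy]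
        · simp [hw _ hy, hxy.symm, hzy.symm]
        · simp [hw _ hz, hxz.symm]
    · intro N H m hHG hJ hm hH h
      have h3 := h.move z y hzy (hJ z y (Or.inr ((edge_adj_iff hzy).2 (Or.inl ⟨rfl, rfl⟩))))
        (H' := H ⊔ edge z y) (by
          have h4 : zeroNbrs H m z = ∅ := by
            rw [Finset.eq_empty_iff_forall_notMem]
            intro a ha
            obtain ⟨h5, h6⟩ := mem_zeroNbrs.1 ha
            have := hH z (Finset.mem_insert_of_mem hz) a h5
            omega
          rw [h4]; exact hm y (Finset.mem_insert_of_mem hy)) rfl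
      have h4 := h3.move w x hwx' (by
          rw [sup_adj, edge_adj_iff hzy]
          rintro (h5 | h5 | h5)
          · exact hJ w x (Or.inl ((edge_adj_iff hwx').2 (Or.inl ⟨rfl, rfl⟩))) h5
          · exact hw z hz h5.1.symm
          · exact hw y hy h5.1.symm)
        (H' := H ⊔ edge z y ⊔ edge w x) (by
          have h4 : zeroNbrs (H ⊔ edge z y) (shift m y z) w = ∅ := by
            rw [Finset.eq_empty_iff_forall_notMem]
            intro a ha
            obtain ⟨h5, h6⟩ := mem_zeroNbrs.1 ha
            have h7 : H.Adj w a := by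
              rw [sup_adj, edge_adj_iff hzy] at h5
              refine h5.resolve_right ?_
              rintro (h5 | h5)
              · exact hw z hz h5.1.symm
              · exact hw y hy h5.1.symm
            have h8 := hH w (Finset.mem_insert_self _ _) a h7
            unfold shift at h6
            split_ifs at h6 with e1 e2
            · exact hwy (e2 ▸ hHG h7)
            · omega
          have h5 := hm x (Finset.mem_insert_of_mem hx)
          rw [h4]
          simp only [shift, if_neg hxz, if_neg hxy, Finset.card_empty]
          omega) rfl
      rw [sup_assoc, sup_comm (edge z y)] at h4
      refine h4.mono fun a => ?_
      by_cases ha : a = w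
      · subst ha
        simp [shift, (hw z hz).symm, (hw y hy).symm]
      · by_cases haT : a ∈ T
        · simp [ha, haT]
        · have h5 : a ≠ x := fun e => haT (e ▸ hx)
          have h6 : a ≠ y := fun e => haT (e ▸ hy)
          have h7 : a ≠ z := fun e => haT (e ▸ hz)
          simp [shift, ha, haT, h5, h6, h7]

/-- A triangle `T` can absorb one path end from a neighbour `v` that carries two of them. -/
theorem IsEvenTriangle.exists_take {G : SimpleGraph V} {T : Finset V} (hT : IsEvenTriangle G T)
    {v : V} (hvT : v ∉ T) {x : V} (hx : x ∈ T) (hvx : G.Adj v x) :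
    ∃ J ≤ G, (∀ a b, J.Adj a b → a ∈ insert v T) ∧ (∀ u ∈ insert v T, Odd #(nbrs J u)) ∧
      ∀ (N : ℕ) (H : SimpleGraph V) (m : V → ℕ), (∀ a b, J.Adj a b → ¬ H.Adj a b) →
        (∀ u ∈ T, 1 ≤ m u) → 2 ≤ m v → (∀ u ∈ T, ∀ a, H.Adj u a → 1 ≤ m a) →
        Realizable N H m → Realizable N (H ⊔ J) 0 := by
  obtain ⟨y, z, hyz, hyzT⟩ := Finset.card_eq_two.1 (show #(T.erase x) = 2 by
    rw [Finset.card_erase_of_mem hx, hT.1])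
  have hy : y ∈ T.erase x := by simp [hyzT]
  have hz : z ∈ T.erase x := by simp [hyzT]
  have hTeq : ∀ u ∈ T, u = x ∨ u = y ∨ u = z := by
    intro u hu
    by_cases hux : u = x
    · exact Or.inl hux
    · have : u ∈ T.erase x := Finset.mem_erase.2 ⟨hux, hu⟩
      rw [hyzT] at this
      exact Or.inr (by simpa using this)
  rw [Finset.mem_erase] at hy hz
  have hv : ∀ u ∈ T, u ≠ v := fun u hu e => hvT (e ▸ hu)
  have hxv := hv x hx
  -- The vertex `v` pays for `xv` and keeps one end, so `y` still sees no endless neighbour when `z`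
  -- pays for `yz`.
  refine ⟨edge x v ⊔ edge y z, sup_le (edge_le hvx.symm) (edge_le (hT.adj hy.2 hz.2 hyz)), ?_, ?_, ?_⟩
  · rintro a b h
    rw [sup_adj, edge_adj_iff hxv, edge_adj_iff hyz] at h
    rw [Finset.mem_insert]
    rcases h with (⟨rfl, _⟩ | ⟨rfl, _⟩) | (⟨rfl, _⟩ | ⟨rfl, _⟩)
    exacts [Or.inr hx, Or.inl rfl, Or.inr hy.2, Or.inr hz.2]
  · intro u hu
    rw [nbrs_sup, nbrs_edge hxv, nbrs_edge hyz]
    rcases Finset.mem_insert.1 hu with rfl | hu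
    · simp [(hv x hx).symm, (hv y hy.2).symm, (hv z hz.2).symm]
    · rcases hTeq u hu with rfl | rfl | rfl
      · simp [hy.1.symm, hz.1.symm]
      · simp [hv _ hy.2, hy.1]
      · simp [hv _ hz.2, hz.1, hyz.symm]
  · intro N H m hJ hm hm2 hH h
    have h3 := h.move x v hxv (hJ x v (Or.inl ((edge_adj_iff hxv).2 (Or.inl ⟨rfl, rfl⟩))))
      (H' := H ⊔ edge x v) (by
        have h4 : zeroNbrs H m x = ∅ := by
          rw [Finset.eq_empty_iff_forall_notMem]
          intro a ha
          obtain ⟨h5, h6⟩ := mem_zeroNbrs.1 ha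
          have := hH x hx a h5
          omega
        rw [h4, Finset.card_empty]; omega) rfl
    have hyadj : ∀ a, (H ⊔ edge x v).Adj y a → H.Adj y a := by
      intro a h5
      rw [sup_adj, edge_adj_iff hxv] at h5
      refine h5.resolve_right ?_
      rintro (h5 | h5)
      exacts [hy.1 h5.1, hv y hy.2 h5.1]
    have h4 := h3.move y z hyz (fun h5 => hJ y z
        (Or.inr ((edge_adj_iff hyz).2 (Or.inl ⟨rfl, rfl⟩))) (hyadj z h5))
      (H' := H ⊔ edge x v ⊔ edge y z) (by
        have h4 : zeroNbrs (H ⊔ edge x v) (shift m v x) y = ∅ := by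
          rw [Finset.eq_empty_iff_forall_notMem]
          intro a ha
          obtain ⟨h5, h6⟩ := mem_zeroNbrs.1 ha
          have h8 := hH y hy.2 a (hyadj a h5)
          unfold shift at h6
          split_ifs at h6 with e1 e2
          · subst e2; omega
          · omega
        have h5 := hm z hz.2
        rw [h4]
        simp only [shift, if_neg hz.1, if_neg (hv z hz.2), Finset.card_empty]
        omega) rfl
    rw [sup_assoc] at h4
    exact h4.mono fun a => Nat.zero_le _

/-- Reduction at an edge `wv`, where `w` is stuck at `T` and `v` is not adjacent to `T`. -/
theorem realizable_of_isStuck {G : SimpleGraph V} (hG : IsAdmissible G)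
    (ih : ∀ H : SimpleGraph V, size H < size G → IsAdmissible H →
      Realizable (Fintype.card V) H 0)
    (hsp : HasSmallParts G) {w v : V} (hw : ¬ IsEven G w) {T : Finset V}
    (hT : IsEvenTriangle G T) (hwT : evenNbrs G w ⊆ T) (hw2 : 2 ≤ #(evenNbrs G w))
    (hwv : G.Adj w v) (hvT : ∀ u ∈ T, ¬ G.Adj v u) (hv : ¬ IsEven G v)
    (hv' : evenNbrs G v = ∅ ∨ IsStuck G v) : Realizable (Fintype.card V) G 0 := by
  have hwT' : w ∉ T := fun h => hw (hT.2 w h).1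
  have hvT' : v ∉ T := fun h => hv (hT.2 v h).1
  have hwv' := hwv.ne
  obtain ⟨J₁, hJ₁G, hJ₁s, hJ₁o, hgive⟩ := hT.exists_give hwT' (by
    obtain ⟨x, hx, z, hz, hxz⟩ := Finset.one_lt_card.1 hw2
    exact ⟨x, hwT hx, z, hwT hz, hxz, (mem_evenNbrs.1 hx).1, (mem_evenNbrs.1 hz).1⟩)
  -- Both cases are treated together: if `v` has no even neighbours, `T'` and `J₂` are empty and
  -- nothing is absorbed.
  obtain ⟨T', J₂, hJ₂G, hT', hvT'', hJ₂s, hJ₂o, hJ₂v, htake⟩ : ∃ (T' : Finset V),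
      ∃ J ≤ G, (T' = ∅ ∨ IsEvenTriangle G T' ∧ ∃ u ∈ T', G.Adj v u) ∧ evenNbrs G v ⊆ T' ∧
      (∀ a b, J.Adj a b → a ∈ insert v T') ∧ (∀ u ∈ T', Odd #(nbrs J u)) ∧
      (T'.Nonempty → Odd #(nbrs J v)) ∧
      ∀ (N : ℕ) (H : SimpleGraph V) (m : V → ℕ), (∀ a b, J.Adj a b → ¬ H.Adj a b) →
        (∀ u ∈ T', 1 ≤ m u) → (T'.Nonempty → 2 ≤ m v) → (∀ u ∈ T', ∀ a, H.Adj u a → 1 ≤ m a) →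
        Realizable N H m → Realizable N (H ⊔ J) 0 := by
    rcases hv' with h | ⟨T', hT', h1, h2⟩
    · refine ⟨∅, ⊥, bot_le, Or.inl rfl, by rw [h], by simp, by simp, by simp, ?_⟩
      intro N H m _ _ _ _ h
      rw [sup_bot_eq]
      exact h.mono fun a => Nat.zero_le _
    · obtain ⟨u, hu⟩ := Finset.card_pos.1 (by omega : 0 < #(evenNbrs G v))
      have hvu := (mem_evenNbrs.1 hu).1
      obtain ⟨J, hJG, hJs, hJo, hJt⟩ := hT'.exists_take (fun h => hv (hT'.2 v h).1) (h1 hu) hvu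
      exact ⟨T', J, hJG, Or.inr ⟨hT', u, h1 hu, hvu⟩, h1, hJs,
        fun u hu => hJo u (Finset.mem_insert_of_mem hu),
        fun _ => hJo v (Finset.mem_insert_self _ _),
        fun N H m h3 h4 h5 h6 => hJt N H m h3 h4 (h5 ⟨u, h1 hu⟩) h6⟩
  have hT'e : ∀ u ∈ T', IsEven G u := by
    intro u hu
    rcases hT' with rfl | h
    · simp at hu
    · exact (h.1.2 u hu).1
  have hT'mem : ∀ u ∈ T', ∀ a, G.Adj u a → IsEven G a → a ∈ T' := by
    intro u hu a hua ha
    rcases hT' with rfl | h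
    · simp at hu
    · exact h.1.mem_of_adj hu hua ha
  have hTT' : ∀ u ∈ T, u ∉ T' := by
    intro u hu hu'
    rcases hT' with rfl | ⟨h1, a, ha, hva⟩
    · simp at hu'
    · exact hvT a (hT.eq_of_mem h1 hu hu' ▸ ha) hva
  have hwT'' : w ∉ T' := fun h => hw (hT'e w h)
  have hvT3 : v ∉ T' := fun h => hv (hT'e v h)
  -- Deleting `J` makes `T` and `T'` odd and keeps `w` odd; `v` stays odd if `T'` is nonempty, and
  -- is the only vertex that can turn even.
  set J := J₁ ⊔ edge v w ⊔ J₂ with hJ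
  have hle : J ≤ G := sup_le (sup_le hJ₁G (edge_le hwv.symm)) hJ₂G
  set H := G \ J with hH
  have hHG : H ≤ G := sdiff_le
  have hn₁ : ∀ a, a ∉ insert w T → nbrs J₁ a = ∅ := by
    intro a ha
    rw [Finset.eq_empty_iff_forall_notMem]
    exact fun b hb => ha (hJ₁s a b (mem_nbrs.1 hb))
  have hn₂ : ∀ a, a ∉ insert v T' → nbrs J₂ a = ∅ := by
    intro a ha
    rw [Finset.eq_empty_iff_forall_notMem]
    exact fun b hb => ha (hJ₂s a b (mem_nbrs.1 hb))
  have hdeg : ∀ a, nbrs J a = nbrs J₁ a ∪ (if a = v then {w} else if a = w then {v} else ∅) ∪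
      nbrs J₂ a := fun a => by rw [hJ, nbrs_sup, nbrs_sup, nbrs_edge hwv'.symm]
  have hTodd : ∀ u ∈ T, ¬ IsEven H u := by
    intro u hu
    have h1 : u ≠ v := fun e => hvT' (e ▸ hu)
    have h2 : u ≠ w := fun e => hwT' (e ▸ hu)
    rw [hH, isEven_sdiff hle, hdeg, if_neg h1, if_neg h2, hn₂ u (by simp [h1, hTT' u hu]),
      Finset.union_empty, Finset.union_empty]
    have := Nat.not_even_iff_odd.2 (hJ₁o u (Finset.mem_insert_of_mem hu))
    have h3 := (hT.2 u hu).1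
    tauto
  have hT'odd : ∀ u ∈ T', ¬ IsEven H u := by
    intro u hu
    have h1 : u ≠ v := fun e => hvT3 (e ▸ hu)
    have h2 : u ≠ w := fun e => hwT'' (e ▸ hu)
    rw [hH, isEven_sdiff hle, hdeg, if_neg h1, if_neg h2,
      hn₁ u (by simp only [Finset.mem_insert, h2, false_or]; exact fun h => hTT' u h hu),
      Finset.union_empty, Finset.empty_union]
    have := Nat.not_even_iff_odd.2 (hJ₂o u hu)
    have h3 := hT'e u hu
    tauto
  have hwodd : ¬ IsEven H w := by
    have h1 : v ∉ nbrs J₁ w := by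
      rw [mem_nbrs]
      intro h
      have := hJ₁s v w h.symm
      rw [Finset.mem_insert] at this
      exact this.elim hwv'.symm hvT'
    rw [hH, isEven_sdiff hle, hdeg, if_neg hwv', if_pos rfl,
      hn₂ w (by simp [hwv', hwT'']), Finset.union_empty,
      Finset.card_union_of_disjoint (Finset.disjoint_singleton_right.2 h1), Finset.card_singleton]
    have := (hJ₁o w (Finset.mem_insert_self _ _)).add_one
    tauto
  have hvodd : T'.Nonempty → ¬ IsEven H v := by
    intro hne
    have h1 : w ∉ nbrs J₂ v := by
      rw [mem_nbrs]
      intro h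
      have := hJ₂s w v h.symm
      rw [Finset.mem_insert] at this
      exact this.elim hwv' hwT''
    rw [hH, isEven_sdiff hle, hdeg, if_pos rfl,
      hn₁ v (by simp [hwv'.symm, hvT']), Finset.empty_union,
      Finset.card_union_of_disjoint (Finset.disjoint_singleton_left.2 h1), Finset.card_singleton,
      add_comm]
    have := (hJ₂v hne).add_one
    tauto
  have hev : ∀ a, IsEven H a → a = v ∨ (IsEven G a ∧ a ∉ T ∧ a ∉ T') := by
    intro a ha
    by_cases h1 : a = v
    · exact Or.inl h1
    have h2 : a ≠ w := fun e => hwodd (e ▸ ha)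
    have h3 : a ∉ T := fun h => hTodd a h ha
    have h4 : a ∉ T' := fun h => hT'odd a h ha
    refine Or.inr ⟨?_, h3, h4⟩
    rw [hH, isEven_sdiff hle, hdeg, if_neg h1, if_neg h2, hn₁ a (by simp [h2, h3]),
      hn₂ a (by simp [h1, h4])] at ha
    simpa using ha
  have hwN : ∀ a, G.Adj w a → IsEven G a → ¬ IsEven H a := fun a h1 h2 =>
    hTodd a (hwT (mem_evenNbrs.2 ⟨h1, h2⟩))
  have hvN : ∀ a, G.Adj v a → IsEven G a → ¬ IsEven H a := fun a h1 h2 =>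
    hT'odd a (hvT'' (mem_evenNbrs.2 ⟨h1, h2⟩))
  have hJmem : ∀ a b, J.Adj a b → a = w ∨ a ∈ T ∨ a = v ∨ a ∈ T' := by
    rintro a b ((h | h) | h)
    · exact (Finset.mem_insert.1 (hJ₁s a b h)).elim Or.inl fun h => Or.inr (Or.inl h)
    · rcases (edge_adj_iff hwv'.symm).1 h with ⟨h, _⟩ | ⟨h, _⟩
      exacts [Or.inr (Or.inr (Or.inl h)), Or.inl h]
    · exact (Finset.mem_insert.1 (hJ₂s a b h)).elim (fun h => Or.inr (Or.inr (Or.inl h)))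
        fun h => Or.inr (Or.inr (Or.inr h))
  have hadm : IsAdmissible H := by
    refine hG.of_le hHG (fun u hu => hsp.card_le hu) ?_ ?_
    · intro u hu hu'
      obtain rfl := (hev u hu).resolve_right fun h => hu' h.1
      rw [Finset.eq_empty_iff_forall_notMem]
      intro a ha
      obtain ⟨h1, h2⟩ := mem_evenNbrs.1 ha
      rcases hev a h2 with rfl | h3
      · exact H.irrefl h1
      · exact hvN a (hHG h1) h3.1 h2
    · intro T₂ hT₂ hT₂H a ha ⟨u, hu, hau⟩
      have haw : a ≠ w := by
        rintro rfl
        exact hwN u hau (hT₂.2 u hu).1 (hT₂H u hu)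
      have hav : a ≠ v := by
        rintro rfl
        exact hvN u hau (hT₂.2 u hu).1 (hT₂H u hu)
      refine ⟨fun h => ?_, fun b hab => ?_⟩
      · rcases hev a h with h | h
        exacts [hav h, ha h.1]
      · rw [hH, sdiff_adj]
        refine ⟨hab, fun h => ?_⟩
        rcases hJmem a b h with h | h | h | h
        exacts [haw h, ha (hT.2 a h).1, hav h, ha (hT'e a h)]
  have hreal := (ih H (size_sdiff_lt hle (a := v) (b := w)
    (Or.inl (Or.inr ((edge_adj_iff hwv'.symm).2 (Or.inl ⟨rfl, rfl⟩))))) hadm).odd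
  have hHnot : ∀ a b, J.Adj a b → ¬ H.Adj a b := fun a b h h' => by
    rw [hH, sdiff_adj] at h'
    exact h'.2 h
  have hJvw : J.Adj v w := Or.inl (Or.inr ((edge_adj_iff hwv'.symm).2 (Or.inl ⟨rfl, rfl⟩)))
  have h1 := hgive _ H (oddInd H) hHG (fun a b h => hHnot a b (Or.inl (Or.inl h)))
    (fun u hu => one_le_oddInd (by
      rcases Finset.mem_insert.1 hu with rfl | hu
      exacts [hwodd, hTodd u hu]))
    (fun u hu a hua => one_le_oddInd fun ha => by
      rcases hev a ha with rfl | ⟨h1, h2, h3⟩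
      · rcases Finset.mem_insert.1 hu with rfl | hu
        · exact hHnot _ _ hJvw hua.symm
        · exact hvT u hu (hHG hua.symm)
      · rcases Finset.mem_insert.1 hu with rfl | hu
        · exact hwN a (hHG hua) h1 ha
        · exact h2 (hT.mem_of_adj hu (hHG hua) h1)) hreal
  set m₁ : V → ℕ := fun a => if a = w then oddInd H a + 1 else if a ∈ T then 0 else oddInd H a
    with hm₁
  have hm₁w : m₁ w = 2 := by simp [hm₁, oddInd_eq_one hwodd]
  have hJ₁v : ∀ a, ¬ J₁.Adj v a := by
    intro a h
    have := hJ₁s v a h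
    rw [Finset.mem_insert] at this
    exact this.elim hwv'.symm hvT'
  -- One of the two ends at `w` pays for `vw` and reaches `v`. The vertices of `T` have spent their
  -- ends by now, which is why `v` must not be adjacent to `T`.
  have h2 := h1.move v w hwv'.symm (fun h => h.elim (hHnot v w hJvw) (hJ₁v w))
    (H' := H ⊔ J₁ ⊔ edge v w) (by
      have h4 : zeroNbrs (H ⊔ J₁) m₁ v = ∅ := by
        rw [Finset.eq_empty_iff_forall_notMem]
        intro a ha
        obtain ⟨h5, h6⟩ := mem_zeroNbrs.1 ha
        have h7 : H.Adj v a := h5.resolve_right (hJ₁v a)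
        simp only [hm₁] at h6
        split_ifs at h6 with e1 e2
        · exact hvT a e2 (hHG h7)
        · have h8 := oddInd_eq_zero.1 h6
          rcases hev a h8 with rfl | h9
          · exact H.irrefl h7
          · exact hvN a (hHG h7) h9.1 h8
      rw [h4, hm₁w]; norm_num) rfl
  have hT'H : ∀ u ∈ T', ∀ a, (H ⊔ J₁ ⊔ edge v w).Adj u a → H.Adj u a := by
    intro u hu a h
    rcases h with (h | h) | h
    · exact h
    · have := hJ₁s u a h
      rcases Finset.mem_insert.1 this with rfl | h3
      · exact (hwT'' hu).elim
      · exact (hTT' u h3 hu).elim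
    · rw [edge_adj_iff hwv'.symm] at h
      rcases h with ⟨rfl, _⟩ | ⟨rfl, _⟩
      exacts [(hvT3 hu).elim, (hwT'' hu).elim]
  have hm₂ : ∀ a, a ≠ v → a ≠ w → a ∉ T → shift m₁ w v a = oddInd H a := by
    intro a h3 h4 h5
    simp [shift, hm₁, h3, h4, h5]
  have h3 := htake _ _ _ (fun a b h h' => by
      rcases h' with (h' | h') | h'
      · exact hHnot a b (Or.inr h) h'
      · have h4 := hJ₁s a b h'
        have h5 := hJ₂s a b h
        rw [Finset.mem_insert] at h4 h5
        rcases h4 with rfl | h4 <;> rcases h5 with h5 | h5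
        exacts [hwv' h5, hwT'' h5, hvT' (h5 ▸ h4), hTT' a h4 h5]
      · rw [edge_adj_iff hwv'.symm] at h'
        have h5 : w ∈ insert v T' := by
          rcases h' with ⟨_, rfl⟩ | ⟨rfl, _⟩
          exacts [hJ₂s _ _ h.symm, hJ₂s _ _ h]
        rw [Finset.mem_insert] at h5
        exact h5.elim hwv' hwT'')
    (fun u hu => by
      rw [hm₂ u (fun e => hvT3 (e ▸ hu)) (fun e => hwT'' (e ▸ hu)) (fun h => hTT' u h hu)]
      exact one_le_oddInd (hT'odd u hu))
    (fun hne => by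
      have := oddInd_eq_one (hvodd hne)
      simp [shift, hm₁, hwv'.symm, hvT', this])
    (fun u hu a hua => by
      have h4 := hT'H u hu a hua
      by_cases hav : a = v
      · simp [shift, hav]
      by_cases haw : a = w
      · subst haw; simp [shift, hwv', hm₁w]
      by_cases haT : a ∈ T
      · exact (hTT' a haT (hT'mem u hu a (hHG h4) (hT.2 a haT).1)).elim
      rw [hm₂ a hav haw haT]
      refine one_le_oddInd fun h => ?_
      rcases hev a h with h5 | h5
      · exact hav h5
      · exact h5.2.2 (hT'mem u hu a (hHG h4) h5.1)) h2
  have hG' : H ⊔ J₁ ⊔ edge v w ⊔ J₂ = G := by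
    rw [sup_assoc H, sup_assoc H, ← hJ, hH, sdiff_sup_cancel hle]
  rwa [hG'] at h3

end Stuck

/-! ### Graphs whose even vertices are isolated. -/

section Detach

open Finset SimpleGraph
open scoped Classical

variable {V : Type*} [Fintype V]

theorem isAdmissible_of_evenNbrs_eq_empty {G : SimpleGraph V}
    (h : ∀ v, IsEven G v → evenNbrs G v = ∅) : IsAdmissible G := by
  refine ⟨fun v hv => by simp [h v hv], fun T hT => ?_⟩
  obtain ⟨u, hu⟩ := Finset.card_pos.1 (by rw [hT.1]; norm_num : 0 < #T)
  obtain ⟨h1, h2⟩ := hT.2 u hu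
  have h3 := congrArg Finset.card h2
  rw [h u h1, Finset.card_erase_of_mem hu, hT.1] at h3
  simp at h3

theorem isEven_sup {G J : SimpleGraph V} {v : V} (h : ∀ u, J.Adj v u → ¬ G.Adj v u) :
    IsEven (G ⊔ J) v ↔ (IsEven G v ↔ Even #(nbrs J v)) := by
  rw [IsEven, IsEven, nbrs_sup, Finset.card_union_of_disjoint, Nat.even_add]
  exact Finset.disjoint_left.2 fun u h1 h2 => h u (mem_nbrs.1 h2) (mem_nbrs.1 h1)

theorem size_edge {a b : V} (hab : a ≠ b) : size (edge a b) = 2 := by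
  have h : ∀ v, #(nbrs (edge a b) v) = (if v = a then 1 else 0) + (if v = b then 1 else 0) := by
    intro v
    rw [nbrs_edge hab]
    by_cases h1 : v = a
    · subst h1; simp [hab]
    · by_cases h2 : v = b <;> simp [h1, h2, hab.symm]
  simp [size, h, Finset.sum_add_distrib]

theorem size_sdiff_add {G J : SimpleGraph V} (h : J ≤ G) : size (G \ J) + size J = size G := by
  rw [size, size, size, ← Finset.sum_add_distrib]
  refine Finset.sum_congr rfl fun v _ => ?_
  rw [nbrs_sdiff, Finset.card_sdiff_add_card_eq_card (nbrs_mono h v)]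

theorem size_sup_le (G J : SimpleGraph V) : size (G ⊔ J) ≤ size G + size J := by
  rw [size, size, size, ← Finset.sum_add_distrib]
  refine Finset.sum_le_sum fun v _ => ?_
  rw [nbrs_sup]
  exact Finset.card_union_le _ _

/-- The decomposition into single edges. -/
theorem realizable_size (G : SimpleGraph V) : Realizable (size G) G 0 := by
  induction hk : size G using Nat.strong_induction_on generalizing G with
  | _ k ih =>
    by_cases h : ∃ a b, G.Adj a b
    · obtain ⟨a, b, hab⟩ := h
      have h1 := size_sdiff_add (edge_le hab)
      rw [size_edge hab.ne] at h1
      have h2 := (ih (size (G \ edge a b)) (by omega) _ rfl).new_path a b hab.ne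
        (by simp [sdiff_adj, edge_adj_iff hab.ne])
      rwa [sdiff_sup_cancel (edge_le hab), h1, hk] at h2
    · obtain rfl : G = ⊥ := by
        ext a b
        simpa using fun hab => h ⟨a, b, hab⟩
      exact realizable_bot k

/-- Reduction at a vertex `x` with two neighbours `y` and `z`, using an isolated vertex `q`. -/
theorem realizable_of_isolated {N : ℕ} {G : SimpleGraph V}
    (hiso : ∀ v, IsEven G v → ∀ u, ¬ G.Adj v u)
    (ih : ∀ H : SimpleGraph V, size H < size G → IsAdmissible H → Realizable N H 0)
    {x y z q : V} (hxy : G.Adj x y) (hxz : G.Adj x z) (hyz : y ≠ z) (hq : ∀ u, ¬ G.Adj q u) :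
    Realizable N G 0 := by
  have hqx : q ≠ x := fun e => hq y (e ▸ hxy)
  have hqy : q ≠ y := fun e => hq x (e ▸ hxy.symm)
  have hqz : q ≠ z := fun e => hq x (e ▸ hxz.symm)
  have hxy' := hxy.ne
  have hxz' := hxz.ne
  set J := edge x y ⊔ edge x z with hJ
  have hJG : J ≤ G := sup_le (edge_le hxy) (edge_le hxz)
  have hJnbrs : ∀ v, nbrs J v = if v = x then {y, z} else if v = y ∨ v = z then {x} else ∅ := by
    intro v
    rw [hJ, nbrs_sup, nbrs_edge hxy', nbrs_edge hxz']
    by_cases h1 : v = x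
    · simp [h1]
    · by_cases h2 : v = y <;> by_cases h3 : v = z <;> simp [h1, h2, h3, hxy'.symm, hxz'.symm, hyz, hyz.symm]
  -- One edge fewer, and `z` is the only even vertex of `H` that may have neighbours. Later `zx` is
  -- restored at `z` at the expense of `x`, and removing the pendant edge at `q` sends its end to
  -- `y`, which pays for `xy`.
  set H := (G \ J) ⊔ edge q y with hH
  have hqH : ∀ u, H.Adj q u ↔ u = y := by
    intro u
    rw [hH, sup_adj, sdiff_adj, edge_adj_iff hqy]
    simp [hq, hqy]
  have hHadj : ∀ a b, a ≠ q → b ≠ q → (H.Adj a b ↔ G.Adj a b ∧ ¬ J.Adj a b) := by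
    intro a b ha hb
    rw [hH, sup_adj, sdiff_adj, edge_adj_iff hqy]
    simp [ha, hb]
  have hsize : size H < size G := by
    have h1 := size_sup_le (G \ J) (edge q y)
    have h2 := size_sdiff_add hJG
    have h3 := size_sdiff_add (G := J) (J := edge x y) le_sup_left
    have h4 : 0 < size (J \ edge x y) := by
      refine (Finset.card_pos.2 (⟨z, ?_⟩ : (nbrs (J \ edge x y) x).Nonempty)).trans_le
        (Finset.single_le_sum (f := fun v => #(nbrs (J \ edge x y) v))
          (fun v _ => Nat.zero_le _) (Finset.mem_univ x))
      rw [mem_nbrs, sdiff_adj, hJ, sup_adj, edge_adj_iff hxy', edge_adj_iff hxz']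
      simp [hyz.symm, hxy', hxz']
    rw [size_edge hqy, ← hH] at h1
    rw [size_edge hxy'] at h3
    omega
  have hpar : ∀ v, IsEven H v ↔ v = z ∨ (IsEven G v ∧ v ≠ q) := by
    intro v
    have hodd : ∀ a b, G.Adj a b → ¬ IsEven G a := fun a b h h' => hiso a h' b h
    have hox := hodd x y hxy
    have hoy := hodd y x hxy.symm
    have hoz := hodd z x hxz.symm
    have heq : IsEven G q := by
      have : nbrs G q = ∅ := by ext u; simp [hq]
      rw [IsEven, this]; simp
    rw [hH, isEven_sup, isEven_sdiff hJG, hJnbrs, nbrs_edge hqy]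
    · by_cases h1 : v = x
      · subst h1; simp [hqx.symm, hxy', hxz', hox, Finset.card_pair hyz]
      by_cases h2 : v = y
      · subst h2; simp [hqy.symm, h1, hyz, hoy]
      by_cases h3 : v = z
      · subst h3; simp [hqz.symm, h1, h2, hoz]
      by_cases h4 : v = q
      · subst h4; simp [h1, h2, h3, heq]
      simp [h1, h2, h3, h4]
    · intro u h h'
      rw [sdiff_adj] at h'
      rcases (edge_adj_iff hqy).1 h with ⟨rfl, _⟩ | ⟨_, rfl⟩
      exacts [hq _ h'.1, hq _ h'.1.symm]
  have hmem : ∀ a b, H.Adj a b → IsEven H b → b = z := by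
    intro a b hab hb
    rcases (hpar b).1 hb with h | ⟨h1, h2⟩
    · exact h
    · rw [hH, sup_adj, sdiff_adj, edge_adj_iff hqy] at hab
      rcases hab with h | ⟨_, rfl⟩ | ⟨_, h⟩
      exacts [(hiso b h1 a h.1.symm).elim, (hiso b h1 x hxy.symm).elim, (h2 h).elim]
  have hadm : IsAdmissible H := by
    refine isAdmissible_of_evenNbrs_eq_empty fun v hv => ?_
    rw [Finset.eq_empty_iff_forall_notMem]
    intro u hu
    obtain ⟨h1, h2⟩ := mem_evenNbrs.1 hu
    have h3 := hmem v u h1 h2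
    have h4 := hmem u v h1.symm hv
    exact h1.ne (h4.trans h3.symm)
  have hxH : ¬ IsEven H x := fun h => by
    rcases (hpar x).1 h with h | h
    exacts [hxz' h, hiso x h.1 y hxy]
  have hyH : ¬ IsEven H y := fun h => by
    rcases (hpar y).1 h with h | h
    exacts [hyz h, hiso y h.1 x hxy.symm]
  have h1 := (ih H hsize hadm).odd.move z x hxz'.symm (fun h => by
      rw [hHadj z x hqz.symm hqx.symm] at h
      exact h.2 (Or.inr ((edge_adj_iff hxz').2 (Or.inr ⟨rfl, rfl⟩))))
    (H' := H ⊔ edge z x) (by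
      have : zeroNbrs H (oddInd H) z = ∅ := by
        rw [Finset.eq_empty_iff_forall_notMem]
        intro a ha
        obtain ⟨h1, h2⟩ := mem_zeroNbrs.1 ha
        exact h1.ne (hmem z a h1 (oddInd_eq_zero.1 h2)).symm
      rw [this, oddInd_eq_one hxH]; norm_num) rfl
  have hGxy : G \ edge x y = (H ⊔ edge z x) \ edge q y := by
    ext a b
    rw [hH, hJ]
    simp only [sdiff_adj, sup_adj, edge_adj_iff hxy', edge_adj_iff hxz', edge_adj_iff hxz'.symm,
      edge_adj_iff hqy]
    clear h1
    constructor
    · rintro ⟨h1, h2⟩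
      refine ⟨?_, ?_⟩
      · by_cases h3 : a = x ∧ b = z ∨ a = z ∧ b = x
        · exact Or.inr h3.symm
        · exact Or.inl (Or.inl ⟨h1, fun h => h.elim h2 h3⟩)
      · rintro (⟨rfl, _⟩ | ⟨_, rfl⟩)
        · exact hq b h1
        · exact hq a h1.symm
    · rintro ⟨(⟨h1, h2⟩ | h1) | h1, h2⟩
      · exact ⟨h1, fun h => h2 (Or.inl h)⟩
      · exact (h2 h1).elim
      · rcases h1 with ⟨rfl, rfl⟩ | ⟨rfl, rfl⟩
        · exact ⟨hxz.symm, by rintro (⟨h, _⟩ | ⟨h, _⟩); exacts [hxz' h.symm, hyz h.symm]⟩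
        · exact ⟨hxz, by rintro (⟨_, h⟩ | ⟨h, _⟩); exacts [hyz h.symm, hxy' h]⟩
  have h2 := h1.remove_leaf (q := q) (y := y) (fun u => by
    rw [sup_adj, hqH, edge_adj_iff hxz'.symm]; simp [hqz, hqx]) hGxy
  refine (h2.move x y hxy' (fun h => ?_) (H' := G) ?_ ?_).mono fun a => Nat.zero_le _
  · rw [sdiff_adj] at h
    exact h.2 ((edge_adj_iff hxy').2 (Or.inl ⟨rfl, rfl⟩))
  · have : zeroNbrs (G \ edge x y) (shift (shift (oddInd H) x z) q y) x = ∅ := by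
      rw [Finset.eq_empty_iff_forall_notMem]
      intro a ha
      obtain ⟨h3, h4⟩ := mem_zeroNbrs.1 ha
      rw [sdiff_adj] at h3
      have haq : a ≠ q := fun e => hq x (e ▸ h3.1.symm)
      unfold shift at h4
      split_ifs at h4 with e1 e2 e3
      · exact h3.1.ne e3.symm
      · rcases (hpar a).1 (oddInd_eq_zero.1 h4) with h | h
        exacts [e2 h, hiso a h.1 x h3.1.symm]
    rw [this]
    simp [shift]
  · rw [sdiff_sup_cancel (edge_le hxy)]

end Detach

/-! ### Adding an isolated vertex. -/

section Transfer

open Finset SimpleGraph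
open scoped Classical

variable {V : Type*}

theorem consec_map {W : Type*} {f : V → W} (hf : Function.Injective f) {l : List V} {u v : V} :
    Consec (l.map f) (f u) (f v) ↔ Consec l u v := by
  have h : ∀ u v : V, [f u, f v] <:+: l.map f ↔ [u, v] <:+: l := by
    intro u v
    rw [List.infix_map_iff]
    constructor
    · rintro ⟨l', h1, h2⟩
      rwa [← List.map_injective_iff.2 hf (a₁ := [u, v]) (a₂ := l') h2] at h1
    · exact fun h => ⟨_, h, rfl⟩
  rw [Consec, Consec, h, h]

/-- A list that contains the isolated vertex contains nothing else, so it carries no edge and can be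
emptied. -/
theorem exists_list_of_isolated_none {l : List (Option V)} (hl : l.Nodup)
    (h : ∀ u, ¬ Consec l none u) :
    ∃ l' : List V, l'.Nodup ∧ ∀ u v, Consec l' u v ↔ Consec l (some u) (some v) := by
  by_cases hn : none ∈ l
  · refine ⟨[], List.nodup_nil, fun u v => ?_⟩
    obtain ⟨s, t, rfl⟩ := List.append_of_mem hn
    obtain rfl : t = [] := by
      cases t with
      | nil => rfl
      | cons a t => exact (h a (Or.inl ⟨s, t, by simp⟩)).elim
    obtain rfl : s = [] := by
      rcases List.eq_nil_or_concat' s with rfl | ⟨s, a, rfl⟩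
      · rfl
      · exact (h a (Or.inr ⟨s, [], by simp⟩)).elim
    simp [consec_cons, not_consec_nil]
  · obtain ⟨l', rfl⟩ : ∃ l' : List V, l'.map some = l := by
      refine ⟨l.filterMap id, ?_⟩
      rw [List.map_filterMap_some_eq_filter_map_isSome]
      rw [List.map_id, List.filter_eq_self]
      intro a ha
      cases a with
      | none => exact (hn ha).elim
      | some a => rfl
    exact ⟨l', hl.of_map, fun u v => (consec_map (Option.some_injective V)).symm⟩

theorem map_some_adj {G : SimpleGraph V} {u v : V} :
    (G.map some).Adj (some u) (some v) ↔ G.Adj u v :=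
  SimpleGraph.map_adj_apply (f := Function.Embedding.some)

theorem not_map_some_adj_none {G : SimpleGraph V} (u : Option V) :
    ¬ (G.map some).Adj none u := by
  rintro ⟨_, a, b, _, h, _⟩
  exact Option.some_ne_none a h

theorem Realizable.of_map_some {N : ℕ} {G : SimpleGraph V}
    (h : Realizable N (G.map some) 0) : Realizable N G 0 := by
  obtain ⟨k, p, hp, hk, _⟩ := h
  have hadj : ∀ u v, G.Adj u v ↔ ∃ i, Consec (p i) (some u) (some v) := by
    intro u v
    rw [← hp.adj_iff, map_some_adj]
  have hnone : ∀ i u, ¬ Consec (p i) none u := fun i u hi =>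
    not_map_some_adj_none u ((hp.adj_iff none u).2 ⟨i, hi⟩)
  choose q hq1 hq2 using fun i => exists_list_of_isolated_none (hp.nodup i) (hnone i)
  refine ⟨k, q, ⟨hq1, fun u v => ?_, fun i j u v hi hj => ?_⟩, hk, fun v => Nat.zero_le _⟩
  · simp only [hadj, hq2]
  · exact hp.unique i j _ _ ((hq2 i u v).1 hi) ((hq2 j u v).1 hj)

theorem Realizable.mono_left {N N' : ℕ} {H : SimpleGraph V} {m : V → ℕ} (h : Realizable N H m)
    (hN : N ≤ N') : Realizable N' H m := by
  obtain ⟨k, p, h1, h2, h3⟩ := h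
  exact ⟨k, p, h1, h2.trans hN, h3⟩

/-- Since 2 * k is even, one additional vertex gains nothing over an even number. -/
theorem Realizable.of_add_one {N : ℕ} {H : SimpleGraph V} {m : V → ℕ}
    (h : Realizable (N + 1) H m) (hN : Even N) : Realizable N H m := by
  obtain ⟨k, p, h1, h2, h3⟩ := h
  obtain ⟨r, rfl⟩ := hN
  exact ⟨k, p, h1, by omega, h3⟩

variable [Fintype V]

theorem degree_eq_card_nbrs (G : SimpleGraph V) [DecidableRel G.Adj] (v : V) :
    G.degree v = #(nbrs G v) := by
  rw [← card_neighborFinset_eq_degree]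
  congr 1
  ext u; simp

theorem even_card_not_isEven (G : SimpleGraph V) : Even #{v | ¬ IsEven G v} := by
  have h := G.even_card_odd_degree_vertices
  simp only [degree_eq_card_nbrs, ← Nat.not_even_iff_odd] at h
  convert h
  exact Iff.rfl

theorem nbrs_map_some (G : SimpleGraph V) (v : V) :
    nbrs (G.map some) (some v) = (nbrs G v).map Function.Embedding.some := by
  ext u
  cases u with
  | none => simpa using fun h : (G.map some).Adj (some v) none => not_map_some_adj_none _ h.symm
  | some u => simp [map_some_adj]

theorem nbrs_map_some_none (G : SimpleGraph V) : nbrs (G.map some) none = ∅ := by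
  ext u; simp [not_map_some_adj_none]

theorem size_map_some (G : SimpleGraph V) : size (G.map some) = size G := by
  simp [size, Fintype.sum_option, nbrs_map_some, nbrs_map_some_none]

end Transfer

/-! ### The induction for admissible graphs. -/

section Induction

open Finset SimpleGraph
open scoped Classical

universe u

/-- The case of a graph whose vertices of even degree are isolated. -/
theorem realizable_of_forall_isolated {V : Type u} [Fintype V] {G : SimpleGraph V}
    (ih : ∀ (W : Type u) [Fintype W] (H : SimpleGraph W), size H < size G → IsAdmissible H →
      Realizable (Fintype.card W) H 0)
    (hiso : ∀ v, IsEven G v → ∀ u, ¬ G.Adj v u) : Realizable (Fintype.card V) G 0 := by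
  by_cases h1 : ∀ v, #(nbrs G v) ≤ 1
  · refine (realizable_size G).mono_left ?_
    simpa [size] using Finset.sum_le_card_nsmul univ _ 1 fun v _ => h1 v
  push Not at h1
  obtain ⟨x, hx⟩ := h1
  obtain ⟨y, hy, z, hz, hyz⟩ := Finset.one_lt_card.1 hx
  rw [mem_nbrs] at hy hz
  by_cases h2 : ∃ q, IsEven G q
  · obtain ⟨q, hq⟩ := h2
    exact realizable_of_isolated hiso (ih V) hy hz hyz (hiso q hq)
  push Not at h2
  -- All degrees are odd, so the number of vertices is even and an added isolated vertex is free.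
  -- This is why the induction has to range over all vertex types.
  refine (Realizable.of_map_some ?_).of_add_one (N := Fintype.card V) ?_
  · refine realizable_of_isolated (G := G.map some) (q := none) ?_ ?_
      (map_some_adj.2 hy) (map_some_adj.2 hz) (by simpa using hyz) ?_
    · intro v hv u huv
      cases v with
      | none => exact not_map_some_adj_none u huv
      | some v =>
        rw [IsEven, nbrs_map_some, Finset.card_map] at hv
        exact h2 v hv
    · intro H hH hadm
      rw [size_map_some] at hH
      simpa using ih (Option V) H hH hadm
    · exact not_map_some_adj_none
  · have := even_card_not_isEven G
    rwa [Finset.filter_true_of_mem fun v _ => h2 v, Finset.card_univ] at this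

/-- If no reduction applies, non-isolated vertices of E have degree 2 there. A neighbour `a` of `u`
whose other neighbour differed from the other neighbour of `u` would give a reducible path, so the
component closes up to a triangle. -/
theorem hasSmallParts_or_realizable {V : Type u} [Fintype V] {G : SimpleGraph V}
    (hG : IsAdmissible G)
    (ih : ∀ H : SimpleGraph V, size H < size G → IsAdmissible H →
      Realizable (Fintype.card V) H 0) :
    HasSmallParts G ∨ Realizable (Fintype.card V) G 0 := by
  rw [or_iff_not_imp_right]
  intro hcon
  have h2 : ∀ u, IsEven G u → #(evenNbrs G u) ≤ 2 := by
    intro u hu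
    by_contra h
    exact hcon (realizable_of_exists_three hG ih hu (by have := hG.1 u hu; omega))
  have h02 : ∀ u, IsEven G u → (evenNbrs G u).Nonempty → #(evenNbrs G u) = 2 := by
    intro u hu hne
    by_contra h
    have h3 := h2 u hu
    have h4 := hne.card_pos
    obtain ⟨y, hy⟩ := Finset.card_eq_one.1 (by omega : #(evenNbrs G u) = 1)
    exact hcon (realizable_of_leaf hG ih h2 hu hy)
  have hpair : ∀ u a b, evenNbrs G u = {a, b} → a ≠ b → IsEven G u →
      evenNbrs G a = {u, b} := by
    intro u a b hab hne hu
    have ha : a ∈ evenNbrs G u := by simp [hab]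
    have hua := mem_evenNbrs.1 ha
    have hu' : u ∈ evenNbrs G a := mem_evenNbrs.2 ⟨hua.1.symm, hu⟩
    have h3 := h02 a hua.2 ⟨u, hu'⟩
    obtain ⟨t, ht⟩ := Finset.card_eq_one.1 (show #((evenNbrs G a).erase u) = 1 by
      rw [Finset.card_erase_of_mem hu', h3])
    have h4 : evenNbrs G a = {u, t} := by rw [← Finset.insert_erase hu', ht]
    have htu : t ≠ u := Finset.ne_of_mem_erase (ht ▸ Finset.mem_singleton_self t)
    by_cases htb : t = b
    · rwa [htb] at h4
    · exact (hcon (realizable_of_path hG ih h2 htu hne htb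
        (by rw [h4, Finset.pair_comm]) hab)).elim
  intro u hu
  by_cases hne : (evenNbrs G u).Nonempty
  · right
    obtain ⟨a, b, hab, h3⟩ := Finset.card_eq_two.1 (h02 u hu hne)
    have ha := hpair u a b h3 hab hu
    have hb := hpair u b a (by rw [h3, Finset.pair_comm]) hab.symm hu
    have hua : G.Adj u a ∧ IsEven G a := mem_evenNbrs.1 (by simp [h3])
    have hub : G.Adj u b ∧ IsEven G b := mem_evenNbrs.1 (by simp [h3])
    have h4 := hua.1.ne
    have h5 := hub.1.ne
    rw [h3]
    refine ⟨Finset.card_eq_three.2 ⟨u, a, b, h4, h5, hab, rfl⟩, fun v hv => ?_⟩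
    simp only [Finset.mem_insert, Finset.mem_singleton] at hv
    rcases hv with rfl | rfl | rfl
    · refine ⟨hu, ?_⟩
      rw [h3]; ext c; simp only [Finset.mem_erase, Finset.mem_insert, Finset.mem_singleton]; grind
    · refine ⟨hua.2, ?_⟩
      rw [ha]; ext c; simp only [Finset.mem_erase, Finset.mem_insert, Finset.mem_singleton]; grind
    · refine ⟨hub.2, ?_⟩
      rw [hb]; ext c; simp only [Finset.mem_erase, Finset.mem_insert, Finset.mem_singleton]; grind
  · exact Or.inl (Finset.not_nonempty_iff_eq_empty.1 hne)

/-- A triangle supplies the odd vertex `w` that witnesses its goodness. If `w` is stuck, it has two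
neighbours in the triangle, so the second clause of `IsGood` holds and gives an odd neighbour `v`
away from the triangle; either `v` itself or the edge `wv` is reducible. -/
theorem IsAdmissible.realizable {V : Type u} [Fintype V] {G : SimpleGraph V}
    (hG : IsAdmissible G) : Realizable (Fintype.card V) G 0 := by
  induction hk : size G using Nat.strong_induction_on generalizing V G with
  | _ k ihk =>
    have ihU : ∀ (W : Type u) [Fintype W] (H : SimpleGraph W), size H < size G →
        IsAdmissible H → Realizable (Fintype.card W) H 0 :=
      fun W _ H hH hadm => ihk _ (hk ▸ hH) hadm rfl
    have ih := ihU V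
    rcases hasSmallParts_or_realizable hG ih with hsp | h
    swap
    · exact h
    by_cases hT : ∃ T, IsEvenTriangle G T
    · obtain ⟨T, hT⟩ := hT
      obtain ⟨w, hw, x, hx, hwx, hor⟩ := hG.2 T hT
      have hxw : x ∈ evenNbrs G w := mem_evenNbrs.2 ⟨hwx, (hT.2 x hx).1⟩
      by_cases hst : IsStuck G w
      · obtain ⟨T', hT', h1, h2⟩ := hst
        obtain rfl := hT.eq_of_mem hT' hx (h1 hxw)
        rcases hor with h3 | ⟨v, hwv, hvT, hv⟩
        · have h4 : evenNbrs G w ⊆ {x} := fun y hy =>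
            Finset.mem_singleton.2 (h3 y (h1 hy) (mem_evenNbrs.1 hy).1)
          have h5 := Finset.card_le_card h4
          rw [Finset.card_singleton] at h5
          omega
        · have hvo : ¬ IsEven G v := fun h => hvT (h1 (mem_evenNbrs.2 ⟨hwv, h⟩))
          by_cases hv' : evenNbrs G v = ∅ ∨ IsStuck G v
          · exact realizable_of_isStuck hG ih hsp hw hT h1 h2 hwv hv hvo hv'
          · push Not at hv'
            exact realizable_of_not_isStuck hG ih hsp hvo hv'.1 hv'.2
      · exact realizable_of_not_isStuck hG ih hsp hw ⟨x, hxw⟩ hst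
    · have hiso : ∀ u, IsEven G u → evenNbrs G u = ∅ := fun u hu =>
        (hsp u hu).resolve_right fun h => hT ⟨_, h⟩
      by_cases h0 : ∀ v, IsEven G v → ∀ u, ¬ G.Adj v u
      · exact realizable_of_forall_isolated ihU h0
      · push Not at h0
        obtain ⟨u, hu, w, huw⟩ := h0
        have hw : ¬ IsEven G w := fun h => by
          have : w ∈ evenNbrs G u := mem_evenNbrs.2 ⟨huw, h⟩
          rw [hiso u hu] at this
          simp at this
        exact realizable_of_not_isStuck hG ih hsp hw ⟨u, mem_evenNbrs.2 ⟨huw.symm, hu⟩⟩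
          fun ⟨T, h, _⟩ => hT ⟨T, h⟩

end Induction

/-! ### From admissible graphs to the path number of connected graphs. -/

section PathNumber

open Finset SimpleGraph
open scoped Classical

variable {V : Type*}

theorem exists_subgraph_of_list {G : SimpleGraph V} {l : List V} (hl : l.Nodup)
    (h : ∀ u v, Consec l u v → G.Adj u v) :
    ∃ P : G.Subgraph, (l ≠ [] → P.IsPathSubgraph) ∧
      ∀ u v, s(u, v) ∈ P.edgeSet ↔ Consec l u v := by
  by_cases hne : l = []
  · exact ⟨⊥, fun h => (h hne).elim, fun u v => by simp [hne, not_consec_nil]⟩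
  · have hchain : l.IsChain G.Adj :=
      List.isChain_iff_forall_rel_of_append_cons_cons.2 fun a b s t e =>
        h a b (Or.inl ⟨s, t, by simp [e]⟩)
    refine ⟨(Walk.ofSupport l hne hchain).toSubgraph, fun _ => ⟨_, _, _, ?_, rfl⟩, fun u v => ?_⟩
    · rwa [Walk.isPath_def, Walk.support_ofSupport]
    · rw [Walk.mem_edges_toSubgraph, ← Walk.infix_support_iff_mem_edges, Walk.support_ofSupport,
        Consec]

theorem IsPathFamily.exists_isPathDecomposition {ι : Type*} [Fintype ι] {G : SimpleGraph V}
    {p : ι → List V} (h : IsPathFamily G p) :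
    ∃ D : Finset G.Subgraph, G.IsPathDecomposition D ∧ #D ≤ Fintype.card ι := by
  choose P hP1 hP2 using fun i => exists_subgraph_of_list (G := G) (h.nodup i)
    fun u v hi => (h.adj_iff u v).2 ⟨i, hi⟩
  -- Empty lists are dropped: they carry no edge and give no path of `G`.
  refine ⟨({i | p i ≠ []} : Finset ι).image P, ⟨?_, ?_, ?_⟩, ?_⟩
  · intro Q hQ
    obtain ⟨i, hi, rfl⟩ := Finset.mem_image.1 hQ
    exact hP1 i (Finset.mem_filter.1 hi).2
  · intro Q hQ R hR hne
    obtain ⟨i, _, rfl⟩ := Finset.mem_image.1 hQ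
    obtain ⟨j, _, rfl⟩ := Finset.mem_image.1 hR
    refine Set.disjoint_left.2 fun e he he' => ?_
    induction e with
    | _ u v => exact hne (congrArg P (h.unique i j u v ((hP2 i u v).1 he) ((hP2 j u v).1 he')))
  · intro e he
    induction e with
    | _ u v =>
      obtain ⟨i, hi⟩ := (h.adj_iff u v).1 he
      refine ⟨P i, Finset.mem_image_of_mem P (Finset.mem_filter.2 ⟨Finset.mem_univ i, ?_⟩),
        (hP2 i u v).2 hi⟩
      exact List.ne_nil_of_mem hi.mem_left
  · exact Finset.card_image_le.trans (Finset.card_le_univ _)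

theorem Realizable.two_mul_pathNumber_le {N : ℕ} {G : SimpleGraph V} {m : V → ℕ}
    (h : Realizable N G m) : 2 * G.pathNumber ≤ N := by
  obtain ⟨k, p, hp, hk, _⟩ := h
  obtain ⟨D, hD, hcard⟩ := hp.exists_isPathDecomposition
  have h1 : G.pathNumber ≤ #D := Nat.sInf_le ⟨D, hD, rfl⟩
  rw [Fintype.card_fin] at hcard
  omega

variable [Fintype V]

theorem card_evenNbrs_le_maxDegree (G : SimpleGraph V) [DecidableRel G.Adj] {v : V}
    (hv : IsEven G v) : #(evenNbrs G v) ≤ G.evenSubgraph.maxDegree := by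
  have hiff : ∀ u, Even (G.degree u) ↔ IsEven G u := fun u => by rw [degree_eq_card_nbrs, IsEven]
  refine le_trans (le_of_eq ?_)
    (degree_le_maxDegree G.evenSubgraph ⟨v, (hiff v).2 hv⟩)
  rw [← card_neighborFinset_eq_degree,
    ← Finset.card_map (Function.Embedding.subtype fun u => Even (G.degree u))]
  congr 1
  ext u
  simp [mem_evenNbrs, hiff]

/-- If the triangle `T` is not good, then `T` dominates the graph. -/
theorem IsEvenTriangle.dominates {G : SimpleGraph V} (hconn : G.Connected) {T : Finset V}
    (hT : IsEvenTriangle G T) (hgood : ¬ IsGood G T) (v : V) :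
    v ∈ T ∨ ∃ u ∈ T, G.Adj v u := by
  obtain ⟨x, hx⟩ := Finset.card_pos.1 (by rw [hT.1]; norm_num : 0 < #T)
  obtain ⟨p⟩ := hconn.preconnected v x
  induction p with
  | nil => exact Or.inl hx
  | @cons a b _ hab _ ih =>
    rcases ih hx with hb | ⟨y, hy, hby⟩
    · exact Or.inr ⟨b, hb, hab⟩
    · by_cases hbT : b ∈ T
      · exact Or.inr ⟨b, hbT, hab⟩
      by_contra hcon
      push Not at hcon
      -- Domination spreads along the walk: at the first failure `a`, the dominated vertex `b` is
      -- odd and its neighbour `a` makes `T` good.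
      exact hgood ⟨b, fun h => hbT (hT.mem_of_adj hy hby.symm h), y, hy, hby,
        Or.inr ⟨a, hab.symm, hcon⟩⟩

/-- The extra 1 is needed only if some triangle is not good. Then it dominates `G` and contains
every even vertex, so the order is odd, and one of its edges is split off as a path of its own. -/
theorem realizable_card_add_one {G : SimpleGraph V} (hconn : G.Connected)
    (h3 : ∀ v, IsEven G v → #(evenNbrs G v) ≤ 3) : Realizable (Fintype.card V + 1) G 0 := by
  by_cases hG : ∀ T, IsEvenTriangle G T → IsGood G T
  · exact (IsAdmissible.realizable ⟨h3, hG⟩).mono_left (Nat.le_succ _)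
  push Not at hG
  obtain ⟨T, hT, hgood⟩ := hG
  have hodd : ∀ v, IsEven G v ↔ v ∈ T := by
    refine fun v => ⟨fun hv => ?_, fun hv => (hT.2 v hv).1⟩
    rcases hT.dominates hconn hgood v with h | ⟨u, hu, hvu⟩
    exacts [h, hT.mem_of_adj hu hvu.symm hv]
  have hcard : Odd (Fintype.card V) := by
    have h1 := even_card_not_isEven G
    have h2 := Finset.card_filter_add_card_filter_not (s := (univ : Finset V)) (IsEven G)
    have h4 : ({v | IsEven G v} : Finset V) = T := by ext v; simp [hodd]
    rw [h4, hT.1, Finset.card_univ] at h2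
    rw [← h2, add_comm]
    exact h1.add_odd (by decide)
  obtain ⟨x, hx, y, hy, hxy⟩ := Finset.one_lt_card.1 (by rw [hT.1]; norm_num : 1 < #T)
  have hGxy := hT.adj hx hy hxy
  have hev : ∀ v, IsEven (G \ edge x y) v → v ∈ (T.erase x).erase y := by
    intro v hv
    rw [isEven_sdiff (edge_le hGxy), nbrs_edge hxy, hodd] at hv
    by_cases h1 : v = x
    · subst h1; simp [hx] at hv
    by_cases h2 : v = y
    · subst h2; simp [hy, h1] at hv
    rw [if_neg h1, if_neg h2] at hv
    simpa [h1, h2] using hv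
  have hsub : #((T.erase x).erase y) = 1 := by
    rw [Finset.card_erase_of_mem (Finset.mem_erase.2 ⟨hxy.symm, hy⟩), Finset.card_erase_of_mem hx,
      hT.1]
  have hadm : IsAdmissible (G \ edge x y) := by
    refine isAdmissible_of_evenNbrs_eq_empty fun v hv => ?_
    rw [Finset.eq_empty_iff_forall_notMem]
    intro u hu
    obtain ⟨h1, h2⟩ := mem_evenNbrs.1 hu
    exact h1.ne (Finset.card_le_one.1 hsub.le v (hev v hv) u (hev u h2))
  obtain ⟨r, hr⟩ := hcard
  have h1 := hadm.realizable
  rw [hr] at h1 ⊢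
  -- With 2r + 1 vertices the remainder needs at most r paths, and the deleted edge is one more.
  have h2 := (h1.of_add_one (even_two_mul r)).new_path x y hxy (by
    simp [sdiff_adj, edge_adj_iff hxy])
  rwa [sdiff_sup_cancel (edge_le hGxy)] at h2

end PathNumber

theorem mainTheorem4 {V : Type*} [Fintype V] (G : SimpleGraph V) [DecidableRel G.Adj]
    (hconn : G.Connected) (hdeg : G.evenSubgraph.maxDegree ≤ 3) :
    G.pathNumber ≤ ⌈(Fintype.card V : ℚ) / 2⌉₊ := by
  have h1 := (realizable_card_add_one hconn fun v hv =>
    (card_evenNbrs_le_maxDegree G hv).trans hdeg).two_mul_pathNumber_le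
  have h2 := Nat.le_ceil ((Fintype.card V : ℚ) / 2)
  rw [div_le_iff₀ two_pos] at h2
  have h3 : Fintype.card V ≤ ⌈(Fintype.card V : ℚ) / 2⌉₊ * 2 := by exact_mod_cast h2
  omega
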